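/- Let $q$ be odd, let $\mathbb F_q\subset\mathbb F_{q^2}$ be finite fields, and for a matrix $A=(a_{ij})$ over $\mathbb F_{q^2}$ put $A^*=(a_{ji}^q)$. Let $J_m$ be the $m\times m$ matrix with ones on the second diagonal and zeros elsewhere, $U(m)=\{g\in GL(m,\mathbb F_{q^2}): g^*J_mg=J_m\}$ and $\mathfrak u(m)=\{X: X^*J_m+J_mX=0\}$, on which $U(m)$ acts by conjugation. Let $\widetilde{\mathcal T}_{2n}$ be the set of $U(2n)$-orbits in $\mathfrak u(2n)$. **Graphs.** For a graph graded by $\mathbb Z_{\ge0}$ with finite levels $V_n$ and edge weights $\tau(w,v)$, $w\in V_{n+1}$, $v\in V_n$ ($\tau=0$ off the edges), $\mathrm{Harm}_{\ge0}$ denotes the convex cone of functions $F\ge0$ on the vertices with $F(v)=\sum_{w\in V_{n+1}}\tau(w,v)F(w)$ for all $n\ge0$, $v\in V_n$. * $\Gamma^{\mathbb{UB}}$ has levels $V_n=\widetilde{\mathcal T}_{2n}$ and weights $K^{n+1}_n(\lambda,\mu)=\#\{(x,y)\in\mathbb F_{q^2}^{2n}\times\mathbb F_{q^2}: y^q=-y,\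 \begin{bmatrix}0&-x^*J_{2n}&y\\0&X_\mu&x\\0&0&0\end{bmatrix}\in\lambda\}$, where $X_\mu\in\mu$ is any representative. $\Gamma^{\mathbb{UB}}_0$ is its part formed by the nilpotent orbits. * For $\nu$ a partition and $-1<s<0$ let $\widetilde Q_\nu(;s)=(-1)^{\sum_i(i-1)\nu_i}Q_\nu(;s)$, where $Q_\nu(;s)$ is the Hall–Littlewood $Q$-symmetric function with parameter $s$, and let $\xi_{\lambda/\mu}(s)$ be the coefficients in $(1-s^2)p_2\,\widetilde Q_\mu(;s)=\sum_{|\lambda|=|\mu|+2}\xi_{\lambda/\mu}(s)\,\widetilde Q_\lambda(;s)$, with $p_2$ the power sum. The graph $\mathbb Y^{HL}_{\mathscr E}(-q^{-1})$ has the partitions of $2n$ on level $n$; its edges join $\mu\subset\lambda$ whenever $\lambda\setminus\mu$ consists of two boxes in one column or in two adjacent columns, with weight $\xi_{\lambda/\mu}(-q^{-1})$. **Functionals.** Let $\mathcal C(\mathfrak g)$ be the real vector space of real functions on $\mathfrak g$ constant on orbits, $A_{q^2}=\bigoplus_{n\ge0}\mathcal C(\mathfrak{gl}(n,\mathbb F_{q^2}))$,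 $B_{q^2}=\bigoplus_{n\ge0}\mathcal C(\mathfrak u(2n))$. Let $\widetilde\nabla:A_{q^2}\otimes B_{q^2}\to B_{q^2}$ be the linear map which on $\mathcal C(\mathfrak{gl}(i,\mathbb F_{q^2}))\otimes\mathcal C(\mathfrak u(2j))$ is parabolic induction to $\mathcal C(\mathfrak u(2n))$, $n=i+j$: $$\widetilde\nabla(a\otimes b)(X)=\sum_{gP\in U(2n)/P}\Phi(g^{-1}Xg),$$ where $P\subset U(2n)$ is the subgroup of block upper-triangular matrices with diagonal blocks of sizes $i,2j,i$, and $\Phi(Y)=a(Y_{11})\,b(Y_{22})$ if $Y\in\mathfrak u(2n)$ is block upper-triangular with diagonal blocks $Y_{11},Y_{22},Y_{33}$ of these sizes, $\Phi(Y)=0$ otherwise. Let $\tilde x_1\in\mathcal C(\mathfrak{gl}(1,\mathbb F_{q^2}))$ be the indicator function of the zero matrix. Let $\widetilde{\mathcal F}(B_{q^2})$ be the convex cone of linear functionals $\psi:B_{q^2}\to\mathbb R$ that are nonnegative on the indicator functions of all orbits in $\bigsqcup_n\widetilde{\mathcal T}_{2n}$ and satisfy $\psi(b)=\psi(\widetilde\nabla(\tilde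 x_1\otimes b))$ for all $b\in B_{q^2}$; let $\widetilde{\mathcal F}_0(B_{q^2})$ be the subcone of those vanishing on the indicator functions of all non-nilpotent orbits. **Proposition.** $\mathrm{Harm}_{\ge0}(\Gamma^{\mathbb{UB}})$ and $\widetilde{\mathcal F}(B_{q^2})$ are isomorphic as convex cones. Also, $\mathrm{Harm}_{\ge0}(\Gamma^{\mathbb{UB}}_0)$, $\mathrm{Harm}_{\ge0}(\mathbb Y^{HL}_{\mathscr E}(-q^{-1}))$ and $\widetilde{\mathcal F}_0(B_{q^2})$ are isomorphic as convex cones. -/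

import Mathlib

open scoped DirectSum TensorProduct Matrix

noncomputable section

namespace UB

/-! ## Graded graphs with edge weights and their cones of positive harmonic functions -/

/-- A (possibly disconnected) graph graded by `ℕ`, with finite levels `V n`, and with a weight
`weight n w v` for `w` on level `n + 1` and `v` on level `n`; the weight is `0` exactly when there
is no edge between `w` and `v`. -/
structure GradedGraph where
  V : ℕ → Type*
  fintypeV : ∀ n, Fintype (V n)
  weight : ∀ n, V (n + 1) → V n → ℝ

attribute [instance] GradedGraph.fintypeV

/-- The convex cone of positive harmonic functions on a weighted graded graph. -/
def GradedGraph.harm (Γ : GradedGraph) : PointedCone ℝ ((n : ℕ) → Γ.V n → ℝ) where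
  carrier := {F | (∀ n v, 0 ≤ F n v) ∧
    ∀ n v, F n v = ∑ w : Γ.V (n + 1), Γ.weight n w v * F (n + 1) w}
  zero_mem' := by simp
  add_mem' := by
    rintro F G ⟨hF, hF'⟩ ⟨hG, hG'⟩
    refine ⟨fun n v => add_nonneg (hF n v) (hG n v), fun n v => ?_⟩
    simp only [Pi.add_apply, mul_add, Finset.sum_add_distrib]
    rw [← hF' n v, ← hG' n v]
  smul_mem' := by
    rintro c F ⟨hF, hF'⟩
    refine ⟨fun n v => mul_nonneg c.2 (hF n v), fun n v => ?_⟩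
    change (c : ℝ) * F n v = ∑ w, Γ.weight n w v * ((c : ℝ) * F (n + 1) w)
    rw [hF' n v, Finset.mul_sum]
    exact Finset.sum_congr rfl fun w _ => by ring

/-! ## Unitary groups over a finite field and their Lie algebras

`k` is the field with `q` elements and `K` its quadratic extension with `q ^ 2` elements. -/

section Unitary

variable (k K : Type*) [Field k] [Fintype k] [Field K] [Algebra k K]

/-- The matrix `J_n` with ones on the second diagonal. -/
def J (n : ℕ) : Matrix (Fin n) (Fin n) K := fun r s => if s = r.rev then 1 else 0

/-- The involution `x ↦ x ^ q` of `K`, where `q` is the number of elements of `k`. -/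
abbrev conj : K →ₐ[k] K := FiniteField.frobeniusAlgHom k K

variable {K} in
/-- `A^*`: raise all entries to the power `q` and transpose. -/
def adj {m n : Type*} (A : Matrix m n K) : Matrix n m K := (A.map (conj k K))ᵀ

variable {K} in
lemma adj_mul {l m n : Type*} [Fintype m] (A : Matrix l m K) (B : Matrix m n K) :
    adj k (A * B) = adj k B * adj k A := by
  simp only [adj, Matrix.map_mul, Matrix.transpose_mul]

lemma adj_one (n : ℕ) : adj k (1 : Matrix (Fin n) (Fin n) K) = 1 := by
  simp [adj]

variable {K} in
lemma J_mul {n : ℕ} {m : Type*} (A : Matrix (Fin n) m K) (r : Fin n) (s : m) :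
    (J K n * A) r s = A r.rev s := by
  simp [Matrix.mul_apply, J]

variable {K} in
lemma mul_J {n : ℕ} {m : Type*} (A : Matrix m (Fin n) K) (r : m) (s : Fin n) :
    (A * J K n) r s = A r s.rev := by
  have : ∀ t : Fin n, (s = t.rev) ↔ (t = s.rev) := fun t =>
    ⟨fun h => by simp [h], fun h => by simp [h]⟩
  simp [Matrix.mul_apply, J, this]

lemma J_mul_J (n : ℕ) : J K n * J K n = 1 := by
  ext r s
  rw [J_mul]
  simp [J, Matrix.one_apply, eq_comm]

/-- The unitary group `U(n, 𝔽_{q²})`. -/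
def unitary (n : ℕ) : Subgroup (GL (Fin n) K) where
  carrier := {g | adj k g.1 * J K n * g.1 = J K n}
  one_mem' := by simp [adj_one]
  mul_mem' := by
    intro g h hg hh
    simp only [Set.mem_ofPred_eq] at *
    rw [Units.val_mul, adj_mul]
    calc adj k h.1 * adj k g.1 * J K n * (g.1 * h.1)
        = adj k h.1 * (adj k g.1 * J K n * g.1) * h.1 := by simp only [Matrix.mul_assoc]
      _ = J K n := by rw [hg, hh]
  inv_mem' := by
    intro g hg
    simp only [Set.mem_ofPred_eq] at *
    have h1 : g.1 * (g⁻¹).1 = 1 := by rw [← Units.val_mul]; simp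
    have h2 : adj k (g⁻¹).1 * adj k g.1 = 1 := by rw [← adj_mul, h1, adj_one]
    calc adj k (g⁻¹).1 * J K n * (g⁻¹).1
        = adj k (g⁻¹).1 * (adj k g.1 * J K n * g.1) * (g⁻¹).1 := by rw [hg]
      _ = (adj k (g⁻¹).1 * adj k g.1) * J K n * (g.1 * (g⁻¹).1) := by
          simp only [Matrix.mul_assoc]
      _ = J K n := by rw [h1, h2]; simp

/-- The Lie algebra `𝔲(n, 𝔽_{q²})` of the unitary group. -/
def lie (n : ℕ) : AddSubgroup (Matrix (Fin n) (Fin n) K) where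
  carrier := {X | adj k X * J K n + J K n * X = 0}
  zero_mem' := by
    simp only [Set.mem_ofPred_eq]
    ext r s
    simp [adj]
  add_mem' := by
    intro X Y hX hY
    simp only [Set.mem_ofPred_eq] at *
    have : adj k (X + Y) = adj k X + adj k Y := by ext r s; simp [adj, -FiniteField.frobeniusAlgHom_apply]
    rw [this, Matrix.add_mul, Matrix.mul_add, add_add_add_comm, hX, hY, add_zero]
  neg_mem' := by
    intro X hX
    simp only [Set.mem_ofPred_eq] at *
    have : adj k (-X) = -adj k X := by ext r s; simp [adj, -FiniteField.frobeniusAlgHom_apply]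
    rw [this, Matrix.neg_mul, Matrix.mul_neg, ← neg_add, hX, neg_zero]

variable {K}

lemma mem_lie_iff {n : ℕ} {X : Matrix (Fin n) (Fin n) K} :
    X ∈ lie k K n ↔ ∀ r s, X r s = -conj k K (X s.rev r.rev) := by
  change adj k X * J K n + J K n * X = 0 ↔ _
  constructor
  · intro h r s
    have := congrFun (congrFun h r.rev) s
    rw [Matrix.add_apply, mul_J, J_mul, Fin.rev_rev, Matrix.zero_apply] at this
    exact eq_neg_of_add_eq_zero_right this
  · intro h
    ext r s
    rw [Matrix.add_apply, mul_J, J_mul, h r.rev s, Fin.rev_rev, Matrix.zero_apply]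
    simp [adj]

/-- The adjoint action `Ad(g) X = g X g⁻¹`. -/
def Ad {n : ℕ} (g : unitary k K n) (X : lie k K n) : lie k K n :=
  ⟨g.1.1 * X.1 * (g.1⁻¹).1, by
    have hX : adj k X.1 * J K n + J K n * X.1 = 0 := X.2
    have hg : adj k g.1.1 * J K n * g.1.1 = J K n := g.2
    have hg' : adj k (g.1⁻¹).1 * J K n * (g.1⁻¹).1 = J K n := (g⁻¹).2
    have h1 : g.1.1 * (g.1⁻¹).1 = 1 := by rw [← Units.val_mul]; simp
    have h1' : (g.1⁻¹).1 * g.1.1 = 1 := by rw [← Units.val_mul]; simp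
    change adj k _ * J K n + J K n * _ = 0
    have e1 : adj k g.1.1 * J K n = J K n * (g.1⁻¹).1 := by
      rw [← hg, Matrix.mul_assoc _ g.1.1, h1, Matrix.mul_one, hg]
    have e2 : J K n * g.1.1 = adj k (g.1⁻¹).1 * J K n := by
      conv_lhs => rw [← hg']
      rw [Matrix.mul_assoc _ (g.1⁻¹).1, h1', Matrix.mul_one]
    rw [adj_mul, adj_mul]
    calc _ = adj k (g.1⁻¹).1 * (adj k X.1 * (adj k g.1.1 * J K n))
          + (J K n * g.1.1) * X.1 * (g.1⁻¹).1 := by simp only [Matrix.mul_assoc]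
      _ = adj k (g.1⁻¹).1 * (adj k X.1 * J K n + J K n * X.1) * (g.1⁻¹).1 := by
          rw [e1, e2]; simp only [Matrix.mul_add, Matrix.add_mul, Matrix.mul_assoc]
      _ = 0 := by rw [hX]; simp⟩

lemma Ad_one {n : ℕ} (X : lie k K n) : Ad k 1 X = X := by
  apply Subtype.ext; simp [Ad]

lemma Ad_mul {n : ℕ} (g h : unitary k K n) (X : lie k K n) :
    Ad k (g * h) X = Ad k g (Ad k h X) := by
  apply Subtype.ext; simp [Ad, Matrix.mul_assoc]

variable (K)

/-- Two elements of the Lie algebra are equivalent if they are in the same orbit. -/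
def orbitSetoid (n : ℕ) : Setoid (lie k K n) where
  r X Y := ∃ g : unitary k K n, Ad k g X = Y
  iseqv := by
    refine ⟨fun X => ⟨1, Ad_one k X⟩, ?_, ?_⟩
    · rintro X Y ⟨g, rfl⟩
      exact ⟨g⁻¹, by rw [← Ad_mul, inv_mul_cancel, Ad_one]⟩
    · rintro X Y Z ⟨g, rfl⟩ ⟨h, rfl⟩
      exact ⟨h * g, Ad_mul k h g X⟩

/-- The set of `U(n, 𝔽_{q²})`-orbits in `𝔲(n, 𝔽_{q²})`. -/
abbrev Orbits (n : ℕ) := Quotient (orbitSetoid k K n)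

variable {K} in
/-- The orbit of an element of the Lie algebra. -/
abbrev orbit {n : ℕ} (X : lie k K n) : Orbits k K n := Quotient.mk (orbitSetoid k K n) X

variable {K} in
/-- An orbit is nilpotent if it consists of nilpotent matrices. -/
def IsNilp {n : ℕ} (o : Orbits k K n) : Prop := ∀ X : lie k K n, orbit k X = o → IsNilpotent X.1

section Finite

variable [Fintype K]

instance (n : ℕ) : Fintype (Orbits k K n) := Fintype.ofFinite _

open Classical in
instance (n : ℕ) : Fintype {o : Orbits k K n // IsNilp k o} := Fintype.ofFinite _

end Finite

/-! ## The graph of `𝕌𝔹`-invariant measures and its nilpotent component -/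

variable {K}

/-- The `(2n+2) × (2n+2)` matrix with rows `(0, -x^* J, y)`, `(0, X, x)`, `(0, 0, 0)`. -/
def extend {n : ℕ} (X : Matrix (Fin (2 * n)) (Fin (2 * n)) K) (x : Fin (2 * n) → K) (y : K) :
    Matrix (Fin (2 * (n + 1))) (Fin (2 * (n + 1))) K :=
  let xs : Matrix (Fin (2 * n)) (Fin 1) K := Matrix.replicateCol (Fin 1) x
  Matrix.of <| Fin.cons (n := 2 * n + 1) (α := fun _ => Fin (2 * n + 1 + 1) → K)
    (Fin.cons 0 (Fin.snoc (n := 2 * n) (α := fun _ => K) ((-(adj k xs * J K (2 * n))) 0) y))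
    (Fin.snoc (n := 2 * n) (α := fun _ => Fin (2 * n + 1 + 1) → K)
      (fun r => Fin.cons 0 (Fin.snoc (n := 2 * n) (α := fun _ => K) (X r) (x r)))
      0)

/-- The number `K^{n+1}_n(λ, μ)` of pairs `(x, y)` with `y ^ q = -y` such that the extension of a
representative of `μ` by `(x, y)` belongs to the orbit `λ`. -/
def link {n : ℕ} (lam : Orbits k K (2 * (n + 1))) (mu : Orbits k K (2 * n)) : ℕ :=
  Nat.card {p : (Fin (2 * n) → K) × K // conj k K p.2 = -p.2 ∧
    ∃ h : extend k mu.out.1 p.1 p.2 ∈ lie k K (2 * (n + 1)), orbit k ⟨_, h⟩ = lam}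

variable (K)

/-- The graph `Γ^{𝕌𝔹}`. -/
def graphUB [Fintype K] : GradedGraph where
  V n := Orbits k K (2 * n)
  fintypeV _ := inferInstance
  weight _ lam mu := link k lam mu

/-- The graph `Γ₀^{𝕌𝔹}`: the part of `Γ^{𝕌𝔹}` formed by the nilpotent orbits. -/
def graphUB₀ [Fintype K] : GradedGraph where
  V n := {o : Orbits k K (2 * n) // IsNilp k o}
  fintypeV _ := inferInstance
  weight _ lam mu := link k lam.1 mu.1

/-! ## Spaces of invariant functions -/

/-- Invariant functions on `𝔤𝔩(n, K)`. -/
def invGL (n : ℕ) : Submodule ℝ (Matrix (Fin n) (Fin n) K → ℝ) where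
  carrier := {f | ∀ (g : GL (Fin n) K) (X : Matrix (Fin n) (Fin n) K),
    f (g.1 * X * (g⁻¹).1) = f X}
  zero_mem' := by simp
  add_mem' := by
    intro f g hf hg h X
    rw [Pi.add_apply, Pi.add_apply, hf, hg]
  smul_mem' := by
    intro c f hf h X
    rw [Pi.smul_apply, Pi.smul_apply, hf]

/-- Invariant functions on `𝔲(n, 𝔽_{q²})`. -/
def invU (n : ℕ) : Submodule ℝ (lie k K n → ℝ) where
  carrier := {f | ∀ (g : unitary k K n) (X : lie k K n), f (Ad k g X) = f X}
  zero_mem' := by simp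
  add_mem' := by
    intro f g hf hg h X
    rw [Pi.add_apply, Pi.add_apply, hf, hg]
  smul_mem' := by
    intro c f hf h X
    rw [Pi.smul_apply, Pi.smul_apply, hf]

/-- The graded space `A_{q²}`. -/
abbrev A := ⨁ n : ℕ, invGL K n

/-- The graded space `B_{q²}`, with `𝒞(𝔲(2n, 𝔽_{q²}))` in degree `n`. -/
abbrev B := ⨁ n : ℕ, invU k K (2 * n)

/-! ## Parabolic induction from `𝔤𝔩(i) ⊕ 𝔲(2j)` to `𝔲(2(i + j))` -/

section Parabolic

variable (i j : ℕ)

/-- The block (`0`, `1` or `2`) of an index, for the partition `2(i+j) = i + 2j + i`. -/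
def blk (r : Fin (2 * (i + j))) : ℕ :=
  if (r : ℕ) < i then 0 else if (r : ℕ) < i + 2 * j then 1 else 2

/-- Inclusion of the indices of the first block. -/
def topIdx (r : Fin i) : Fin (2 * (i + j)) := ⟨r, by omega⟩

/-- Inclusion of the indices of the middle block. -/
def midIdx (r : Fin (2 * j)) : Fin (2 * (i + j)) := ⟨i + r, by omega⟩

lemma topIdx_spec : Function.Injective (topIdx i j) ∧
    ∀ r, blk i j r = 0 ↔ r ∈ Set.range (topIdx i j) := by
  refine ⟨fun r s h => ?_, fun r => ⟨fun h => ?_, ?_⟩⟩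
  · simpa [topIdx, Fin.ext_iff] using h
  · unfold blk at h
    split_ifs at h with h1
    exact ⟨⟨r, h1⟩, rfl⟩
  · rintro ⟨s, rfl⟩
    simp [blk, topIdx]

lemma midIdx_spec : Function.Injective (midIdx i j) ∧
    ∀ r, blk i j r = 1 ↔ r ∈ Set.range (midIdx i j) := by
  refine ⟨fun r s h => ?_, fun r => ⟨fun h => ?_, ?_⟩⟩
  · simpa [midIdx, Fin.ext_iff] using h
  · unfold blk at h
    split_ifs at h with h1 h2 <;> try omega
    exact ⟨⟨r - i, by omega⟩, by simp only [midIdx, Fin.ext_iff]; omega⟩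
  · rintro ⟨s, rfl⟩
    have := s.2
    simp [blk, midIdx]

lemma midIdx_rev (r : Fin (2 * j)) : midIdx i j r.rev = (midIdx i j r).rev := by
  have := r.2
  simp only [midIdx, Fin.ext_iff, Fin.val_rev]
  omega

variable {K} {i j}

/-- The diagonal blocks of block triangular matrices multiply. -/
lemma block_mul {m : ℕ} {e : Fin m → Fin (2 * (i + j))} {c : ℕ}
    (he : Function.Injective e ∧ ∀ r, blk i j r = c ↔ r ∈ Set.range e)
    {M N : Matrix (Fin (2 * (i + j))) (Fin (2 * (i + j))) K}
    (hM : M.BlockTriangular (blk i j)) (hN : N.BlockTriangular (blk i j)) :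
    (M * N).submatrix e e = M.submatrix e e * N.submatrix e e := by
  ext r s
  simp only [Matrix.submatrix_apply, Matrix.mul_apply]
  symm
  refine Fintype.sum_of_injective e he.1 _ _ (fun l hl => ?_) (fun _ => rfl)
  have hl' : blk i j l ≠ c := fun h => hl ((he.2 l).1 h)
  have hr : blk i j (e r) = c := (he.2 _).2 ⟨r, rfl⟩
  have hs : blk i j (e s) = c := (he.2 _).2 ⟨s, rfl⟩
  rcases lt_or_gt_of_ne hl' with h | h
  · rw [hM (by rw [hr]; exact h), zero_mul]
  · rw [hN (by rw [hs]; exact h), mul_zero]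

lemma block_one {m : ℕ} {e : Fin m → Fin (2 * (i + j))} (he : Function.Injective e) :
    (1 : Matrix (Fin (2 * (i + j))) (Fin (2 * (i + j))) K).submatrix e e = 1 :=
  Matrix.submatrix_one e he

variable (K) (i j)

/-- The parabolic subgroup `P̃_{i,j} = L̃_{i,j} Ũ_{i,j}` of `U(2(i+j), 𝔽_{q²})`: the block
upper-triangular unitary matrices for the block sizes `i`, `2j`, `i`. -/
def parabolic : Subgroup (unitary k K (2 * (i + j))) where
  carrier := {g | g.1.1.BlockTriangular (blk i j)}
  one_mem' := Matrix.blockTriangular_one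
  mul_mem' := by
    intro g h hg hh
    exact Matrix.BlockTriangular.mul hg hh
  inv_mem' := by
    intro g hg
    change (g.1⁻¹).1.BlockTriangular (blk i j)
    rw [Matrix.coe_units_inv]
    have : Invertible g.1.1 := g.1.invertible
    exact Matrix.blockTriangular_inv_of_blockTriangular hg

variable {K} {i j}

/-- The `𝔤𝔩(i)`-component of an element of the parabolic subalgebra. -/
def topBlock (X : lie k K (2 * (i + j))) : Matrix (Fin i) (Fin i) K :=
  X.1.submatrix (topIdx i j) (topIdx i j)

/-- The `𝔲(2j)`-component of an element of the parabolic subalgebra. -/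
def midBlock (X : lie k K (2 * (i + j))) : lie k K (2 * j) :=
  ⟨X.1.submatrix (midIdx i j) (midIdx i j), by
    rw [mem_lie_iff]
    intro r s
    simp only [Matrix.submatrix_apply, midIdx_rev]
    exact (mem_lie_iff k).1 X.2 _ _⟩

open Classical in
/-- The function `a ⊗ b` on the Levi subalgebra `𝔤𝔩(i) ⊕ 𝔲(2j)`, extended to the parabolic
subalgebra of block upper-triangular matrices through the projection onto the diagonal blocks,
and by `0` outside of it. -/
def inflate (a : Matrix (Fin i) (Fin i) K → ℝ) (b : lie k K (2 * j) → ℝ)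
    (X : lie k K (2 * (i + j))) : ℝ :=
  if X.1.BlockTriangular (blk i j) then a (topBlock k X) * b (midBlock k X) else 0

lemma blockTriangular_Ad {p : unitary k K (2 * (i + j))} (hp : p ∈ parabolic k K i j)
    {X : lie k K (2 * (i + j))} (hX : X.1.BlockTriangular (blk i j)) :
    (Ad k p X).1.BlockTriangular (blk i j) := by
  have h2 : (p.1⁻¹).1.BlockTriangular (blk i j) := (parabolic k K i j).inv_mem hp
  exact Matrix.BlockTriangular.mul (Matrix.BlockTriangular.mul hp hX) h2

lemma inflate_Ad (a : invGL K i) (b : invU k K (2 * j)) {p : unitary k K (2 * (i + j))}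
    (hp : p ∈ parabolic k K i j) (X : lie k K (2 * (i + j))) :
    inflate k a.1 b.1 (Ad k p X) = inflate k a.1 b.1 X := by
  have hp1 : p.1.1.BlockTriangular (blk i j) := hp
  have hp2 : (p.1⁻¹).1.BlockTriangular (blk i j) := (parabolic k K i j).inv_mem hp
  by_cases hX : X.1.BlockTriangular (blk i j)
  swap
  · have : ¬ (Ad k p X).1.BlockTriangular (blk i j) := by
      intro h
      apply hX
      have := blockTriangular_Ad k ((parabolic k K i j).inv_mem hp) h
      rwa [← Ad_mul, inv_mul_cancel, Ad_one] at this
    rw [inflate, inflate, if_neg hX, if_neg this]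
  rw [inflate, inflate, if_pos hX, if_pos (blockTriangular_Ad k hp hX)]
  have q1 : p.1.1 * (p.1⁻¹).1 = 1 := by rw [← Units.val_mul]; simp
  have q2 : (p.1⁻¹).1 * p.1.1 = 1 := by rw [← Units.val_mul]; simp
  have conjBlock : ∀ {m : ℕ} {e : Fin m → Fin (2 * (i + j))} {c : ℕ},
      (Function.Injective e ∧ ∀ r, blk i j r = c ↔ r ∈ Set.range e) →
      (Ad k p X).1.submatrix e e =
        p.1.1.submatrix e e * X.1.submatrix e e * (p.1⁻¹).1.submatrix e e := by
    intro m e c he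
    change (p.1.1 * X.1 * (p.1⁻¹).1).submatrix e e = _
    rw [block_mul he (Matrix.BlockTriangular.mul hp1 hX) hp2, block_mul he hp1 hX]
  have unit : ∀ {m : ℕ} {e : Fin m → Fin (2 * (i + j))} {c : ℕ},
      (Function.Injective e ∧ ∀ r, blk i j r = c ↔ r ∈ Set.range e) →
      ∃ g : GL (Fin m) K, g.1 = p.1.1.submatrix e e ∧ (g⁻¹).1 = (p.1⁻¹).1.submatrix e e := by
    intro m e c he
    refine ⟨⟨p.1.1.submatrix e e, (p.1⁻¹).1.submatrix e e, ?_, ?_⟩, rfl, rfl⟩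
    · rw [← block_mul he hp1 hp2, q1, block_one he.1]
    · rw [← block_mul he hp2 hp1, q2, block_one he.1]
  congr 1
  · obtain ⟨g, hg, hg'⟩ := unit (topIdx_spec i j)
    have : topBlock k (Ad k p X) = g.1 * topBlock k X * (g⁻¹).1 := by
      rw [hg, hg']; exact conjBlock (topIdx_spec i j)
    rw [this]
    exact a.2 g _
  · obtain ⟨g, hg, hg'⟩ := unit (midIdx_spec i j)
    -- the inverse of a unitary matrix `p` is `J p^* J`
    have inv_eq : (p.1⁻¹).1 = J K _ * (adj k p.1.1 * J K _) := by
      have hu : adj k p.1.1 * J K _ * p.1.1 = J K _ := p.2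
      calc (p.1⁻¹).1 = J K _ * J K _ * (p.1⁻¹).1 := by rw [J_mul_J, Matrix.one_mul]
        _ = J K _ * (adj k p.1.1 * J K _ * p.1.1) * (p.1⁻¹).1 := by rw [hu]
        _ = J K _ * (adj k p.1.1 * J K _) * (p.1.1 * (p.1⁻¹).1) := by
            simp only [Matrix.mul_assoc]
        _ = _ := by rw [q1, Matrix.mul_one]
    have hinv : (g⁻¹).1 = J K (2 * j) * (adj k g.1 * J K (2 * j)) := by
      ext r s
      rw [hg', hg, J_mul, mul_J, Matrix.submatrix_apply, inv_eq, J_mul, mul_J]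
      simp [adj, midIdx_rev]
    have hgU : g ∈ unitary k K (2 * j) := by
      change adj k g.1 * J K _ * g.1 = J K _
      have h3 : (g⁻¹).1 * g.1 = 1 := by rw [← Units.val_mul]; simp
      calc adj k g.1 * J K _ * g.1
          = J K _ * J K _ * (adj k g.1 * J K _ * g.1) := by rw [J_mul_J, Matrix.one_mul]
        _ = J K _ * ((J K (2 * j) * (adj k g.1 * J K (2 * j))) * g.1) := by
            simp only [Matrix.mul_assoc]
        _ = J K _ := by rw [← hinv, h3, Matrix.mul_one]
    have : midBlock k (Ad k p X) = Ad k ⟨g, hgU⟩ (midBlock k X) := by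
      apply Subtype.ext
      change (Ad k p X).1.submatrix _ _ = g.1 * X.1.submatrix _ _ * (g⁻¹).1
      rw [hg, hg']; exact conjBlock (midIdx_spec i j)
    rw [this]
    exact b.2 ⟨g, hgU⟩ _

/-- The value on a coset does not depend on the chosen representative. -/
lemma inflate_out (a : invGL K i) (b : invU k K (2 * j)) (g : unitary k K (2 * (i + j)))
    (X : lie k K (2 * (i + j))) :
    inflate k a.1 b.1
      (Ad k (QuotientGroup.mk g : unitary k K (2 * (i + j)) ⧸ parabolic k K i j).out⁻¹ X) =
    inflate k a.1 b.1 (Ad k g⁻¹ X) := by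
  obtain ⟨p, hp⟩ := QuotientGroup.mk_out_eq_mul (parabolic k K i j) g
  rw [hp, mul_inv_rev, Ad_mul]
  exact inflate_Ad k a b ((parabolic k K i j).inv_mem p.2) _

variable [Fintype K]

instance : Fintype (unitary k K (2 * (i + j)) ⧸ parabolic k K i j) := Fintype.ofFinite _

/-- Parabolic induction of `a ⊗ b`: the sum of the inflated function over representatives of the
left cosets of the parabolic subgroup. -/
def induce (a : Matrix (Fin i) (Fin i) K → ℝ) (b : lie k K (2 * j) → ℝ)
    (X : lie k K (2 * (i + j))) : ℝ :=
  ∑ c : unitary k K (2 * (i + j)) ⧸ parabolic k K i j, inflate k a b (Ad k c.out⁻¹ X)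

lemma induce_mem (a : invGL K i) (b : invU k K (2 * j)) :
    induce k a.1 b.1 ∈ invU k K (2 * (i + j)) := by
  intro h X
  unfold induce
  refine Fintype.sum_equiv (MulAction.toPerm h⁻¹) _ _ (fun c => ?_)
  induction c using QuotientGroup.induction_on with
  | H g =>
    change _ = inflate k a.1 b.1 (Ad k (QuotientGroup.mk (h⁻¹ * g) :
      unitary k K (2 * (i + j)) ⧸ parabolic k K i j).out⁻¹ X)
    rw [inflate_out, inflate_out, ← Ad_mul, mul_inv_rev, inv_inv]

variable (K) (i j)

/-- Parabolic induction `𝒞(𝔤𝔩(i)) ⊗ 𝒞(𝔲(2j)) → 𝒞(𝔲(2(i+j)))` as a bilinear map. -/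
def induceLin : invGL K i →ₗ[ℝ] invU k K (2 * j) →ₗ[ℝ] invU k K (2 * (i + j)) :=
  LinearMap.mk₂ ℝ (fun a b => ⟨induce k a.1 b.1, induce_mem k a b⟩)
    (by
      intro a a' b
      ext X
      simp only [Submodule.coe_add, Pi.add_apply, induce, ← Finset.sum_add_distrib]
      refine Finset.sum_congr rfl fun c _ => ?_
      unfold inflate
      split_ifs <;> simp [add_mul])
    (by
      intro r a b
      ext X
      simp only [Submodule.coe_smul, Pi.smul_apply, induce, Finset.smul_sum]
      refine Finset.sum_congr rfl fun c _ => ?_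
      unfold inflate
      split_ifs <;> simp [mul_assoc])
    (by
      intro a b b'
      ext X
      simp only [Submodule.coe_add, Pi.add_apply, induce, ← Finset.sum_add_distrib]
      refine Finset.sum_congr rfl fun c _ => ?_
      unfold inflate
      split_ifs <;> simp [mul_add])
    (by
      intro r a b
      ext X
      simp only [Submodule.coe_smul, Pi.smul_apply, induce, Finset.smul_sum]
      refine Finset.sum_congr rfl fun c _ => ?_
      unfold inflate
      split_ifs <;> simp [mul_left_comm])

end Parabolic

variable [Fintype K]

/-- The graded map `∇̃ : A_{q²} ⊗ B_{q²} → B_{q²}` whose component on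
`𝒞(𝔤𝔩(i)) ⊗ 𝒞(𝔲(2j))` is parabolic induction to `𝒞(𝔲(2(i+j)))`. -/
def nablaTilde : A K ⊗[ℝ] B k K →ₗ[ℝ] B k K :=
  TensorProduct.lift <| DirectSum.toModule ℝ ℕ (B k K →ₗ[ℝ] B k K) fun i =>
    (DirectSum.toModule ℝ ℕ (invGL K i →ₗ[ℝ] B k K) fun j =>
      ((induceLin k K i j).compr₂
        (DirectSum.lof ℝ ℕ (fun n => invU k K (2 * n)) (i + j))).flip).flip

/-! ## The cones of positive harmonic functionals -/

variable {K} in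
open Classical in
/-- The indicator function `χ_o` of a unitary orbit in `𝔲(2n, 𝔽_{q²})`, as an element of
`B_{q²}`. -/
def chi {n : ℕ} (o : Orbits k K (2 * n)) : B k K :=
  DirectSum.lof ℝ ℕ (fun n => invU k K (2 * n)) n
    ⟨fun X => if orbit k X = o then 1 else 0, by
      intro g X
      have : orbit k (Ad k g X) = orbit k X := (Quotient.sound (s := orbitSetoid k K (2 * n)) (show ∃ h, Ad k h X = Ad k g X from ⟨g, rfl⟩)).symm
      simp only [this]⟩

open Classical in
/-- The indicator function `x̃₁` of the `1 × 1` zero matrix, as an element of `A_{q²}`. -/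
def xOne : A K :=
  DirectSum.lof ℝ ℕ (fun n => invGL K n) 1
    ⟨fun X => if X = 0 then 1 else 0, by
      intro g X
      have : g.1 * X * (g⁻¹).1 = 0 ↔ X = 0 := by
        rw [Units.mul_left_eq_zero, Units.mul_right_eq_zero]
      simp only [this]⟩

/-- The cone `ℱ̃(B_{q²})` of positive harmonic functionals. -/
def functionals : PointedCone ℝ (Module.Dual ℝ (B k K)) where
  carrier := {ψ | (∀ (n : ℕ) (o : Orbits k K (2 * n)), 0 ≤ ψ (chi k o)) ∧
    ∀ b : B k K, ψ b = ψ (nablaTilde k K (xOne K ⊗ₜ[ℝ] b))}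
  zero_mem' := by simp
  add_mem' := by
    rintro φ ψ ⟨h1, h2⟩ ⟨h3, h4⟩
    refine ⟨fun n o => add_nonneg (h1 n o) (h3 n o), fun b => ?_⟩
    rw [LinearMap.add_apply, LinearMap.add_apply, ← h2 b, ← h4 b]
  smul_mem' := by
    rintro c ψ ⟨h1, h2⟩
    refine ⟨fun n o => mul_nonneg c.2 (h1 n o), fun b => ?_⟩
    change (c : ℝ) * ψ b = (c : ℝ) * ψ _
    rw [← h2 b]

/-- The nilpotent subcone `ℱ̃₀(B_{q²})`: functionals in `ℱ̃(B_{q²})` vanishing on the indicator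
functions of the orbits that are not nilpotent. -/
def functionals₀ : PointedCone ℝ (Module.Dual ℝ (B k K)) where
  carrier := {ψ | ψ ∈ functionals k K ∧
    ∀ (n : ℕ) (o : Orbits k K (2 * n)), ¬ IsNilp k o → ψ (chi k o) = 0}
  zero_mem' := ⟨zero_mem _, by simp⟩
  add_mem' := by
    rintro φ ψ ⟨h1, h2⟩ ⟨h3, h4⟩
    exact ⟨add_mem h1 h3, fun n o ho => by rw [LinearMap.add_apply, h2 n o ho, h4 n o ho, add_zero]⟩
  smul_mem' := by
    rintro c ψ ⟨h1, h2⟩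
    refine ⟨Submodule.smul_mem _ c h1, fun n o ho => ?_⟩
    change (c : ℝ) * ψ _ = 0
    rw [h2 n o ho, mul_zero]

end Unitary

/-! ## Hall–Littlewood symmetric functions

A symmetric function `f` is recorded by the family of its restrictions `f(x_1, …, x_N)` to finitely
many variables, `N = 0, 1, 2, …`; this embeds the algebra of symmetric functions in the product of
the fields of rational functions `ℝ(x_1, …, x_N)`. -/

section HallLittlewood

/-- The field `ℝ(x_1, …, x_N)`. -/
abbrev RatFun (N : ℕ) := FractionRing (MvPolynomial (Fin N) ℝ)

/-- The variable `x_i`. -/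
def var {N : ℕ} (i : Fin N) : RatFun N :=
  algebraMap (MvPolynomial (Fin N) ℝ) (RatFun N) (MvPolynomial.X i)

/-- The power sum `p_m`. -/
def powerSum (m : ℕ) : (N : ℕ) → RatFun N := fun _ => ∑ i, var i ^ m

/-- `φ_m(t) = (1 - t)(1 - t²) ⋯ (1 - t^m)`. -/
def hlPhi (t : ℝ) (m : ℕ) : ℝ := ∏ i ∈ Finset.range m, (1 - t ^ (i + 1))

/-- `v_m(t) = φ_m(t) / (1 - t)^m`. -/
def hlv (t : ℝ) (m : ℕ) : ℝ := ∏ i ∈ Finset.range m, ((1 - t ^ (i + 1)) / (1 - t))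

/-- The multiplicity `m_i(ν)` of `i ≥ 1` as a part of `ν`. -/
def mult (ν : YoungDiagram) (i : ℕ) : ℕ := ν.rowLens.count i

/-- `R_ν(x_1, …, x_N; t) = ∑_{w ∈ S_N} w(x^ν ∏_{i<j} (x_i - t x_j) / (x_i - x_j))`. -/
def hlR (t : ℝ) (ν : YoungDiagram) (N : ℕ) : RatFun N :=
  ∑ w : Equiv.Perm (Fin N), (∏ i : Fin N, var (w i) ^ ν.rowLen i) *
    ∏ p : Fin N × Fin N with p.1 < p.2,
      ((var (w p.1) - t • var (w p.2)) / (var (w p.1) - var (w p.2)))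

/-- The Hall–Littlewood function `P_ν(; t)`: for `N ≥ ℓ(ν)`, its restriction to `N` variables is
`R_ν / ∏_{i ≥ 0} v_{m_i}(t)`, where `m_0 = N - ℓ(ν)`; for `N < ℓ(ν)` it is `0`. -/
def hlP (t : ℝ) (ν : YoungDiagram) : (N : ℕ) → RatFun N := fun N =>
  if ν.rowLens.length ≤ N then
    (hlv t (N - ν.rowLens.length) * ∏ i ∈ Finset.Icc 1 ν.card, hlv t (mult ν i))⁻¹ • hlR t ν N
  else 0

/-- The Hall–Littlewood function `Q_ν(; t) = b_ν(t) P_ν(; t)`, `b_ν(t) = ∏_{i ≥ 1} φ_{m_i}(t)`. -/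
def hlQ (t : ℝ) (ν : YoungDiagram) : (N : ℕ) → RatFun N :=
  (∏ i ∈ Finset.Icc 1 ν.card, hlPhi t (mult ν i)) • hlP t ν

/-- `Q̃_ν(; s) = (-1)^{∑ (i-1) ν_i} Q_ν(; s)`; rows of diagrams are numbered from `0`, so the
exponent is the sum of the row numbers of the boxes. -/
def hlQtilde (s : ℝ) (ν : YoungDiagram) : (N : ℕ) → RatFun N :=
  ((-1 : ℝ) ^ (∑ c ∈ ν.cells, c.1)) • hlQ s ν

/-- `c` is the family of coefficients in the expansion of `(1 - s²) p_2 · Q̃_μ(; s)` in the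
functions `Q̃_λ(; s)`, `|λ| = |μ| + 2`. -/
def IsExpansion (s : ℝ) (μ : YoungDiagram) (c : YoungDiagram →₀ ℝ) : Prop :=
  (∀ ν ∈ c.support, ν.card = μ.card + 2) ∧
    ((1 - s ^ 2) • powerSum 2) * hlQtilde s μ = c.sum fun ν a => a • hlQtilde s ν

/-- The coefficients `ξ_{λ/μ}(s)`: the family satisfying `IsExpansion`, which is unique as the
functions `Q̃_λ(; s)` form a basis of the space of symmetric functions for `-1 < s < 0`. -/
def xi (s : ℝ) (lam μ : YoungDiagram) : ℝ := Classical.epsilon (IsExpansion s μ) lam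

/-- `μ ↗↗ λ`: `λ` is obtained from `μ` by adding two boxes, in one column or in two adjacent
columns. -/
def TwoStep (μ lam : YoungDiagram) : Prop :=
  μ ≤ lam ∧ ∃ c d : ℕ × ℕ, c ≠ d ∧ lam.cells \ μ.cells = {c, d} ∧
    (c.2 = d.2 ∨ c.2 + 1 = d.2)

lemma finite_card (n : ℕ) : Finite {ν : YoungDiagram // ν.card = n} := by
  let f : {ν : YoungDiagram // ν.card = n} →
      ((Finset.range n ×ˢ Finset.range n).powerset : Finset (Finset (ℕ × ℕ))) := fun ν =>
    ⟨ν.1.cells, by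
      rw [Finset.mem_powerset]
      rintro ⟨i, j⟩ hc
      have hij : (i, j) ∈ ν.1 := hc
      have h1 := YoungDiagram.mem_iff_lt_colLen.1
        (ν.1.up_left_mem le_rfl (Nat.zero_le j) hij)
      have h2 := YoungDiagram.mem_iff_lt_rowLen.1
        (ν.1.up_left_mem (Nat.zero_le i) le_rfl hij)
      rw [YoungDiagram.colLen_eq_card] at h1
      rw [YoungDiagram.rowLen_eq_card] at h2
      have h3 : (ν.1.col 0).card ≤ n := (Finset.card_le_card (Finset.filter_subset _ _)).trans_eq ν.2
      have h4 : (ν.1.row 0).card ≤ n := (Finset.card_le_card (Finset.filter_subset _ _)).trans_eq ν.2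
      simp only [Finset.mem_product, Finset.mem_range]
      omega⟩
  refine Finite.of_injective f fun ν μ h => ?_
  exact Subtype.ext (YoungDiagram.ext (congrArg Subtype.val h))

open Classical in
/-- The even HL-deformed Young graph with parameter `s`: partitions of `2n` on level `n`, edges
`μ ↗↗ λ` and multiplicities `ξ_{λ/μ}(s)`. -/
def evenYoungGraph (s : ℝ) : GradedGraph where
  V n := {ν : YoungDiagram // ν.card = 2 * n}
  fintypeV n := haveI := finite_card (2 * n); Fintype.ofFinite _
  weight _ lam μ := if TwoStep μ.1 lam.1 then xi s lam.1 μ.1 else 0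

end HallLittlewood

end UB

end

/-! A functional on $B_{q^2}$ is determined by its values on indicators of orbits. Inflating $\tilde
x_1\otimes\chi_\mu$ gives the indicator of the matrices with rows $(0,-x^*J,y)$, $(0,X,x)$,
$(0,0,0)$ and $X\in\mu$, exactly the extensions counted by `link`; induction then sums its
translates over the cosets of the parabolic subgroup. Pairing with an invariant function makes all
cosets contribute equally, so $\psi(\widetilde\nabla(\tilde x_1\otimes\chi_\mu))$ equals the number
of cosets times $|\mu|\sum_\lambda K(\lambda,\mu)\,\psi(\chi_\lambda)/|\lambda|$
(`apply_nablaTilde_chi`). Dividing $\psi(\chi_o)$ by $|o|$ and restoring a product of coset numbers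
(`ratio`) turns the functional equation into harmonicity. An extension is nilpotent if and only if
its middle block is, so no edge joins a nilpotent orbit to another one, and harmonic functions on
the nilpotent part extend by zero (`extendZero_mem_iff`).

The comparison with partitions has three ingredients.

Classification: a nilpotent skew-adjoint $X$ on a Hermitian space is determined up to isometry by
its Jordan type (`exists_isometry`: split off a cyclic block of maximal length, with normalized form
values). That every partition of $2n$ occurs follows from the positivity of the counts below
(`exists_orbitType_eq`).

Counting: number columns from $0$ and let $l$ be minimal with $x\in\operatorname{im}X+\ker X^l$. The
extension by $(x,y)$ adds one box to each of the columns $l,l+1$, or two boxes to column $l$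
(`jordanType_extEnd`). For $l=0$ exactly one $y$ gives the second case. For $l=j+1$, writing
$x=Xu+w$ with $X^{j+1}w=0$, the second case means $H(w,X^jw)=0$. This is a Hermitian or
skew-Hermitian form on $\ker X^{j+1}$ whose rank is the number of Jordan blocks of size $j+1$; the
number of its isotropic vectors contains a power of $-q$ (`card_isotropic`), which is where the
parameter $-q^{-1}$ comes from. The result is `sum_jordanType_extEnd`.

Symmetric functions: multiplying $R_\nu$ by $p_2$ raises one exponent by $2$ in all ways, and
exchange relations straighten the result (`raise_blocks`, `isExpansion_expansion`). The coefficients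
are unique because Hall–Littlewood polynomials are linearly independent, as seen by sending one
variable to infinity (`hlRec_linearIndependent`).

With $n(\nu)=\sum_i(i-1)\nu_i$, the number of extensions from $\mu$ to $\lambda$ is
$q^{4n+1}q^{n(\mu)-n(\lambda)}\xi_{\lambda/\mu}(-q^{-1})$ (`numA_mul_pow`, `numB_mul_pow`). The two
graphs thus differ by a positive gauge, and `nonempty_harmEquiv` applies. -/

set_option linter.unusedSectionVars false

noncomputable section
namespace UB

/-! ## Hall–Littlewood polynomials by recursion on the index list -/

section Rec

variable {F : Type*} [Field F]

/-- A function on lists of exponents obeying the exchange relations of Hall–Littlewood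
polynomials. -/
structure IsStraight (t : F) (φ : List ℕ → F) : Prop where
  one : ∀ pre a L, φ (pre ++ a :: (a + 1) :: L) = t * φ (pre ++ (a + 1) :: a :: L)
  two : ∀ pre a L, φ (pre ++ a :: (a + 2) :: L) =
    t * φ (pre ++ (a + 2) :: a :: L) + (t - 1) * φ (pre ++ (a + 1) :: (a + 1) :: L)

lemma IsStraight.append {t : F} {φ : List ℕ → F} (h : IsStraight t φ) (M : List ℕ) :
    IsStraight t (fun L => φ (M ++ L)) :=
  ⟨fun pre a L => by simpa using h.one (M ++ pre) a L,
    fun pre a L => by simpa using h.two (M ++ pre) a L⟩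

/-- `∑_i φ(L + 2 e_i)`. -/
def raise : List ℕ → (List ℕ → F) → F
  | [], _ => 0
  | a :: L, φ => φ ((a + 2) :: L) + raise L (fun M => φ (a :: M))

lemma raise_sum {ι : Type*} (s : Finset ι) (c : ι → F) (φ : ι → List ℕ → F) (L : List ℕ) :
    raise L (fun M => ∑ x ∈ s, c x * φ x M) = ∑ x ∈ s, c x * raise L (φ x) := by
  induction L generalizing φ with
  | nil => simp [raise]
  | cons a L ih => simp only [raise, ih, mul_add, Finset.sum_add_distrib]

/-- Each transposition of $a$ with $a+1$ costs one factor $t$. -/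
lemma IsStraight.move_one {t : F} {φ : List ℕ → F} (h : IsStraight t φ) (pre : List ℕ)
    (j a : ℕ) (L : List ℕ) : φ (pre ++ (List.replicate j a ++ (a + 1) :: L)) =
      t ^ j * φ (pre ++ (a + 1) :: (List.replicate j a ++ L)) := by
  induction j generalizing L with
  | zero => simp
  | succ j ih =>
    have e1 : List.replicate (j + 1) a ++ (a + 1) :: L =
        List.replicate j a ++ a :: (a + 1) :: L := by
      rw [List.replicate_succ']; simp
    have e2 : List.replicate (j + 1) a ++ L = List.replicate j a ++ a :: L := by
      rw [List.replicate_succ']; simp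
    have := h.one (pre ++ List.replicate j a) a L
    simp only [List.append_assoc] at this
    rw [e1, this, ih, e2, pow_succ]
    ring

/-- Raising the $i$-th copy (from $0$) of $a$ and sorting gives $t^i$ times the term with $a+2$,
plus multiples of the term with two entries $a+1$. The geometric sums have denominators $1-t$ and
$1-t^2$, which the factor $1-t^2$ clears. The truncated lengths $m-1$, $m-2$ are harmless because
the coefficients vanish when the block is too short. -/
lemma raise_replicate {t : F} {φ : List ℕ → F} (h : IsStraight t φ) (m a : ℕ) (L : List ℕ) :
    (1 - t ^ 2) * raise (List.replicate m a ++ L) φ =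
      (1 + t) * (1 - t ^ m) * φ ((a + 2) :: (List.replicate (m - 1) a ++ L)) -
      (1 - t ^ (m - 1)) * (1 - t ^ m) *
        φ ((a + 1) :: (a + 1) :: (List.replicate (m - 2) a ++ L)) +
      (1 - t ^ 2) * raise L (fun M => φ (List.replicate m a ++ M)) := by
  induction m generalizing φ with
  | zero => simp
  | succ m ih =>
    have ih' := ih (h.append [a])
    simp only [List.cons_append, List.nil_append] at ih'
    rw [List.replicate_succ, List.cons_append, raise, mul_add, ih']
    simp only [List.cons_append, Nat.add_sub_cancel]
    -- Blocks of one and two entries are separated, so that in the remaining case the subtraction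
    -- $m-2$ is not truncated.
    rcases m with _ | _ | m
    · simp only [List.replicate_zero, List.nil_append, pow_zero, sub_self]
      simp
      ring_nf
      simp
    · have h2 := h.two [] a L
      simp only [List.nil_append] at h2
      simp [h2]
      ring
    · have h2 := h.two [] a (List.replicate (m + 1) a ++ L)
      have h1 := h.move_one [] 1 a ((a + 1) :: (List.replicate m a ++ L))
      have h1' := h.move_one [a + 1] 1 a (List.replicate m a ++ L)
      simp only [List.nil_append, List.replicate_one,
        List.cons_append] at h1 h1' h2
      have e : m + 1 + 1 + 1 - 2 = m + 1 := by omega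
      have e' : m + 1 + 1 - 2 = m := by omega
      simp only [Nat.add_sub_cancel, e, e', List.replicate_succ, List.cons_append] at h2 ⊢
      rw [h2, h1, h1']
      ring

/-- The weakly decreasing list with entries less than `D`, in which `a` has multiplicity `m a`. -/
def blocks (m : ℕ → ℕ) : ℕ → List ℕ
  | 0 => []
  | D + 1 => List.replicate (m D) D ++ blocks m D

/-- The part of `blocks m D` formed by the entries greater than `a`. -/
def upBlocks (m : ℕ → ℕ) (a : ℕ) : ℕ → List ℕ
  | 0 => []
  | D + 1 => if a < D then List.replicate (m D) D ++ upBlocks m a D else []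

lemma blocks_split (m : ℕ → ℕ) {a D : ℕ} (h : a < D) :
    blocks m D = upBlocks m a D ++ (List.replicate (m a) a ++ blocks m a) := by
  induction D with
  | zero => omega
  | succ D ih =>
    rw [blocks, upBlocks]
    split_ifs with h1
    · rw [ih h1, List.append_assoc]
    · obtain rfl : a = D := by omega
      simp

lemma upBlocks_split (m : ℕ → ℕ) {a D : ℕ} (h : a + 1 < D) :
    upBlocks m a D = upBlocks m (a + 1) D ++ List.replicate (m (a + 1)) (a + 1) := by
  induction D with
  | zero => omega
  | succ D ih =>
    rw [upBlocks, if_pos (by omega), upBlocks]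
    split_ifs with h1
    · rw [ih h1, List.append_assoc]
    · obtain rfl : a + 1 = D := by omega
      simp [upBlocks]

lemma blocks_congr {m m' : ℕ → ℕ} {D : ℕ} (h : ∀ a < D, m a = m' a) :
    blocks m D = blocks m' D := by
  induction D with
  | zero => rfl
  | succ D ih => rw [blocks, blocks, h D (by omega), ih fun a ha => h a (by omega)]

lemma upBlocks_congr {m m' : ℕ → ℕ} {a D : ℕ} (h : ∀ b, a < b → m b = m' b) :
    upBlocks m a D = upBlocks m' a D := by
  induction D with
  | zero => rfl
  | succ D ih =>
    rw [upBlocks, upBlocks]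
    split_ifs with h1
    · rw [h D h1, ih]
    · rfl

lemma raise_blocks_aux {t : F} {φ : List ℕ → F} (h : IsStraight t φ) (m : ℕ → ℕ) (D : ℕ) :
    (1 - t ^ 2) * raise (blocks m D) φ = ∑ a ∈ Finset.range D,
      ((1 + t) * (1 - t ^ m a) * φ (upBlocks m a D ++
          ((a + 2) :: (List.replicate (m a - 1) a ++ blocks m a))) -
        (1 - t ^ (m a - 1)) * (1 - t ^ m a) * φ (upBlocks m a D ++
          ((a + 1) :: (a + 1) :: (List.replicate (m a - 2) a ++ blocks m a)))) := by
  induction D generalizing φ with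
  | zero => simp [blocks, raise]
  | succ D ih =>
    rw [blocks, raise_replicate h, ih (h.append _), Finset.sum_range_succ, add_comm]
    congr 1
    · refine Finset.sum_congr rfl fun a ha => ?_
      rw [upBlocks, if_pos (Finset.mem_range.1 ha), List.append_assoc, List.append_assoc]
    · simp [upBlocks]

/-- Multiplicities after replacing an entry `a` by `a + 2`. -/
def multA (m : ℕ → ℕ) (a b : ℕ) : ℕ :=
  if b = a then m b - 1 else if b = a + 2 then m b + 1 else m b

/-- Multiplicities after replacing two entries `a` by `a + 1`. -/
def multB (m : ℕ → ℕ) (a b : ℕ) : ℕ :=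
  if b = a then m b - 2 else if b = a + 1 then m b + 2 else m b

/-- The raised entry $a+2$ still stands to the right of the $m_{a+1}$ copies of $a+1$; moving it
past them accounts for $t^{m_{a+1}}$. The pair $(a+1,a+1)$ is already in order. Two spare levels
above $D$ leave room for raised entries. -/
lemma raise_blocks {t : F} {φ : List ℕ → F} (h : IsStraight t φ) (m : ℕ → ℕ) (D E : ℕ)
    (hm : ∀ a, D ≤ a → m a = 0) (hE : D + 2 ≤ E) :
    (1 - t ^ 2) * raise (blocks m E) φ = ∑ a ∈ Finset.range D,
      ((1 + t) * t ^ m (a + 1) * (1 - t ^ m a) * φ (blocks (multA m a) E) -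
        (1 - t ^ (m a - 1)) * (1 - t ^ m a) * φ (blocks (multB m a) E)) := by
  rw [raise_blocks_aux h]
  symm
  refine Finset.sum_subset_zero_on_sdiff (Finset.range_subset_range.2 (by omega)) ?_ ?_
  · intro a ha
    simp only [Finset.mem_sdiff, Finset.mem_range, not_lt] at ha
    simp [hm a ha.2]
  · intro a ha
    rw [Finset.mem_range] at ha
    congr 1
    · rw [upBlocks_split m (by omega : a + 1 < E), List.append_assoc,
        h.move_one (upBlocks m (a + 1) E) (m (a + 1)) (a + 1)]
      have : blocks (multA m a) E = upBlocks m (a + 1) E ++ (a + 1 + 1) ::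
          (List.replicate (m (a + 1)) (a + 1) ++ (List.replicate (m a - 1) a ++ blocks m a)) := by
        rw [blocks_split _ (by omega : a + 2 < E), blocks, blocks,
          upBlocks_split m (by omega : a + 1 + 1 < E), List.append_assoc,
          blocks_congr (m := multA m a) (m' := m) (D := a),
          upBlocks_congr (m := multA m a) (m' := m)]
        · have e0 : multA m a a = m a - 1 := by simp [multA]
          have e1 : multA m a (a + 1) = m (a + 1) := by simp [multA]
          have e2 : multA m a (a + 2) = m (a + 2) + 1 := by simp [multA]
          rw [e0, e1, e2, List.replicate_succ']
          simp
        · intro b hb; unfold multA; split_ifs <;> omega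
        · intro b hb; unfold multA; split_ifs <;> omega
      rw [this]
      ring
    · have : blocks (multB m a) E = upBlocks m a E ++ (a + 1) :: (a + 1) ::
          (List.replicate (m a - 2) a ++ blocks m a) := by
        rw [blocks_split _ (by omega : a + 1 < E), blocks,
          upBlocks_split m (by omega : a + 1 < E), List.append_assoc,
          blocks_congr (m := multB m a) (m' := m) (D := a),
          upBlocks_congr (m := multB m a) (m' := m)]
        · have e0 : multB m a a = m a - 2 := by simp [multB]
          have e1 : multB m a (a + 1) = m (a + 1) + 2 := by simp [multB]
          rw [e0, e1, List.replicate_add]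
          simp [List.replicate_succ]
        · intro b hb; unfold multB; split_ifs <;> omega
        · intro b hb; unfold multB; split_ifs <;> omega
      rw [this]

lemma count_blocks (m : ℕ → ℕ) (D a : ℕ) :
    (blocks m D).count a = if a < D then m a else 0 := by
  induction D with
  | zero => simp [blocks]
  | succ D ih =>
    rw [blocks, List.count_append, ih, List.count_replicate]
    by_cases h : D = a
    · subst h; simp
    · have : (D == a) = false := by simpa using h
      simp only [this]
      grind

lemma lt_of_mem_blocks (m : ℕ → ℕ) (D a : ℕ) (h : a ∈ blocks m D) : a < D := by
  by_contra h'
  have := count_blocks m D a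
  rw [if_neg h'] at this
  exact (List.count_eq_zero.1 this) h

lemma pairwise_blocks (m : ℕ → ℕ) (D : ℕ) : (blocks m D).Pairwise (· ≥ ·) := by
  induction D with
  | zero => simp [blocks]
  | succ D ih =>
    rw [blocks, List.pairwise_append]
    refine ⟨by simp [List.pairwise_replicate], ih, fun a ha b hb => ?_⟩
    have := lt_of_mem_blocks m D b hb
    rw [(List.mem_replicate.1 ha).2]
    omega

variable [DecidableEq F]

/-- `∏_{y ∈ S} (x - t y) / (x - y)`. -/
def hlFactor (t x : F) (S : Finset F) : F := ∏ y ∈ S, (x - t * y) / (x - y)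

/-- The polynomial `R_L` in the set of variables `S`, by expansion along the first entry of the
list `L` of exponents. -/
def hlRec (t : F) : List ℕ → Finset F → F
  | [], _ => 1
  | a :: L, S => ∑ x ∈ S, x ^ a * hlFactor t x (S.erase x) * hlRec t L (S.erase x)

lemma hlRec_cons (t : F) (a : ℕ) (L : List ℕ) (S : Finset F) :
    hlRec t (a :: L) S = ∑ x ∈ S, x ^ a * hlFactor t x (S.erase x) * hlRec t L (S.erase x) := rfl

lemma sum_sum_erase (S : Finset F) (φ : F → F → F) :
    ∑ x ∈ S, ∑ y ∈ S.erase x, φ x y = ∑ p ∈ S.offDiag, φ p.1 p.2 := by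
  rw [Finset.sum_sigma']
  refine Finset.sum_bij' (fun p _ => (p.1, p.2)) (fun p _ => ⟨p.1, p.2⟩) ?_ ?_ ?_ ?_ ?_ <;>
    simp only [Finset.mem_sigma, Finset.mem_erase, Finset.mem_offDiag] <;> grind

/-- A sum over ordered pairs of distinct elements only sees the symmetrization of its summand; twice
the sum is compared, and characteristic zero allows division by $2$. -/
lemma sum_sum_erase_congr [CharZero F] (S : Finset F) (φ ψ : F → F → F)
    (h : ∀ x ∈ S, ∀ y ∈ S, x ≠ y → φ x y + φ y x = ψ x y + ψ y x) :
    ∑ x ∈ S, ∑ y ∈ S.erase x, φ x y = ∑ x ∈ S, ∑ y ∈ S.erase x, ψ x y := by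
  have key : ∀ χ : F → F → F, 2 * ∑ x ∈ S, ∑ y ∈ S.erase x, χ x y =
      ∑ p ∈ S.offDiag, (χ p.1 p.2 + χ p.2 p.1) := by
    intro χ
    rw [sum_sum_erase, two_mul, Finset.sum_add_distrib]
    congr 1
    refine Finset.sum_bij' (fun p _ => p.swap) (fun p _ => p.swap) ?_ ?_ ?_ ?_ ?_ <;>
      simp only [Finset.mem_offDiag] <;> grind
  have h2 : (2 : F) ≠ 0 := two_ne_zero
  apply mul_left_cancel₀ h2
  rw [key, key]
  refine Finset.sum_congr rfl fun p hp => ?_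
  rw [Finset.mem_offDiag] at hp
  exact h _ hp.1 _ hp.2.1 hp.2.2

/-- The symmetric factor in the expansion of `hlRec` along its first two entries. -/
def hlSym (t : F) (L : List ℕ) (S : Finset F) (x y : F) : F :=
  hlFactor t x ((S.erase x).erase y) * hlFactor t y ((S.erase x).erase y) *
    hlRec t L ((S.erase x).erase y)

lemma hlSym_comm (t : F) (L : List ℕ) (S : Finset F) (x y : F) :
    hlSym t L S x y = hlSym t L S y x := by
  unfold hlSym
  rw [Finset.erase_right_comm]
  ring

/-- This isolates everything that is not symmetric in the first two variables $x,y$: the monomial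
and the single factor $(x-ty)/(x-y)$. -/
lemma hlRec_cons_cons (t : F) (a b : ℕ) (L : List ℕ) (S : Finset F) :
    hlRec t (a :: b :: L) S = ∑ x ∈ S, ∑ y ∈ S.erase x,
      x ^ a * y ^ b * ((x - t * y) / (x - y)) * hlSym t L S x y := by
  rw [hlRec_cons]
  refine Finset.sum_congr rfl fun x _ => ?_
  rw [hlRec_cons, Finset.mul_sum]
  refine Finset.sum_congr rfl fun y hy => ?_
  have : hlFactor t x (S.erase x) =
      (x - t * y) / (x - y) * hlFactor t x ((S.erase x).erase y) :=
    (Finset.mul_prod_erase _ _ hy).symm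
  rw [this, hlSym]
  ring

/-- A common prefix is peeled off by induction. Then `hlSym` is a common symmetric factor, and each
exchange relation becomes a rational identity in $x,y$ after symmetrization. -/
lemma isStraight_hlRec [CharZero F] (t : F) (S : Finset F) :
    IsStraight t (fun L => hlRec t L S) := by
  constructor
  · intro pre a L
    induction pre generalizing S with
    | nil =>
      simp only [List.nil_append, hlRec_cons_cons]
      rw [Finset.mul_sum]
      simp_rw [Finset.mul_sum]
      refine sum_sum_erase_congr _ _ _ fun x _ y _ hxy => ?_
      rw [hlSym_comm t L S y x]
      have h1 : x - y ≠ 0 := sub_ne_zero.2 hxy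
      have h2 : y - x ≠ 0 := sub_ne_zero.2 hxy.symm
      have h3 : y - x = -(x - y) := by ring
      rw [h3]
      field_simp
      ring
    | cons b pre ih =>
      simp only [List.cons_append, hlRec_cons, ih, Finset.mul_sum]
      exact Finset.sum_congr rfl fun x _ => by ring
  · intro pre a L
    induction pre generalizing S with
    | nil =>
      simp only [List.nil_append, hlRec_cons_cons]
      rw [Finset.mul_sum, Finset.mul_sum, ← Finset.sum_add_distrib]
      simp_rw [Finset.mul_sum, ← Finset.sum_add_distrib]
      refine sum_sum_erase_congr _ _ _ fun x _ y _ hxy => ?_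
      rw [hlSym_comm t L S y x]
      have h1 : x - y ≠ 0 := sub_ne_zero.2 hxy
      have h3 : y - x = -(x - y) := by ring
      rw [h3]
      field_simp
      ring
    | cons b pre ih =>
      simp only [List.cons_append, hlRec_cons, ih, Finset.mul_sum, ← Finset.sum_add_distrib]
      exact Finset.sum_congr rfl fun x _ => by ring

/-- Since $p_2(S)=x^2+p_2(S\setminus x)$, the power sum passes through the recursion and either
raises the current exponent or moves on to the rest. The cardinality condition ensures that no
variable is left when the list is exhausted. -/
lemma powerSum_mul_hlRec (t : F) (L : List ℕ) (S : Finset F) (h : S.card = L.length) :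
    (∑ x ∈ S, x ^ 2) * hlRec t L S = raise L (fun M => hlRec t M S) := by
  induction L generalizing S with
  | nil =>
    have : S = ∅ := Finset.card_eq_zero.1 h
    simp [this, raise]
  | cons a L ih =>
    simp only [raise, hlRec_cons]
    rw [raise_sum, Finset.mul_sum, ← Finset.sum_add_distrib]
    refine Finset.sum_congr rfl fun x hx => ?_
    rw [← ih (S.erase x) (by rw [Finset.card_erase_of_mem hx, h]; simp),
      ← Finset.add_sum_erase _ _ hx]
    ring

end Rec

/-! ## Linear independence of Hall–Littlewood polynomials -/

section Independence

open Filter Topology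

/-- The coefficient of the `d`-th power of a new variable tending to infinity. -/
def hlLead (t : ℝ) (d : ℕ) : List ℕ → Finset ℝ → ℝ
  | [], _ => 0
  | a :: L, S => (if a = d then hlRec t L S else 0) +
      t * ∑ x ∈ S, x ^ a * hlFactor t x (S.erase x) * hlLead t d L (S.erase x)

lemma tendsto_factor_left (t y : ℝ) :
    Tendsto (fun T : ℝ => (T - t * y) / (T - y)) atTop (𝓝 1) := by
  have h : Tendsto (fun T : ℝ => 1 + ((1 - t) * y) / (T - y)) atTop (𝓝 (1 + 0)) :=
    tendsto_const_nhds.add (tendsto_const_nhds.div_atTop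
      (tendsto_atTop_add_const_right _ (-y) tendsto_id))
  rw [add_zero] at h
  refine h.congr' ?_
  filter_upwards [eventually_gt_atTop y] with T hT
  have : T - y ≠ 0 := ne_of_gt (sub_pos.2 hT)
  field_simp
  ring

lemma tendsto_factor_right (t x : ℝ) :
    Tendsto (fun T : ℝ => (x - t * T) / (x - T)) atTop (𝓝 t) := by
  have h : Tendsto (fun T : ℝ => t + (-((1 - t) * x)) / (T - x)) atTop (𝓝 (t + 0)) :=
    tendsto_const_nhds.add (tendsto_const_nhds.div_atTop
      (tendsto_atTop_add_const_right _ (-x) tendsto_id))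
  rw [add_zero] at h
  refine h.congr' ?_
  filter_upwards [eventually_gt_atTop x] with T hT
  have h1 : T - x ≠ 0 := ne_of_gt (sub_pos.2 hT)
  have h2 : x - T ≠ 0 := ne_of_lt (sub_neg.2 hT)
  field_simp
  ring

lemma tendsto_hlFactor (t : ℝ) (S : Finset ℝ) :
    Tendsto (fun T : ℝ => hlFactor t T S) atTop (𝓝 1) := by
  have := tendsto_finsetProd S (fun y (_ : y ∈ S) => tendsto_factor_left t y)
  simpa [hlFactor] using this

lemma tendsto_pow_div_pow {a d : ℕ} (h : a ≤ d) :
    Tendsto (fun T : ℝ => T ^ a / T ^ d) atTop (𝓝 (if a = d then 1 else 0)) := by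
  split_ifs with h1
  · subst h1
    refine tendsto_const_nhds.congr' ?_
    filter_upwards [eventually_gt_atTop 0] with T hT
    rw [div_self (pow_ne_zero _ hT.ne')]
  · exact tendsto_pow_div_pow_atTop_zero (lt_of_le_of_ne h h1)

/-- Either the new variable carries the first exponent, or some $x\in S$ does and then only the
factor $(x-tT)/(x-T)$ involves both. -/
lemma hlRec_insert (t : ℝ) (a : ℕ) (L : List ℕ) {S : Finset ℝ} {T : ℝ} (hT : T ∉ S) :
    hlRec t (a :: L) (insert T S) = T ^ a * hlFactor t T S * hlRec t L S +
      ∑ x ∈ S, x ^ a * hlFactor t x (S.erase x) *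
        ((x - t * T) / (x - T) * hlRec t L (insert T (S.erase x))) := by
  rw [hlRec_cons, Finset.sum_insert hT, Finset.erase_insert hT]
  congr 1
  refine Finset.sum_congr rfl fun x hx => ?_
  have hne : T ≠ x := fun h => hT (h ▸ hx)
  rw [Finset.erase_insert_of_ne hne]
  have : hlFactor t x (insert T (S.erase x)) =
      (x - t * T) / (x - T) * hlFactor t x (S.erase x) :=
    Finset.prod_insert (fun h => hT (Finset.mem_of_mem_erase h))
  rw [this]
  ring

lemma tendsto_hlRec (t : ℝ) (d : ℕ) (L : List ℕ) (S : Finset ℝ) (hL : L.length = S.card + 1)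
    (hd : ∀ a ∈ L, a ≤ d) :
    Tendsto (fun T : ℝ => hlRec t L (insert T S) / T ^ d) atTop (𝓝 (hlLead t d L S)) := by
  induction L generalizing S with
  | nil => simp at hL
  | cons a L ih =>
    have hev : ∀ᶠ T : ℝ in atTop, T ∉ S := by
      filter_upwards [S.eventually_all.2 fun x _ => eventually_gt_atTop x] with T hT hTS
      exact lt_irrefl _ (hT T hTS)
    have h1 : Tendsto (fun T : ℝ => T ^ a / T ^ d * hlFactor t T S * hlRec t L S) atTop
        (𝓝 ((if a = d then 1 else 0) * 1 * hlRec t L S)) :=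
      ((tendsto_pow_div_pow (hd a (by simp))).mul (tendsto_hlFactor t S)).mul tendsto_const_nhds
    have h2 : Tendsto (fun T : ℝ => ∑ x ∈ S, x ^ a * hlFactor t x (S.erase x) *
        ((x - t * T) / (x - T) * (hlRec t L (insert T (S.erase x)) / T ^ d))) atTop
        (𝓝 (∑ x ∈ S, x ^ a * hlFactor t x (S.erase x) * (t * hlLead t d L (S.erase x)))) := by
      refine tendsto_finsetSum _ fun x hx => tendsto_const_nhds.mul
        ((tendsto_factor_right t x).mul (ih _ ?_ fun b hb => hd b (by simp [hb])))
      have := Finset.card_pos.2 ⟨x, hx⟩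
      rw [Finset.card_erase_of_mem hx]
      simp only [List.length_cons] at hL
      omega
    have e : hlLead t d (a :: L) S = (if a = d then 1 else 0) * 1 * hlRec t L S +
        ∑ x ∈ S, x ^ a * hlFactor t x (S.erase x) * (t * hlLead t d L (S.erase x)) := by
      rw [hlLead, Finset.mul_sum]
      congr 1
      · split_ifs <;> simp
      · exact Finset.sum_congr rfl fun x _ => by ring
    rw [e]
    refine (h1.add h2).congr' ?_
    filter_upwards [hev] with T hT
    rw [hlRec_insert t a L hT, add_div, Finset.sum_div]
    congr 1
    · ring
    · exact Finset.sum_congr rfl fun x _ => by ring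

/-- The power $T^d$ can only come from one of the leading entries equal to $d$. If $T$ takes the
$i$-th of them (from $0$), the $i$ earlier variables each contribute a factor tending to $t$, and
what remains is the tail whichever entry was used. -/
lemma hlLead_eq (t : ℝ) (d : ℕ) (L : List ℕ) (S : Finset ℝ) (hL : L.Pairwise (· ≥ ·))
    (hd : ∀ a ∈ L, a ≤ d) :
    hlLead t d L S = (∑ i ∈ Finset.range (L.count d), t ^ i) * hlRec t L.tail S := by
  induction L generalizing S with
  | nil => simp [hlLead]
  | cons a L ih =>
    have hd' : ∀ b ∈ L, b ≤ d := fun b hb => hd b (by simp [hb])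
    have hL' := (List.pairwise_cons.1 hL)
    simp only [hlLead, ih _ hL'.2 hd', List.tail_cons]
    by_cases had : a = d
    · subst had
      rw [if_pos rfl, List.count_cons_self]
      rcases L with _ | ⟨b, L⟩
      · simp
      · by_cases hb : b = a
        · subst hb
          rw [List.tail_cons, hlRec_cons, Finset.sum_range_succ', add_mul, add_comm]
          simp only [Finset.mul_sum, Finset.sum_mul, pow_succ]
          congr 1
          · exact Finset.sum_congr rfl fun x _ => Finset.sum_congr rfl fun y _ => by ring
          · simp
        · have : (b :: L).count a = 0 := by
            rw [List.count_eq_zero]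
            intro h
            rcases List.mem_cons.1 h with h | h
            · exact hb h.symm
            · have h1 := (List.pairwise_cons.1 hL'.2).1 a h
              have h2 := hd' b (by simp)
              exact hb (le_antisymm h2 h1)
          rw [this]
          simp
    · have : (a :: L).count d = 0 := by
        rw [List.count_eq_zero]
        intro h
        rcases List.mem_cons.1 h with h | h
        · exact had h.symm
        · exact had (le_antisymm (hd a (by simp)) (hL'.1 d h))
      have h2 : L.count d = 0 := by
        rw [List.count_cons] at this; omega
      simp [this, h2, had]

/-- Among the lists occurring in a relation, let $d$ be the largest first entry. Dividing by $T^d$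
and letting one variable $T$ tend to infinity leaves a relation in one variable fewer between the
tails of the lists starting with $d$, whose coefficients are multiplied by the nonzero sums
$1+t+\dots+t^{m-1}$. -/
lemma hlRec_linearIndependent {t : ℝ} (ht : ∀ m, 0 < m → ∑ i ∈ Finset.range m, t ^ i ≠ 0)
    (N : ℕ) (A : Finset (List ℕ)) (hlen : ∀ L ∈ A, L.length = N)
    (hsort : ∀ L ∈ A, L.Pairwise (· ≥ ·)) (c : List ℕ → ℝ)
    (h : ∀ S : Finset ℝ, S.card = N → ∑ L ∈ A, c L * hlRec t L S = 0) :
    ∀ L ∈ A, c L = 0 := by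
  induction N generalizing A c with
  | zero =>
    intro L hL
    have hA : A = {[]} := by
      ext M
      rw [Finset.mem_singleton]
      refine ⟨fun hM => List.length_eq_zero_iff.1 (hlen M hM), ?_⟩
      rintro rfl
      rwa [List.length_eq_zero_iff.1 (hlen L hL)] at hL
    have := h ∅ rfl
    rw [hA, Finset.sum_singleton, hlRec, mul_one] at this
    rwa [List.length_eq_zero_iff.1 (hlen L hL)]
  | succ N ih =>
    by_contra hcon
    push Not at hcon
    -- Only lists with nonzero coefficient compete for the maximal first entry, so that the
    -- contradiction can be read off at `L₀`.
    set A' := A.filter (fun L => c L ≠ 0) with hA'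
    have hne : A'.Nonempty := by
      obtain ⟨L, hL, hc⟩ := hcon
      exact ⟨L, by simp [hA', hL, hc]⟩
    obtain ⟨L₀, hL₀, hmax⟩ := Finset.exists_max_image A' (fun L => L.headD 0) hne
    set d := L₀.headD 0 with hd
    have hle : ∀ L ∈ A', ∀ a ∈ L, a ≤ d := by
      intro L hL a ha
      have h1 := hmax L hL
      have h2 := hsort L (Finset.mem_filter.1 hL).1
      rcases L with _ | ⟨b, L⟩
      · simp at ha
      · simp only [List.headD_cons] at h1
        rcases List.mem_cons.1 ha with rfl | h3
        · exact h1
        · exact ((List.pairwise_cons.1 h2).1 a h3).trans h1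
    have hlead : ∀ S : Finset ℝ, S.card = N → ∑ L ∈ A', c L * hlLead t d L S = 0 := by
      intro S hS
      have h1 : Tendsto (fun T : ℝ => ∑ L ∈ A', c L * (hlRec t L (insert T S) / T ^ d)) atTop
          (𝓝 (∑ L ∈ A', c L * hlLead t d L S)) :=
        tendsto_finsetSum _ fun L hL => tendsto_const_nhds.mul
          (tendsto_hlRec t d L S (by rw [hlen L (Finset.mem_filter.1 hL).1, hS]) (hle L hL))
      refine tendsto_nhds_unique h1 (tendsto_const_nhds.congr' ?_)
      filter_upwards [S.eventually_all.2 fun x _ => eventually_gt_atTop x] with T hT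
      have hTS : T ∉ S := fun hTS => lt_irrefl _ (hT T hTS)
      have h2 := h (insert T S) (by rw [Finset.card_insert_of_notMem hTS, hS])
      have h3 : ∑ L ∈ A', c L * hlRec t L (insert T S) = 0 := by
        rw [← h2, hA']
        refine Finset.sum_filter_of_ne fun L _ hL => ?_
        exact left_ne_zero_of_mul hL
      simp only [← mul_div_assoc]
      rw [← Finset.sum_div, h3, zero_div]
    set A₁ := A'.filter (fun L => L.headD 0 = d) with hA₁
    have hcons : ∀ L ∈ A₁, d :: L.tail = L := by
      intro L hL
      have h1 := (Finset.mem_filter.1 hL)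
      have h2 := hlen L (Finset.mem_filter.1 h1.1).1
      rcases L with _ | ⟨b, L⟩
      · simp at h2
      · have : b = d := h1.2
        simp [this]
    have hinj : Set.InjOn List.tail (A₁ : Set (List ℕ)) := by
      intro L hL M hM hLM
      rw [← hcons L hL, ← hcons M hM, hLM]
    have key := ih (A₁.image List.tail) ?_ ?_
      (fun M => c (d :: M) * ∑ i ∈ Finset.range ((d :: M).count d), t ^ i) ?_
    · have hL₁ : L₀ ∈ A₁ := by simp [hA₁, hL₀, hd]
      have h0 := key L₀.tail (Finset.mem_image_of_mem _ hL₁)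
      rw [hcons L₀ hL₁] at h0
      rcases mul_eq_zero.1 h0 with h0 | h0
      · exact (Finset.mem_filter.1 hL₀).2 h0
      · refine ht _ ?_ h0
        rw [← hcons L₀ hL₁, List.count_cons_self]
        omega
    · intro M hM
      obtain ⟨L, hL, rfl⟩ := Finset.mem_image.1 hM
      rw [List.length_tail, hlen L (Finset.mem_filter.1 (Finset.mem_filter.1 hL).1).1]
      rfl
    · intro M hM
      obtain ⟨L, hL, rfl⟩ := Finset.mem_image.1 hM
      exact (hsort L (Finset.mem_filter.1 (Finset.mem_filter.1 hL).1).1).tail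
    · intro S hS
      rw [Finset.sum_image hinj, ← hlead S hS]
      symm
      rw [← Finset.sum_filter_add_sum_filter_not A' (fun L => L.headD 0 = d), ← hA₁]
      rw [Finset.sum_eq_zero (s := A'.filter (fun L => ¬ L.headD 0 = d)), add_zero]
      · refine Finset.sum_congr rfl fun L hL => ?_
        have h1 := (Finset.mem_filter.1 hL).1
        rw [hlLead_eq t d L S (hsort L (Finset.mem_filter.1 h1).1) (hle L h1), hcons L hL]
        ring
      · intro L hL
        obtain ⟨h1, h2⟩ := Finset.mem_filter.1 hL
        have h3 := hsort L (Finset.mem_filter.1 h1).1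
        rw [hlLead_eq t d L S h3 (hle L h1)]
        have : L.count d = 0 := by
          rw [List.count_eq_zero]
          intro hdL
          rcases L with _ | ⟨b, L⟩
          · simp at hdL
          · have h4 := hle _ h1 b (by simp)
            simp only [List.headD_cons] at h2
            rcases List.mem_cons.1 hdL with h5 | h5
            · exact h2 h5.symm
            · exact h2 (le_antisymm h4 ((List.pairwise_cons.1 h3).1 d h5))
        simp [this]

end Independence

/-! ## The sum over permutations -/

section Sum

variable {F : Type*} [Field F]

/-- The Hall–Littlewood polynomial as a sum over permutations. -/
def hlSum (t : F) {N : ℕ} (f : Fin N → ℕ) (x : Fin N → F) : F :=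
  ∑ w : Equiv.Perm (Fin N), (∏ i : Fin N, x (w i) ^ f i) *
    ∏ p : Fin N × Fin N with p.1 < p.2, ((x (w p.1) - t * x (w p.2)) / (x (w p.1) - x (w p.2)))

lemma prod_lt_succ {N : ℕ} (g : Fin (N + 1) → Fin (N + 1) → F) :
    ∏ p : Fin (N + 1) × Fin (N + 1) with p.1 < p.2, g p.1 p.2 =
      (∏ j : Fin N, g 0 j.succ) * ∏ p : Fin N × Fin N with p.1 < p.2, g p.1.succ p.2.succ := by
  simp only [Finset.prod_filter, Fintype.prod_prod_type, Fin.prod_univ_succ, Fin.succ_lt_succ_iff]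
  simp

/-- A permutation amounts to the image $p$ of the first index together with a permutation of the
other indices. The factors of the pairs $(0,j)$ form the product over all variables other than
$x_p$, independently of the second permutation. -/
lemma hlSum_eq_hlRec [DecidableEq F] (t : F) {N : ℕ} (f : Fin N → ℕ) (x : Fin N → F)
    (hx : Function.Injective x) :
    hlSum t f x = hlRec t (List.ofFn f) (Finset.univ.image x) := by
  induction N with
  | zero => simp [hlSum, hlRec]
  | succ N ih =>
    rw [List.ofFn_succ, hlRec_cons, Finset.sum_image hx.injOn]
    unfold hlSum
    rw [← Equiv.Perm.decomposeFin.symm.sum_comp, Fintype.sum_prod_type]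
    refine Finset.sum_congr rfl fun p _ => ?_
    have hy : Function.Injective fun i : Fin N => x (Equiv.swap 0 p i.succ) :=
      hx.comp ((Equiv.injective _).comp (Fin.succ_injective _))
    have him : (Finset.univ.image x).erase (x p) =
        Finset.univ.image fun i : Fin N => x (Equiv.swap 0 p i.succ) := by
      ext z
      simp only [Finset.mem_erase, Finset.mem_image, Finset.mem_univ, true_and]
      constructor
      · rintro ⟨hz, i, rfl⟩
        have hne : Equiv.swap 0 p i ≠ 0 := by
          intro h
          have : i = p := by
            rw [Equiv.swap_apply_eq_iff, Equiv.swap_apply_left] at h; exact h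
          exact hz (by rw [this])
        obtain ⟨j, hj⟩ := Fin.exists_succ_eq.2 hne
        exact ⟨j, by rw [hj, Equiv.swap_apply_self]⟩
      · rintro ⟨i, rfl⟩
        refine ⟨fun h => ?_, _, rfl⟩
        have h1 := hx h
        rw [Equiv.swap_apply_eq_iff, Equiv.swap_apply_right] at h1
        exact Fin.succ_ne_zero _ h1
    rw [him, ← ih _ _ hy, hlFactor, Finset.prod_image hy.injOn, hlSum, Finset.mul_sum]
    refine Finset.sum_congr rfl fun σ _ => ?_
    rw [Fin.prod_univ_succ, prod_lt_succ (fun i j => (x (Equiv.Perm.decomposeFin.symm (p, σ) i) -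
      t * x (Equiv.Perm.decomposeFin.symm (p, σ) j)) / (x (Equiv.Perm.decomposeFin.symm (p, σ) i) -
      x (Equiv.Perm.decomposeFin.symm (p, σ) j)))]
    simp only [Equiv.Perm.decomposeFin_symm_apply_zero, Equiv.Perm.decomposeFin_symm_apply_succ]
    rw [Equiv.prod_comp σ (fun j => (x p - t * x (Equiv.swap 0 p j.succ)) /
      (x p - x (Equiv.swap 0 p j.succ)))]
    ring

end Sum

/-! ## Evaluation of rational functions at real points -/

section Eval

variable {N : ℕ} (x : Fin N → ℝ)

/-- The rational function `r` is defined at `x` and has the value `c` there. -/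
def EvalsTo (r : RatFun N) (c : ℝ) : Prop :=
  ∃ p d : MvPolynomial (Fin N) ℝ, MvPolynomial.eval x d ≠ 0 ∧
    r * algebraMap _ (RatFun N) d = algebraMap _ (RatFun N) p ∧
    c * MvPolynomial.eval x d = MvPolynomial.eval x p

variable {x}

lemma evalsTo_algebraMap (p : MvPolynomial (Fin N) ℝ) :
    EvalsTo x (algebraMap _ (RatFun N) p) (MvPolynomial.eval x p) :=
  ⟨p, 1, by simp, by simp, by simp⟩

lemma evalsTo_var (i : Fin N) : EvalsTo x (var i) (x i) := by
  simpa [var] using evalsTo_algebraMap (x := x) (MvPolynomial.X i)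

lemma evalsTo_const (a : ℝ) : EvalsTo x (algebraMap ℝ (RatFun N) a) a := by
  have := evalsTo_algebraMap (x := x) (MvPolynomial.C a)
  rw [MvPolynomial.eval_C, ← MvPolynomial.algebraMap_eq, ← IsScalarTower.algebraMap_apply] at this
  exact this

lemma EvalsTo.add {r s : RatFun N} {a b : ℝ} (hr : EvalsTo x r a) (hs : EvalsTo x s b) :
    EvalsTo x (r + s) (a + b) := by
  obtain ⟨p, d, hd, h1, h2⟩ := hr
  obtain ⟨p', d', hd', h1', h2'⟩ := hs
  refine ⟨p * d' + p' * d, d * d', by simp [hd, hd'], ?_, ?_⟩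
  · simp only [map_mul, map_add, ← h1, ← h1']; ring
  · simp only [map_mul, map_add, ← h2, ← h2']; ring

lemma EvalsTo.mul {r s : RatFun N} {a b : ℝ} (hr : EvalsTo x r a) (hs : EvalsTo x s b) :
    EvalsTo x (r * s) (a * b) := by
  obtain ⟨p, d, hd, h1, h2⟩ := hr
  obtain ⟨p', d', hd', h1', h2'⟩ := hs
  refine ⟨p * p', d * d', by simp [hd, hd'], ?_, ?_⟩
  · simp only [map_mul, ← h1, ← h1']; ring
  · simp only [map_mul, ← h2, ← h2']; ring

lemma EvalsTo.sub {r s : RatFun N} {a b : ℝ} (hr : EvalsTo x r a) (hs : EvalsTo x s b) :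
    EvalsTo x (r - s) (a - b) := by
  have := hr.add ((evalsTo_const (-1)).mul hs)
  simpa [sub_eq_add_neg] using this

lemma EvalsTo.div {r s : RatFun N} {a b : ℝ} (hr : EvalsTo x r a) (hs : EvalsTo x s b)
    (hb : b ≠ 0) : EvalsTo x (r / s) (a / b) := by
  obtain ⟨p, d, hd, h1, h2⟩ := hr
  obtain ⟨p', d', hd', h1', h2'⟩ := hs
  have hp' : MvPolynomial.eval x p' ≠ 0 := by rw [← h2']; exact mul_ne_zero hb hd'
  have hs0 : s ≠ 0 := by
    rintro rfl
    rw [zero_mul] at h1'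
    have : p' = 0 := by
      apply IsFractionRing.injective (MvPolynomial (Fin N) ℝ) (RatFun N)
      rw [← h1', map_zero]
    exact hp' (by rw [this, map_zero])
  refine ⟨p * d', d * p', by simp [hd, hp'], ?_, ?_⟩
  · simp only [map_mul, ← h1, ← h1']
    field_simp
  · simp only [map_mul, ← h2, ← h2']
    field_simp

lemma EvalsTo.sum {ι : Type*} (s : Finset ι) {r : ι → RatFun N} {a : ι → ℝ}
    (h : ∀ i ∈ s, EvalsTo x (r i) (a i)) : EvalsTo x (∑ i ∈ s, r i) (∑ i ∈ s, a i) := by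
  classical
  induction s using Finset.induction_on with
  | empty => simpa using evalsTo_const (x := x) 0
  | insert i s hi ih =>
    rw [Finset.sum_insert hi, Finset.sum_insert hi]
    exact (h i (by simp)).add (ih fun j hj => h j (by simp [hj]))

lemma EvalsTo.prod {ι : Type*} (s : Finset ι) {r : ι → RatFun N} {a : ι → ℝ}
    (h : ∀ i ∈ s, EvalsTo x (r i) (a i)) : EvalsTo x (∏ i ∈ s, r i) (∏ i ∈ s, a i) := by
  classical
  induction s using Finset.induction_on with
  | empty => simpa using evalsTo_const (x := x) 1
  | insert i s hi ih =>
    rw [Finset.prod_insert hi, Finset.prod_insert hi]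
    exact (h i (by simp)).mul (ih fun j hj => h j (by simp [hj]))

lemma EvalsTo.eq_zero {a : ℝ} (h : EvalsTo x 0 a) : a = 0 := by
  obtain ⟨p, d, hd, h1, h2⟩ := h
  rw [zero_mul] at h1
  have : p = 0 := by
    apply IsFractionRing.injective (MvPolynomial (Fin N) ℝ) (RatFun N)
    rw [← h1, map_zero]
  rw [this, map_zero] at h2
  exact (mul_eq_zero.1 h2).resolve_right hd

lemma EvalsTo.pow {r : RatFun N} {a : ℝ} (h : EvalsTo x r a) (n : ℕ) :
    EvalsTo x (r ^ n) (a ^ n) := by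
  simpa using EvalsTo.prod (Finset.range n) (fun _ _ => h)

/-- At distinct real points no denominator vanishes. This carries relations between rational
functions over to the reals, where limits are available. -/
lemma evalsTo_hlSum (hx : Function.Injective x) (t : ℝ) (f : Fin N → ℕ) :
    EvalsTo x (hlSum (algebraMap ℝ (RatFun N) t) f var) (hlSum t f x) := by
  refine EvalsTo.sum _ fun w _ => EvalsTo.mul (EvalsTo.prod _ fun i _ => (evalsTo_var _).pow _)
    (EvalsTo.prod _ fun p hp => EvalsTo.div ?_ ?_ ?_)
  · exact (evalsTo_var _).sub ((evalsTo_const t).mul (evalsTo_var _))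
  · exact (evalsTo_var _).sub (evalsTo_var _)
  · rw [sub_ne_zero]
    exact fun h => (Finset.mem_filter.1 hp).2.ne (w.injective (hx h))

end Eval

/-! ## Young diagrams with prescribed column lengths -/

section Diagrams

lemma youngDiagram_ext_colLen {μ ν : YoungDiagram} (h : ∀ j, μ.colLen j = ν.colLen j) : μ = ν := by
  ext ⟨i, j⟩
  simp only [YoungDiagram.mem_cells, YoungDiagram.mem_iff_lt_colLen, h]

lemma exists_colLen {f : ℕ → ℕ} (hf : Antitone f) {D : ℕ} (hD : f D = 0) :
    ∃ ν : YoungDiagram, ∀ j, ν.colLen j = f j := by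
  refine ⟨⟨(Finset.range (f 0) ×ˢ Finset.range D).filter (fun p => p.1 < f p.2), ?_⟩, ?_⟩
  · rintro ⟨i, j⟩ ⟨i', j'⟩ ⟨h1, h2⟩ h
    simp only [Finset.coe_filter, Finset.mem_product, Finset.mem_range, Set.mem_ofPred_eq] at h ⊢
    simp only at h1 h2
    have := hf h2
    omega
  · intro j
    refine le_antisymm (le_of_forall_lt fun i hi => ?_) (le_of_forall_lt fun i hi => ?_)
    · have := YoungDiagram.mem_iff_lt_colLen.2 hi
      exact (Finset.mem_filter.1 ((YoungDiagram.mem_cells _).2 this)).2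
    · refine YoungDiagram.mem_iff_lt_colLen.1
        ((YoungDiagram.mem_cells _).1 (Finset.mem_filter.2 ⟨?_, hi⟩))
      rw [Finset.mem_product, Finset.mem_range, Finset.mem_range]
      refine ⟨lt_of_lt_of_le hi (hf (Nat.zero_le _)), ?_⟩
      by_contra h
      have : f j ≤ f D := hf (not_lt.1 h)
      omega

/-- The diagram with column lengths `f`, if there is one. -/
def ofColLen (f : ℕ → ℕ) : YoungDiagram :=
  open Classical in if h : ∃ ν : YoungDiagram, ∀ j, ν.colLen j = f j then h.choose else ⊥

lemma colLen_ofColLen {f : ℕ → ℕ} (h : ∃ ν : YoungDiagram, ∀ j, ν.colLen j = f j) (j : ℕ) :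
    (ofColLen f).colLen j = f j := by
  rw [ofColLen, dif_pos h]
  exact h.choose_spec j

lemma ofColLen_eq {f : ℕ → ℕ} {ν : YoungDiagram} (h : ∀ j, ν.colLen j = f j) :
    ofColLen f = ν :=
  youngDiagram_ext_colLen fun j => by rw [colLen_ofColLen ⟨ν, h⟩, h]

variable (μ : YoungDiagram)

lemma colLen_zero_le_card : μ.colLen 0 ≤ μ.card := by
  rw [YoungDiagram.colLen_eq_card]
  exact Finset.card_le_card (Finset.filter_subset _ _)

lemma rowLen_zero_le_card : μ.rowLen 0 ≤ μ.card := by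
  rw [YoungDiagram.rowLen_eq_card]
  exact Finset.card_le_card (Finset.filter_subset _ _)

lemma colLen_eq_zero {j : ℕ} (h : μ.rowLen 0 ≤ j) : μ.colLen j = 0 := by
  by_contra h'
  have := YoungDiagram.mem_iff_lt_colLen.2 (Nat.pos_of_ne_zero h')
  rw [YoungDiagram.mem_iff_lt_rowLen] at this
  omega

/-- The number of rows of length `j`, for `j ≥ 1`. -/
def cmult (j : ℕ) : ℕ := μ.colLen (j - 1) - μ.colLen j

/-- Add one box to each of the columns `j` and `j + 1`. -/
def addA (j : ℕ) : YoungDiagram :=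
  ofColLen fun i => μ.colLen i + if i = j ∨ i = j + 1 then 1 else 0

/-- Add two boxes to the column `j`. -/
def addB (j : ℕ) : YoungDiagram :=
  ofColLen fun i => μ.colLen i + if i = j then 2 else 0

variable {μ}

/-- The condition asks for a row of length exactly $j$ (or a new row, if $j=0$), so that the
enlarged column $j$ still fits under column $j-1$. This excludes the default value of `ofColLen`. -/
lemma colLen_addA {j : ℕ} (h : j = 0 ∨ 1 ≤ cmult μ j) (i : ℕ) :
    (addA μ j).colLen i = μ.colLen i + if i = j ∨ i = j + 1 then 1 else 0 := by
  refine colLen_ofColLen (exists_colLen (D := μ.rowLen 0 + j + 2) ?_ ?_) i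
  · refine antitone_nat_of_succ_le fun i => ?_
    have h1 := μ.colLen_anti i (i + 1) (by omega)
    rcases Nat.eq_zero_or_pos j with h0 | h0
    · split_ifs <;> omega
    · have h2 : 1 ≤ μ.colLen (j - 1) - μ.colLen j := by
        rcases h with h | h
        · omega
        · exact h
      by_cases hj : i + 1 = j
      · subst hj
        simp only [Nat.add_sub_cancel] at h2
        split_ifs <;> omega
      · split_ifs <;> omega
  · rw [colLen_eq_zero _ (by omega), if_neg (by omega)]

lemma colLen_addB {j : ℕ} (h : j = 0 ∨ 2 ≤ cmult μ j) (i : ℕ) :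
    (addB μ j).colLen i = μ.colLen i + if i = j then 2 else 0 := by
  refine colLen_ofColLen (exists_colLen (D := μ.rowLen 0 + j + 2) ?_ ?_) i
  · refine antitone_nat_of_succ_le fun i => ?_
    have h1 := μ.colLen_anti i (i + 1) (by omega)
    rcases Nat.eq_zero_or_pos j with h0 | h0
    · split_ifs <;> omega
    · have h2 : 2 ≤ μ.colLen (j - 1) - μ.colLen j := by
        rcases h with h | h
        · omega
        · exact h
      by_cases hj : i + 1 = j
      · subst hj
        simp only [Nat.add_sub_cancel] at h2
        split_ifs <;> omega
      · split_ifs <;> omega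
  · rw [colLen_eq_zero _ (by omega), if_neg (by omega)]

lemma le_of_colLen_le {μ ν : YoungDiagram} (h : ∀ j, μ.colLen j ≤ ν.colLen j) : μ ≤ ν := by
  rintro ⟨i, j⟩ hc
  change (i, j) ∈ μ at hc
  rw [YoungDiagram.mem_iff_lt_colLen] at hc
  refine YoungDiagram.mem_iff_lt_colLen.2 ?_
  exact hc.trans_le (h j)

lemma mem_sdiff_cells {μ ν : YoungDiagram} (i j : ℕ) :
    (i, j) ∈ ν.cells \ μ.cells ↔ μ.colLen j ≤ i ∧ i < ν.colLen j := by
  rw [Finset.mem_sdiff, YoungDiagram.mem_cells, YoungDiagram.mem_cells,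
    YoungDiagram.mem_iff_lt_colLen, YoungDiagram.mem_iff_lt_colLen]
  omega

lemma sdiff_addA {j : ℕ} (h : j = 0 ∨ 1 ≤ cmult μ j) :
    (addA μ j).cells \ μ.cells = {(μ.colLen j, j), (μ.colLen (j + 1), j + 1)} := by
  ext ⟨a, b⟩
  rw [mem_sdiff_cells, colLen_addA h]
  simp only [Finset.mem_insert, Finset.mem_singleton, Prod.mk.injEq]
  by_cases h1 : b = j
  · subst h1; simp; omega
  · by_cases h2 : b = j + 1
    · subst h2; simp; omega
    · simp [h1, h2]

lemma sdiff_addB {j : ℕ} (h : j = 0 ∨ 2 ≤ cmult μ j) :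
    (addB μ j).cells \ μ.cells = {(μ.colLen j, j), (μ.colLen j + 1, j)} := by
  ext ⟨a, b⟩
  rw [mem_sdiff_cells, colLen_addB h]
  simp only [Finset.mem_insert, Finset.mem_singleton, Prod.mk.injEq]
  by_cases h1 : b = j
  · subst h1; simp; omega
  · simp [h1]

lemma le_addA {j : ℕ} (h : j = 0 ∨ 1 ≤ cmult μ j) : μ ≤ addA μ j :=
  le_of_colLen_le fun i => by rw [colLen_addA h]; omega

lemma le_addB {j : ℕ} (h : j = 0 ∨ 2 ≤ cmult μ j) : μ ≤ addB μ j :=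
  le_of_colLen_le fun i => by rw [colLen_addB h]; omega

lemma twoStep_addA {j : ℕ} (h : j = 0 ∨ 1 ≤ cmult μ j) : TwoStep μ (addA μ j) :=
  ⟨le_addA h, (μ.colLen j, j), (μ.colLen (j + 1), j + 1), by simp, sdiff_addA h, Or.inr rfl⟩

lemma twoStep_addB {j : ℕ} (h : j = 0 ∨ 2 ≤ cmult μ j) : TwoStep μ (addB μ j) :=
  ⟨le_addB h, (μ.colLen j, j), (μ.colLen j + 1, j), by simp, sdiff_addB h, Or.inl rfl⟩

/-- The sum of the row numbers of the boxes of a diagram. -/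
def rowSum (μ : YoungDiagram) : ℕ := ∑ c ∈ μ.cells, c.1

lemma sum_cells_of_sdiff {μ ν : YoungDiagram} (h : μ ≤ ν) {c d : ℕ × ℕ} (hcd : c ≠ d)
    (hs : ν.cells \ μ.cells = {c, d}) (f : ℕ × ℕ → ℕ) :
    ∑ x ∈ ν.cells, f x = (∑ x ∈ μ.cells, f x) + (f c + f d) := by
  rw [← Finset.sum_sdiff (YoungDiagram.cells_subset_iff.2 h), hs, Finset.sum_pair hcd, add_comm]

lemma card_eq_sum (μ : YoungDiagram) : μ.card = ∑ _x ∈ μ.cells, 1 := by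
  rw [Finset.sum_const, smul_eq_mul, mul_one]

lemma TwoStep.card_eq {μ ν : YoungDiagram} (h : TwoStep μ ν) : ν.card = μ.card + 2 := by
  obtain ⟨h1, c, d, hcd, hs, -⟩ := h
  rw [card_eq_sum, card_eq_sum, sum_cells_of_sdiff h1 hcd hs]

lemma rowSum_addA {j : ℕ} (h : j = 0 ∨ 1 ≤ cmult μ j) :
    rowSum (addA μ j) = rowSum μ + (μ.colLen j + μ.colLen (j + 1)) :=
  sum_cells_of_sdiff (le_addA h) (by simp) (sdiff_addA h) _

lemma rowSum_addB {j : ℕ} (h : j = 0 ∨ 2 ≤ cmult μ j) :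
    rowSum (addB μ j) = rowSum μ + (μ.colLen j + (μ.colLen j + 1)) :=
  sum_cells_of_sdiff (le_addB h) (by simp) (sdiff_addB h) _

/-- Every diagram with at least two boxes is obtained from a smaller one by adding two boxes. -/
lemma exists_add (ν : YoungDiagram) (h : 2 ≤ ν.card) : ∃ (μ : YoungDiagram) (j : ℕ),
    ((j = 0 ∨ 1 ≤ cmult μ j) ∧ ν = addA μ j) ∨ ((j = 0 ∨ 2 ≤ cmult μ j) ∧ ν = addB μ j) := by
  have hanti : ∀ i, ν.colLen (i + 1) ≤ ν.colLen i := fun i => ν.colLen_anti _ _ (by omega)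
  have hpos : 0 < ν.rowLen 0 := by
    by_contra h0
    have : ν.cells = ∅ := by
      rw [Finset.eq_empty_iff_forall_notMem]
      rintro ⟨a, b⟩ hab
      rw [YoungDiagram.mem_cells, YoungDiagram.mem_iff_lt_colLen, colLen_eq_zero _ (by omega)] at hab
      omega
    have : ν.card = 0 := by rw [YoungDiagram.card, this, Finset.card_empty]
    omega
  obtain ⟨d, hd⟩ : ∃ d, ν.rowLen 0 = d + 1 := ⟨ν.rowLen 0 - 1, by omega⟩
  have hzero : ∀ i, d + 1 ≤ i → ν.colLen i = 0 := fun i hi => colLen_eq_zero _ (by omega)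
  have hlast : 0 < ν.colLen d := by
    rw [← YoungDiagram.mem_iff_lt_colLen, YoungDiagram.mem_iff_lt_rowLen]; omega
  -- Column $d$ is the last nonempty one. With at least two boxes in it, two are removed there;
  -- otherwise its only box is removed along with one box of the preceding column, which exists
  -- because there are at least two boxes in all.
  by_cases h2 : 2 ≤ ν.colLen d
  · obtain ⟨μ, hμ⟩ := exists_colLen (f := fun i => if i = d then ν.colLen i - 2 else ν.colLen i)
      (antitone_nat_of_succ_le fun i => by
        have := hanti i
        have := hzero (i + 1)
        split_ifs <;> omega) (D := d + 1) (by simp [hzero])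
    refine ⟨μ, d, Or.inr ⟨?_, (ofColLen_eq fun i => ?_).symm⟩⟩
    · rcases Nat.eq_zero_or_pos d with h0 | h0
      · exact Or.inl h0
      · right
        have := hanti (d - 1)
        rw [Nat.sub_add_cancel h0] at this
        rw [cmult, hμ, hμ, if_pos rfl, if_neg (by omega)]
        omega
    · rw [hμ]
      split_ifs with hi
      · subst hi; omega
      · rfl
  · obtain ⟨e, rfl⟩ : ∃ e, d = e + 1 := by
      rcases d with _ | e
      · exfalso
        have : ν.cells ⊆ {(0, 0)} := by
          rintro ⟨a, b⟩ hab
          rw [YoungDiagram.mem_cells, YoungDiagram.mem_iff_lt_colLen] at hab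
          rcases b with _ | b
          · simp; omega
          · rw [hzero _ (by omega)] at hab; omega
        have := Finset.card_le_card this
        rw [Finset.card_singleton] at this
        change ν.card ≤ 1 at this
        omega
      · exact ⟨e, rfl⟩
    obtain ⟨μ, hμ⟩ := exists_colLen
      (f := fun i => if i = e ∨ i = e + 1 then ν.colLen i - 1 else ν.colLen i)
      (antitone_nat_of_succ_le fun i => by
        have := hanti i
        have := hzero (i + 1)
        split_ifs <;> omega) (D := e + 2) (by simp [hzero])
    have he := hanti e
    refine ⟨μ, e, Or.inl ⟨?_, (ofColLen_eq fun i => ?_).symm⟩⟩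
    · rcases Nat.eq_zero_or_pos e with h0 | h0
      · exact Or.inl h0
      · right
        have := hanti (e - 1)
        rw [Nat.sub_add_cancel h0] at this
        rw [cmult, hμ (e - 1), hμ e, if_neg (by omega), if_pos (by simp)]
        omega
    · rw [hμ]
      split_ifs with hi
      · rcases hi with rfl | rfl <;> omega
      · rfl

end Diagrams

/-! ## Multiplication of Hall–Littlewood functions by `p₂` -/

section Expansion

/-- The multiplicities of the row lengths of `ν`, completed by zeros to `N` rows. -/
def multN (ν : YoungDiagram) (N : ℕ) : ℕ → ℕ
  | 0 => N - ν.colLen 0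
  | a + 1 => ν.colLen a - ν.colLen (a + 1)

lemma count_map_rowLen (ν : YoungDiagram) (N a : ℕ) :
    ((List.range N).map ν.rowLen).count a =
      (match a with
        | 0 => N - min N (ν.colLen 0)
        | a + 1 => min N (ν.colLen a) - min N (ν.colLen (a + 1))) := by
  induction N with
  | zero => cases a <;> simp
  | succ N ih =>
    rw [List.range_succ, List.map_append, List.count_append, ih, List.map_singleton,
      List.count_singleton]
    have key : ∀ j, j < ν.rowLen N ↔ N < ν.colLen j := fun j => by
      rw [← YoungDiagram.mem_iff_lt_rowLen, YoungDiagram.mem_iff_lt_colLen]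
    rcases a with _ | a
    · have := key 0
      by_cases h : ν.rowLen N = 0
      · simp [h]; omega
      · simp [h]; omega
    · have h1 := key a
      have h2 := key (a + 1)
      have h3 := ν.colLen_anti a (a + 1) (by omega)
      by_cases h : ν.rowLen N = a + 1
      · simp [h]; omega
      · simp [h]; omega

lemma count_rows {ν : YoungDiagram} {N : ℕ} (h : ν.colLen 0 ≤ N) (a : ℕ) :
    (List.ofFn fun i : Fin N => ν.rowLen i).count a = multN ν N a := by
  have e : (List.ofFn fun i : Fin N => ν.rowLen i) = (List.range N).map ν.rowLen := by
    apply List.ext_getElem <;> simp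
  rw [e, count_map_rowLen]
  rcases a with _ | a
  · simp [multN, h]
  · have h1 := ν.colLen_anti 0 a (by omega)
    have h2 := ν.colLen_anti 0 (a + 1) (by omega)
    simp only [multN]
    rw [min_eq_right (by omega), min_eq_right (by omega)]

lemma pairwise_rows (ν : YoungDiagram) (N : ℕ) :
    (List.ofFn fun i : Fin N => ν.rowLen i).Pairwise (· ≥ ·) := by
  rw [List.pairwise_ofFn]
  intro i j hij
  exact ν.rowLen_anti _ _ hij.le

lemma rows_eq_blocks {ν : YoungDiagram} {N D : ℕ} (h : ν.colLen 0 ≤ N) (hD : ν.rowLen 0 < D) :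
    (List.ofFn fun i : Fin N => ν.rowLen i) = blocks (multN ν N) D := by
  refine List.Perm.eq_of_pairwise (le := (· ≥ ·)) (fun a b _ _ h1 h2 => le_antisymm h2 h1)
    (pairwise_rows ν N) (pairwise_blocks _ _) ?_
  rw [List.perm_iff_count]
  intro a
  rw [count_rows h, count_blocks]
  split_ifs with ha
  · rfl
  · obtain ⟨b, rfl⟩ : ∃ b, a = b + 1 := ⟨a - 1, by omega⟩
    rw [multN, colLen_eq_zero ν (by omega), colLen_eq_zero ν (by omega)]

lemma mult_succ (ν : YoungDiagram) (a : ℕ) :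
    mult ν (a + 1) = ν.colLen a - ν.colLen (a + 1) := by
  have h1 := ν.colLen_anti 0 a (by omega)
  have h2 := ν.colLen_anti 0 (a + 1) (by omega)
  rw [mult, YoungDiagram.rowLens, count_map_rowLen]
  simp only
  rw [min_eq_right h1, min_eq_right h2]

lemma sum_mult (ν : YoungDiagram) : ∑ i ∈ Finset.Icc 1 ν.card, mult ν i = ν.colLen 0 := by
  have h : ∀ n, (∑ i ∈ Finset.Icc 1 n, mult ν i) + ν.colLen n = ν.colLen 0 := by
    intro n
    induction n with
    | zero => simp
    | succ n ih =>
      rw [Finset.sum_Icc_succ_top (by omega), mult_succ]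
      have := ν.colLen_anti n (n + 1) (by omega)
      omega
  have := h ν.card
  rwa [colLen_eq_zero ν (rowLen_zero_le_card ν), add_zero] at this

lemma hlPhi_eq {t : ℝ} (ht : t ≠ 1) (m : ℕ) : hlPhi t m = (1 - t) ^ m * hlv t m := by
  have : 1 - t ≠ 0 := sub_ne_zero.2 ht.symm
  rw [hlPhi, hlv, Finset.prod_div_distrib, Finset.prod_const, Finset.card_range]
  field_simp

lemma one_sub_pow_pos {t : ℝ} (ht : |t| < 1) (m : ℕ) : 0 < 1 - t ^ (m + 1) := by
  have : |t ^ (m + 1)| < 1 := by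
    rw [abs_pow]; exact pow_lt_one₀ (abs_nonneg _) ht (by omega)
  linarith [le_abs_self (t ^ (m + 1))]

lemma hlv_pos {t : ℝ} (ht : |t| < 1) (m : ℕ) : 0 < hlv t m := by
  refine Finset.prod_pos fun i _ => div_pos (one_sub_pow_pos ht i) ?_
  simpa using one_sub_pow_pos ht 0

lemma hlv_succ (t : ℝ) (m : ℕ) : hlv t (m + 1) = hlv t m * ((1 - t ^ (m + 1)) / (1 - t)) :=
  Finset.prod_range_succ _ _

/-- The factor $b_\nu=\prod\varphi_{m_i}=(1-t)^{\ell(\nu)}\prod v_{m_i}$ cancels all the $v_{m_i}$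
with $i\ge1$; only $v_{m_0}$ for the zero parts survives. -/
lemma hlQ_apply {t : ℝ} (ht : |t| < 1) {ν : YoungDiagram} {N : ℕ} (h : ν.colLen 0 ≤ N) :
    hlQ t ν N = ((1 - t) ^ ν.colLen 0 / hlv t (N - ν.colLen 0)) • hlR t ν N := by
  have ht1 : t ≠ 1 := fun h => by rw [h] at ht; simp at ht
  rw [hlQ, Pi.smul_apply, hlP, YoungDiagram.length_rowLens, if_pos h, smul_smul]
  congr 1
  simp only [hlPhi_eq ht1, Finset.prod_mul_distrib, Finset.prod_pow_eq_pow_sum, sum_mult]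
  have h1 := (hlv_pos ht (N - ν.colLen 0)).ne'
  have h2 : ∏ i ∈ Finset.Icc 1 ν.card, hlv t (mult ν i) ≠ 0 :=
    Finset.prod_ne_zero_iff.2 fun i _ => (hlv_pos ht _).ne'
  field_simp

lemma hlQ_apply_of_lt {t : ℝ} {ν : YoungDiagram} {N : ℕ} (h : N < ν.colLen 0) :
    hlQ t ν N = 0 := by
  rw [hlQ, Pi.smul_apply, hlP, YoungDiagram.length_rowLens, if_neg (by omega), smul_zero]

lemma hlR_eq_hlSum (t : ℝ) (ν : YoungDiagram) (N : ℕ) :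
    hlR t ν N = hlSum (algebraMap ℝ (RatFun N) t) (fun i => ν.rowLen i) var := by
  simp only [hlR, hlSum, Algebra.smul_def]

lemma var_injective (N : ℕ) : Function.Injective (var : Fin N → RatFun N) :=
  (IsFractionRing.injective (MvPolynomial (Fin N) ℝ) (RatFun N)).comp
    (MvPolynomial.X_injective)

open Classical in
lemma hlR_eq_hlRec (t : ℝ) {ν : YoungDiagram} {N D : ℕ} (h : ν.colLen 0 ≤ N)
    (hD : ν.rowLen 0 < D) : hlR t ν N = hlRec (algebraMap ℝ (RatFun N) t)
      (blocks (multN ν N) D) (Finset.univ.image var) := by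
  rw [hlR_eq_hlSum, hlSum_eq_hlRec _ _ _ (var_injective N), rows_eq_blocks h hD]

/-- The coefficient of `Q̃` at `addA μ j` in `(1 - s²) p₂ Q̃_μ`. -/
def xiA (s : ℝ) (μ : YoungDiagram) (j : ℕ) : ℝ :=
  (1 + s) * (-s) ^ cmult μ (j + 1) * if j = 0 then 1 else 1 - s ^ cmult μ j

/-- The coefficient of `Q̃` at `addB μ j` in `(1 - s²) p₂ Q̃_μ`. -/
def xiB (s : ℝ) (μ : YoungDiagram) (j : ℕ) : ℝ :=
  if j = 0 then 1 else (1 - s ^ cmult μ j) * (1 - s ^ (cmult μ j - 1))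

/-- The coefficients of the expansion of `(1 - s²) p₂ Q̃_μ`. -/
def expansion (s : ℝ) (μ : YoungDiagram) : YoungDiagram →₀ ℝ :=
  ∑ j ∈ Finset.range (μ.card + 1),
    (Finsupp.single (addA μ j) (xiA s μ j) + Finsupp.single (addB μ j) (xiB s μ j))

/-- For $j>0$ the factor $1-s^{m_j}$ vanishes when no row of length $j$ is available, so the junk
diagrams produced by `addA` outside its range carry no weight. -/
lemma valid_of_xiA_ne_zero {s : ℝ} {μ : YoungDiagram} {j : ℕ} (h : xiA s μ j ≠ 0) :
    j = 0 ∨ 1 ≤ cmult μ j := by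
  by_contra hcon
  push Not at hcon
  have : cmult μ j = 0 := by omega
  exact h (by simp [xiA, this, hcon.1])

lemma valid_of_xiB_ne_zero {s : ℝ} {μ : YoungDiagram} {j : ℕ} (h : xiB s μ j ≠ 0) :
    j = 0 ∨ 2 ≤ cmult μ j := by
  by_contra hcon
  push Not at hcon
  have : cmult μ j = 0 ∨ cmult μ j = 1 := by omega
  rcases this with h1 | h1 <;> exact h (by simp [xiB, h1, hcon.1])

lemma twoStep_of_expansion_ne_zero {s : ℝ} {μ ν : YoungDiagram} (h : expansion s μ ν ≠ 0) :
    TwoStep μ ν := by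
  classical
  rw [expansion, Finsupp.finsetSum_apply] at h
  obtain ⟨j, -, hj⟩ := Finset.exists_ne_zero_of_sum_ne_zero h
  rw [Finsupp.add_apply, Finsupp.single_apply, Finsupp.single_apply] at hj
  by_cases hA : addA μ j = ν ∧ xiA s μ j ≠ 0
  · rw [← hA.1]; exact twoStep_addA (valid_of_xiA_ne_zero hA.2)
  · by_cases hB : addB μ j = ν ∧ xiB s μ j ≠ 0
    · rw [← hB.1]; exact twoStep_addB (valid_of_xiB_ne_zero hB.2)
    · exfalso
      apply hj
      rw [ite_eq_right_iff.2 (fun h => by_contra fun h' => hA ⟨h, h'⟩),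
        ite_eq_right_iff.2 (fun h => by_contra fun h' => hB ⟨h, h'⟩), add_zero]

end Expansion

/-! ### The expansion of $(1-s^2)p_2\widetilde Q_\mu$ and its uniqueness -/

section Expansion

lemma multN_eq_cmult (μ : YoungDiagram) (N : ℕ) {a : ℕ} (ha : a ≠ 0) :
    multN μ N a = cmult μ a := by
  obtain ⟨b, rfl⟩ := Nat.exists_eq_succ_of_ne_zero ha
  rfl

/-- The factor between `Q̃_ν` and `R_ν` in `N` variables. -/
def hlScale (s : ℝ) (ν : YoungDiagram) (N : ℕ) : ℝ :=
  (-1) ^ rowSum ν * ((1 - s) ^ ν.colLen 0 / hlv s (N - ν.colLen 0))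

lemma hlScale_ne_zero {s : ℝ} (hs : |s| < 1) (ν : YoungDiagram) (N : ℕ) : hlScale s ν N ≠ 0 := by
  have h1 : (1 - s) ≠ 0 := by simpa using (one_sub_pow_pos hs 0).ne'
  exact mul_ne_zero (pow_ne_zero _ (by norm_num))
    (div_ne_zero (pow_ne_zero _ h1) (hlv_pos hs _).ne')

lemma hlQtilde_apply {s : ℝ} (hs : |s| < 1) {ν : YoungDiagram} {N : ℕ} (h : ν.colLen 0 ≤ N) :
    hlQtilde s ν N = hlScale s ν N • hlR s ν N := by
  rw [hlQtilde, Pi.smul_apply, hlQ_apply hs h, smul_smul]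
  rfl

lemma hlQtilde_apply_of_lt {s : ℝ} {ν : YoungDiagram} {N : ℕ} (h : N < ν.colLen 0) :
    hlQtilde s ν N = 0 := by
  rw [hlQtilde, Pi.smul_apply, hlQ_apply_of_lt h, smul_zero]

/-- In terms of rows, one box in each of the columns $a,a+1$ is a row of length $a$ becoming one of
length $a+2$; for $a=0$ one of the zero rows is used up. -/
lemma multN_addA {μ : YoungDiagram} {N a : ℕ} (h : a = 0 ∨ 1 ≤ cmult μ a) :
    multN (addA μ a) N = multA (multN μ N) a := by
  funext b
  rcases b with _ | b
  · simp only [multN, multA, colLen_addA h]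
    grind
  · have h1 := μ.colLen_anti b (b + 1) (by omega)
    rcases Nat.eq_zero_or_pos a with h0 | h0
    · simp only [multN, multA, colLen_addA h]
      split_ifs <;> omega
    · have h2 : 1 ≤ μ.colLen (a - 1) - μ.colLen a := h.resolve_left (by omega)
      simp only [multN, multA, colLen_addA h]
      by_cases hb : b + 1 = a
      · subst hb
        simp only [Nat.add_sub_cancel] at h2
        split_ifs <;> omega
      · split_ifs <;> omega

lemma multN_addB {μ : YoungDiagram} {N a : ℕ} (h : a = 0 ∨ 2 ≤ cmult μ a) :
    multN (addB μ a) N = multB (multN μ N) a := by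
  funext b
  rcases b with _ | b
  · simp only [multN, multB, colLen_addB h]
    grind
  · have h1 := μ.colLen_anti b (b + 1) (by omega)
    rcases Nat.eq_zero_or_pos a with h0 | h0
    · simp only [multN, multB, colLen_addB h]
      split_ifs <;> omega
    · have h2 : 2 ≤ μ.colLen (a - 1) - μ.colLen a := h.resolve_left (by omega)
      simp only [multN, multB, colLen_addB h]
      by_cases hb : b + 1 = a
      · subst hb
        simp only [Nat.add_sub_cancel] at h2
        split_ifs <;> omega
      · split_ifs <;> omega

lemma rowLen_zero_lt_of_twoStep {μ ν : YoungDiagram} (h : TwoStep μ ν) :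
    ν.rowLen 0 < μ.card + 3 := by
  have := rowLen_zero_le_card ν
  rw [h.card_eq] at this
  omega

open Classical in
-- The exponent in the sign of $\widetilde Q$ changes by $\mu'_a+\mu'_{a+1}$, which has the parity
-- of $m_{a+1}$; this turns $s^{m_{a+1}}$ into $(-s)^{m_{a+1}}$. For $a=0$ the factor $1-s^{m_0}$,
-- which depends on the number of variables, is absorbed by the change of $v_{m_0}$ and the extra
-- power of $1-s$.
lemma expansion_termA {s : ℝ} (hs : |s| < 1) {μ : YoungDiagram} {N : ℕ} (h : μ.colLen 0 ≤ N)
    (a : ℕ) :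
    (hlScale s μ N * ((1 + s) * s ^ multN μ N (a + 1) * (1 - s ^ multN μ N a))) •
      hlRec (algebraMap ℝ (RatFun N) s) (blocks (multA (multN μ N) a) (μ.card + 3))
        (Finset.univ.image var) = xiA s μ a • hlQtilde s (addA μ a) N := by
  have h1s : (1 - s) ≠ 0 := by simpa using (one_sub_pow_pos hs 0).ne'
  -- Without a row of length $a$ both sides vanish. For $a=0$ this happens because the new diagram
  -- has more rows than there are variables.
  by_cases hm : multN μ N a = 0
  · rw [hm]
    rcases Nat.eq_zero_or_pos a with rfl | h0
    · rw [hlQtilde_apply_of_lt]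
      · simp
      · rw [colLen_addA (Or.inl rfl)]
        simp only [multN] at hm
        simp
        omega
    · rw [multN_eq_cmult _ _ h0.ne'] at hm
      simp [xiA, hm, h0.ne']
  · have hv : a = 0 ∨ 1 ≤ cmult μ a := by
      rcases Nat.eq_zero_or_pos a with h0 | h0
      · exact Or.inl h0
      · rw [multN_eq_cmult _ _ h0.ne'] at hm
        exact Or.inr (by omega)
    have hN : (addA μ a).colLen 0 ≤ N := by
      rw [colLen_addA hv]
      rcases Nat.eq_zero_or_pos a with rfl | h0
      · simp only [multN] at hm
        simp; omega
      · rw [if_neg (by omega)]; omega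
    rw [hlQtilde_apply hs hN, hlR_eq_hlRec s hN (rowLen_zero_lt_of_twoStep (twoStep_addA hv)),
      multN_addA hv, smul_smul]
    congr 1
    rw [hlScale, hlScale, rowSum_addA hv, colLen_addA hv, xiA]
    have e : multN μ N (a + 1) = cmult μ (a + 1) := rfl
    have hsgn : ((-1 : ℝ)) ^ (rowSum μ + (μ.colLen a + μ.colLen (a + 1))) =
        (-1) ^ rowSum μ * (-1) ^ cmult μ (a + 1) := by
      have h1 := μ.colLen_anti a (a + 1) (by omega)
      have : rowSum μ + (μ.colLen a + μ.colLen (a + 1)) =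
          rowSum μ + cmult μ (a + 1) + 2 * μ.colLen (a + 1) := by
        simp only [cmult, Nat.add_sub_cancel]; omega
      rw [this, pow_add, pow_add, pow_mul]
      simp
    have hsq : ((-1 : ℝ) ^ cmult μ (a + 1)) * (-1) ^ cmult μ (a + 1) = 1 := by
      rw [← mul_pow]; simp
    rw [e, hsgn, neg_pow s]
    rcases Nat.eq_zero_or_pos a with rfl | h0
    · have h2 : N - (μ.colLen 0 + if 0 = 0 ∨ 0 = 0 + 1 then 1 else 0) = N - μ.colLen 0 - 1 := by
        simp; omega
      simp only [multN, true_or, if_true] at hm h2 ⊢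
      obtain ⟨r, hr⟩ := Nat.exists_eq_succ_of_ne_zero hm
      rw [h2, hr, Nat.succ_eq_add_one, Nat.add_sub_cancel, hlv_succ]
      have h3 := (hlv_pos hs r).ne'
      have h4 := (one_sub_pow_pos hs r).ne'
      simp only [pow_succ _ (μ.colLen 0)]
      field_simp
      linear_combination (-(1 + s) * s ^ cmult μ (0 + 1)) * hsq
    · rw [multN_eq_cmult _ _ h0.ne', if_neg h0.ne', if_neg (by omega), add_zero]
      linear_combination (-1) * ((1 + s) * s ^ cmult μ (a + 1) * (1 - s ^ cmult μ a) *
        (-1) ^ rowSum μ * ((1 - s) ^ μ.colLen 0 / hlv s (N - μ.colLen 0))) * hsq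

open Classical in
-- Here the sign exponent changes by the odd number $2\mu'_a+1$, which cancels the minus sign of the
-- straightening formula. For $a=0$ the two factors in $m_0$ are absorbed by the quotient of the
-- values of $v$.
lemma expansion_termB {s : ℝ} (hs : |s| < 1) {μ : YoungDiagram} {N : ℕ} (h : μ.colLen 0 ≤ N)
    (a : ℕ) :
    (-(hlScale s μ N * ((1 - s ^ (multN μ N a - 1)) * (1 - s ^ multN μ N a)))) •
      hlRec (algebraMap ℝ (RatFun N) s) (blocks (multB (multN μ N) a) (μ.card + 3))
        (Finset.univ.image var) = xiB s μ a • hlQtilde s (addB μ a) N := by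
  have h1s : (1 - s) ≠ 0 := by simpa using (one_sub_pow_pos hs 0).ne'
  by_cases hm : multN μ N a < 2
  · have hz : (1 - s ^ (multN μ N a - 1)) * (1 - s ^ multN μ N a) = 0 := by
      obtain hm | hm : multN μ N a = 0 ∨ multN μ N a = 1 := by omega
      all_goals simp [hm]
    rw [hz, mul_zero, neg_zero, zero_smul]
    rcases Nat.eq_zero_or_pos a with rfl | h0
    · rw [hlQtilde_apply_of_lt, smul_zero]
      rw [colLen_addB (Or.inl rfl)]
      simp only [multN] at hm
      simp
      omega
    · rw [multN_eq_cmult _ _ h0.ne'] at hz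
      rw [xiB, if_neg h0.ne', mul_comm, hz, zero_smul]
  · have hv : a = 0 ∨ 2 ≤ cmult μ a := by
      rcases Nat.eq_zero_or_pos a with h0 | h0
      · exact Or.inl h0
      · rw [multN_eq_cmult _ _ h0.ne'] at hm
        exact Or.inr (by omega)
    have hN : (addB μ a).colLen 0 ≤ N := by
      rw [colLen_addB hv]
      rcases Nat.eq_zero_or_pos a with rfl | h0
      · simp only [multN] at hm
        simp; omega
      · rw [if_neg (by omega)]; omega
    rw [hlQtilde_apply hs hN, hlR_eq_hlRec s hN (rowLen_zero_lt_of_twoStep (twoStep_addB hv)),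
      multN_addB hv, smul_smul]
    congr 1
    rw [hlScale, hlScale, rowSum_addB hv, colLen_addB hv, xiB]
    have hsgn : ((-1 : ℝ)) ^ (rowSum μ + (μ.colLen a + (μ.colLen a + 1))) =
        - (-1) ^ rowSum μ := by
      have : rowSum μ + (μ.colLen a + (μ.colLen a + 1)) =
          rowSum μ + 2 * μ.colLen a + 1 := by omega
      rw [this, pow_add, pow_add, pow_mul]
      simp
    rw [hsgn]
    rcases Nat.eq_zero_or_pos a with rfl | h0
    · have h2 : N - (μ.colLen 0 + if 0 = 0 then 2 else 0) = N - μ.colLen 0 - 2 := by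
        simp; omega
      simp only [multN, if_true] at hm h2 ⊢
      obtain ⟨r, hr⟩ : ∃ r, N - μ.colLen 0 = r + 1 + 1 := ⟨N - μ.colLen 0 - 2, by omega⟩
      rw [h2, hr, Nat.add_sub_cancel, show r + 1 + 1 - 2 = r by omega, hlv_succ, hlv_succ]
      have h3 := (hlv_pos hs r).ne'
      have h4 := (one_sub_pow_pos hs r).ne'
      have h5 := (one_sub_pow_pos hs (r + 1)).ne'
      simp only [pow_add _ (μ.colLen 0)]
      field_simp
    · rw [multN_eq_cmult _ _ h0.ne', if_neg h0.ne', if_neg h0.ne]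
      simp only [add_zero]
      ring

lemma colLen_zero_le_addA {s : ℝ} {μ : YoungDiagram} {j : ℕ} (h : xiA s μ j ≠ 0) :
    μ.colLen 0 ≤ (addA μ j).colLen 0 := by
  rw [colLen_addA (valid_of_xiA_ne_zero h)]; omega

lemma colLen_zero_le_addB {s : ℝ} {μ : YoungDiagram} {j : ℕ} (h : xiB s μ j ≠ 0) :
    μ.colLen 0 ≤ (addB μ j).colLen 0 := by
  rw [colLen_addB (valid_of_xiB_ne_zero h)]; omega

/-- The identity is checked for each number $N$ of variables separately. If $N\ge\ell(\mu)$, it is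
`raise_blocks` applied to the rows of $\mu$ padded with zeros, followed by a change of normalization
in each term. -/
lemma isExpansion_expansion {s : ℝ} (hs : |s| < 1) (μ : YoungDiagram) :
    IsExpansion s μ (expansion s μ) := by
  classical
  refine ⟨fun ν hν => (twoStep_of_expansion_ne_zero (Finsupp.mem_support_iff.1 hν)).card_eq, ?_⟩
  have e1 : ((expansion s μ).sum fun ν a => a • hlQtilde s ν) =
      ∑ j ∈ Finset.range (μ.card + 1),
        (xiA s μ j • hlQtilde s (addA μ j) + xiB s μ j • hlQtilde s (addB μ j)) := by
    rw [expansion, ← Finsupp.sum_finsetSum_index (by simp) (by intros; rw [add_smul])]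
    refine Finset.sum_congr rfl fun j _ => ?_
    rw [Finsupp.sum_add_index' (by simp) (by intros; rw [add_smul]),
      Finsupp.sum_single_index (by simp), Finsupp.sum_single_index (by simp)]
  rw [e1]
  funext N
  rw [Pi.mul_apply, Finset.sum_apply]
  simp only [Pi.add_apply, Pi.smul_apply]
  by_cases h : μ.colLen 0 ≤ N
  · simp only [← expansion_termA hs h, ← expansion_termB hs h]
    rw [hlQtilde_apply hs h, hlR_eq_hlRec s h
      (lt_of_le_of_lt (rowLen_zero_le_card μ) (by omega : μ.card < μ.card + 3))]
    set τ := algebraMap ℝ (RatFun N) s with hτ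
    have hcard : (Finset.univ.image (var : Fin N → RatFun N)).card =
        (blocks (multN μ N) (μ.card + 3)).length := by
      rw [Finset.card_image_of_injective _ (var_injective N), ← rows_eq_blocks h
        (lt_of_le_of_lt (rowLen_zero_le_card μ) (by omega : μ.card < μ.card + 3))]
      simp
    have hp : powerSum 2 N = ∑ x ∈ Finset.univ.image (var : Fin N → RatFun N), x ^ 2 := by
      rw [Finset.sum_image (var_injective N).injOn]; rfl
    have hr := raise_blocks (isStraight_hlRec τ (Finset.univ.image (var : Fin N → RatFun N)))
      (multN μ N) (μ.card + 1) (μ.card + 3) (fun a ha => by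
        rw [multN_eq_cmult _ _ (by omega), cmult,
          colLen_eq_zero μ (by have := rowLen_zero_le_card μ; omega),
          colLen_eq_zero μ (by have := rowLen_zero_le_card μ; omega)]) (by omega)
    rw [← powerSum_mul_hlRec τ _ _ hcard, ← hp] at hr
    have e2 : (1 - s ^ 2) • powerSum 2 N * hlScale s μ N • hlRec τ
        (blocks (multN μ N) (μ.card + 3)) (Finset.univ.image var) =
        hlScale s μ N • ((1 - τ ^ 2) * (powerSum 2 N * hlRec τ
        (blocks (multN μ N) (μ.card + 3)) (Finset.univ.image var))) := by
      simp only [Algebra.smul_def, map_sub, map_pow, map_one, hτ]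
      ring
    rw [e2, hr, Finset.smul_sum]
    refine Finset.sum_congr rfl fun a _ => ?_
    simp only [Algebra.smul_def, map_sub, map_pow, map_one, map_mul, map_neg, map_add, hτ]
    ring
  -- With fewer variables than rows of $\mu$ both sides vanish, since adding boxes does not shorten
  -- the first column.
  · rw [not_le] at h
    rw [hlQtilde_apply_of_lt h, mul_zero]
    symm
    refine Finset.sum_eq_zero fun j _ => ?_
    have hA : xiA s μ j • hlQtilde s (addA μ j) N = 0 := by
      by_cases hx : xiA s μ j = 0
      · rw [hx, zero_smul]
      · rw [hlQtilde_apply_of_lt (h.trans_le (colLen_zero_le_addA hx)), smul_zero]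
    have hB : xiB s μ j • hlQtilde s (addB μ j) N = 0 := by
      by_cases hx : xiB s μ j = 0
      · rw [hx, zero_smul]
      · rw [hlQtilde_apply_of_lt (h.trans_le (colLen_zero_le_addB hx)), smul_zero]
    rw [hA, hB, add_zero]

lemma sum_pow_ne_zero {s : ℝ} (hs : |s| < 1) (m : ℕ) (hm : 0 < m) :
    ∑ i ∈ Finset.range m, s ^ i ≠ 0 := by
  have h1 := geom_sum_mul_neg s m
  obtain ⟨n, rfl⟩ : ∃ n, m = n + 1 := ⟨m - 1, by omega⟩
  have h2 := one_sub_pow_pos hs n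
  rw [← h1] at h2
  exact left_ne_zero_of_mul h2.ne'

lemma rows_injOn (N : ℕ) : Set.InjOn (fun ν : YoungDiagram => List.ofFn fun i : Fin N => ν.rowLen i)
    {ν | ν.colLen 0 ≤ N} := by
  intro μ hμ ν hν h
  have h1 := List.ofFn_injective h
  have key : ∀ i, μ.rowLen i = ν.rowLen i := by
    intro i
    by_cases hi : i < N
    · exact congrFun h1 ⟨i, hi⟩
    · have h0 : ∀ ρ : YoungDiagram, ρ.colLen 0 ≤ N → ρ.rowLen i = 0 := by
        intro ρ hρ
        by_contra h'
        have := YoungDiagram.mem_iff_lt_rowLen.2 (Nat.pos_of_ne_zero h')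
        rw [YoungDiagram.mem_iff_lt_colLen] at this
        omega
      rw [h0 μ hμ, h0 ν hν]
  ext ⟨i, j⟩
  simp only [YoungDiagram.mem_cells, YoungDiagram.mem_iff_lt_rowLen, key]

/-- A vanishing combination is evaluated at arbitrary distinct real points, where it becomes a
relation between the polynomials `hlRec`. The coefficients differ only by the nonzero
normalizations. -/
lemma hlQtilde_linearIndependent {s : ℝ} (hs : |s| < 1) (N : ℕ) (d : YoungDiagram →₀ ℝ)
    (hN : ∀ ν ∈ d.support, ν.colLen 0 ≤ N)
    (h : ∑ ν ∈ d.support, d ν • hlQtilde s ν N = 0) : d = 0 := by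
  classical
  set rows := fun ν : YoungDiagram => List.ofFn fun i : Fin N => ν.rowLen i with hrows
  have hinj : Set.InjOn rows d.support := (rows_injOn N).mono hN
  set g := Function.invFunOn rows (d.support : Set YoungDiagram)
  have hg : ∀ ν ∈ d.support, g (rows ν) = ν := fun ν hν => hinj.leftInvOn_invFunOn hν
  have key := hlRec_linearIndependent (sum_pow_ne_zero hs) N (d.support.image rows)
    (by intro L hL; obtain ⟨ν, -, rfl⟩ := Finset.mem_image.1 hL; simp [hrows])
    (by intro L hL; obtain ⟨ν, -, rfl⟩ := Finset.mem_image.1 hL; exact pairwise_rows ν N)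
    (fun L => d (g L) * hlScale s (g L) N) (by
      intro S hS
      rw [Finset.sum_image hinj]
      set x : Fin N → ℝ := ⇑(S.orderEmbOfFin hS) with hx
      have hxi : Function.Injective x := (S.orderEmbOfFin hS).injective
      have hS' : S = Finset.univ.image x := by
        rw [← Finset.coe_inj, Finset.coe_image, Finset.coe_univ, Set.image_univ, hx,
          Finset.range_orderEmbOfFin]
      have h1 : EvalsTo x (∑ ν ∈ d.support, d ν • hlQtilde s ν N)
          (∑ ν ∈ d.support, (d ν * hlScale s ν N) * hlSum s (fun i => ν.rowLen i) x) := by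
        refine EvalsTo.sum _ fun ν hν => ?_
        rw [hlQtilde_apply hs (hN ν hν), smul_smul, Algebra.smul_def, hlR_eq_hlSum]
        exact (evalsTo_const _).mul (evalsTo_hlSum hxi _ _)
      rw [h] at h1
      rw [← h1.eq_zero]
      refine Finset.sum_congr rfl fun ν hν => ?_
      rw [hg ν hν, hS', hlSum_eq_hlRec _ _ _ hxi])
  rw [← Finsupp.support_eq_empty, Finset.eq_empty_iff_forall_notMem]
  intro ν hν
  have := key _ (Finset.mem_image_of_mem _ hν)
  rw [hg ν hν] at this
  exact (Finsupp.mem_support_iff.1 hν) ((mul_eq_zero.1 this).resolve_right (hlScale_ne_zero hs _ _))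

/-- All diagrams involved have $|\mu|+2$ boxes, hence at most that many rows; this number of
variables therefore suffices to separate them. -/
lemma IsExpansion.unique {s : ℝ} (hs : |s| < 1) {μ : YoungDiagram} {c c' : YoungDiagram →₀ ℝ}
    (h : IsExpansion s μ c) (h' : IsExpansion s μ c') : c = c' := by
  classical
  rw [← sub_eq_zero]
  have hsupp : ∀ ν ∈ c.support ∪ c'.support, ν.colLen 0 ≤ μ.card + 2 := by
    intro ν hν
    refine (colLen_zero_le_card ν).trans ?_
    rcases Finset.mem_union.1 hν with hν | hν
    · exact (h.1 ν hν).le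
    · exact (h'.1 ν hν).le
  have hsub : (c - c').support ⊆ c.support ∪ c'.support := Finsupp.support_sub
  refine hlQtilde_linearIndependent hs (μ.card + 2) _ (fun ν hν => hsupp ν (hsub hν)) ?_
  have h1 := congrFun (h.2.symm.trans h'.2) (μ.card + 2)
  rw [Finsupp.sum_of_support_subset c Finset.subset_union_left _ (by simp),
    Finsupp.sum_of_support_subset c' Finset.subset_union_right _ (by simp), Finset.sum_apply,
    Finset.sum_apply, ← sub_eq_zero, ← Finset.sum_sub_distrib] at h1
  rw [← h1, Finset.sum_subset hsub]
  · refine Finset.sum_congr rfl fun ν _ => ?_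
    rw [Finsupp.sub_apply, sub_smul, Pi.smul_apply, Pi.smul_apply]
  · intro ν _ hν
    rw [Finsupp.notMem_support_iff.1 hν, zero_smul]

lemma xi_eq {s : ℝ} (hs : |s| < 1) (lam μ : YoungDiagram) : xi s lam μ = expansion s μ lam := by
  rw [xi, IsExpansion.unique hs (Classical.epsilon_spec ⟨_, isExpansion_expansion hs μ⟩)
    (isExpansion_expansion hs μ)]

/-- The sum over the edges of the even Young graph going up from `μ`. -/
lemma sum_evenYoungGraph {s : ℝ} (hs : |s| < 1) {n : ℕ} (μ : (evenYoungGraph s).V n)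
    (G : YoungDiagram → ℝ) :
    ∑ lam : (evenYoungGraph s).V (n + 1), (evenYoungGraph s).weight n lam μ * G lam.1 =
      ∑ j ∈ Finset.range (2 * n + 1),
        (xiA s μ.1 j * G (addA μ.1 j) + xiB s μ.1 j * G (addB μ.1 j)) := by
  classical
  have hw : ∀ lam : (evenYoungGraph s).V (n + 1),
      (evenYoungGraph s).weight n lam μ = expansion s μ.1 lam.1 := by
    intro lam
    change (if TwoStep μ.1 lam.1 then xi s lam.1 μ.1 else 0) = _
    rw [xi_eq hs]
    split_ifs with h
    · rfl
    · exact (by_contra fun h' => h (twoStep_of_expansion_ne_zero (Ne.symm h')))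
  have hcard : μ.1.card = 2 * n := μ.2
  simp only [hw]
  have e1 : ((expansion s μ.1).sum fun ν a => a * G ν) = ∑ j ∈ Finset.range (2 * n + 1),
        (xiA s μ.1 j * G (addA μ.1 j) + xiB s μ.1 j * G (addB μ.1 j)) := by
    rw [expansion, hcard, ← Finsupp.sum_finsetSum_index (by simp) (by intros; rw [add_mul])]
    refine Finset.sum_congr rfl fun j _ => ?_
    rw [Finsupp.sum_add_index' (by simp) (by intros; rw [add_mul]),
      Finsupp.sum_single_index (by simp), Finsupp.sum_single_index (by simp)]
  rw [← e1, Finsupp.sum]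
  refine Finset.sum_bij_ne_zero (fun lam _ _ => lam.1) ?_ ?_ ?_ ?_
  · intro lam _ h
    exact Finsupp.mem_support_iff.2 (left_ne_zero_of_mul h)
  · intro a _ _ b _ _ h
    exact Subtype.ext h
  · intro ν hν h
    have h1 := (twoStep_of_expansion_ne_zero (Finsupp.mem_support_iff.1 hν)).card_eq
    exact ⟨⟨ν, by rw [h1, hcard]; ring⟩, Finset.mem_univ _, h, rfl⟩
  · intros
    rfl

end Expansion

/-! ## Sesquilinear forms over the quadratic extension of a finite field -/

/-- `σ` behaves like the conjugation of the quadratic extension of the field with `q` elements. -/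
structure IsQuadConj {K : Type*} [Field K] (σ : K →+* K) (q : ℕ) : Prop where
  invol : ∀ x, σ (σ x) = x
  norm : ∀ a, σ a = a → a ≠ 0 → ∃ c, c ≠ 0 ∧ σ c * c = a
  two : (2 : K) ≠ 0
  moved : ∃ θ, σ θ ≠ θ
  card_fixed : Nat.card {a // σ a = a} = q
  card : Nat.card K = q ^ 2
  one_lt : 1 < q

section Field

variable {k K : Type*} [Field k] [Fintype k] [Field K] [Fintype K] [Algebra k K]

/-- The polynomial $X^q-X$ has at most $q$ roots, so the fixed points are exactly the image of $k$.
Solvability of $\sigma(c)c=a$ is surjectivity of the norm, which is the power map with exponent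
$(q^2-1)/(q-1)=q+1$. -/
lemma isQuadConj_conj (hodd : Odd (Fintype.card k)) (hdeg : Module.finrank k K = 2) :
    IsQuadConj (conj k K : K →+* K) (Fintype.card k) := by
  classical
  set q := Fintype.card k with hq
  have hq1 : 1 < q := Fintype.one_lt_card
  have hcard : Fintype.card K = q ^ 2 := by
    rw [Module.card_eq_pow_finrank (K := k), hdeg]
  have happ : ∀ x : K, (conj k K : K →+* K) x = x ^ q := fun x => rfl
  have hfix : {a : K | (conj k K : K →+* K) a = a} = Set.range (algebraMap k K) := by
    symm
    refine Set.eq_of_subset_of_ncard_le ?_ ?_ (Set.toFinite _)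
    · rintro _ ⟨a, rfl⟩
      exact (conj k K).commutes a
    · rw [← Set.image_univ, Set.ncard_image_of_injective _ (algebraMap k K).injective,
        Set.ncard_univ, Nat.card_eq_fintype_card]
      set p : Polynomial K := Polynomial.X ^ q - Polynomial.X
      have hp0 : p ≠ 0 := FiniteField.X_pow_card_sub_X_ne_zero K hq1
      calc {a : K | (conj k K : K →+* K) a = a}.ncard
          ≤ (p.roots.toFinset : Set K).ncard := by
            refine Set.ncard_le_ncard (fun a ha => ?_) (Set.toFinite _)
            simp only [Set.mem_ofPred_eq, happ] at ha
            simp [p, hp0, ha]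
        _ = p.roots.toFinset.card := Set.ncard_coe_finset _
        _ ≤ p.roots.card := Multiset.toFinset_card_le _
        _ ≤ p.natDegree := p.card_roots'
        _ = q := FiniteField.X_pow_card_sub_X_natDegree_eq K hq1
  have hcf : Nat.card {a // (conj k K : K →+* K) a = a} = q := by
    change Nat.card ↥{a : K | (conj k K : K →+* K) a = a} = q
    rw [hfix, ← Set.image_univ, Nat.card_coe_set_eq,
      Set.ncard_image_of_injective _ (algebraMap k K).injective, Set.ncard_univ,
      Nat.card_eq_fintype_card]
  refine ⟨fun x => ?_, fun a ha ha0 => ?_, ?_, ?_, hcf, ?_, hq1⟩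
  · rw [happ, happ, ← pow_mul, ← sq, ← hcard, FiniteField.pow_card]
  · have : a ∈ Set.range (algebraMap k K) := by rw [← hfix]; exact ha
    obtain ⟨b, rfl⟩ := this
    obtain ⟨c, hc⟩ := FiniteField.norm_surjective k K b
    have h1 : c ^ (q + 1) = algebraMap k K b := by
      rw [← hc, FiniteField.algebraMap_norm_eq_pow, Nat.card_eq_fintype_card,
        Nat.card_eq_fintype_card, hcard, ← hq]
      congr 1
      symm
      apply Nat.div_eq_of_eq_mul_left (by omega)
      have := Nat.sq_sub_sq q 1
      simpa using this
    refine ⟨c, ?_, by rw [happ, ← pow_succ, h1]⟩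
    rintro rfl
    rw [zero_pow (by omega)] at h1
    exact ha0 h1.symm
  · intro h2
    have hc : CharP K 2 := CharTwo.of_one_ne_zero_of_two_eq_zero one_ne_zero h2
    have : ringChar K = 2 := ringChar.eq K 2 ▸ rfl
    have h3 := (FiniteField.even_card_iff_char_two (F := K)).1 this
    rw [hcard] at h3
    have := hodd.pow (n := 2)
    rw [Nat.odd_iff] at this
    omega
  · by_contra hcon
    push Not at hcon
    have : Nat.card {a // (conj k K : K →+* K) a = a} = Nat.card K :=
      Nat.card_congr (Equiv.subtypeUnivEquiv hcon)
    rw [hcf, Nat.card_eq_fintype_card, hcard] at this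
    nlinarith
  · rw [Nat.card_eq_fintype_card, hcard]

end Field

/-! ### Isotropic vectors of possibly degenerate forms -/

section Forms

variable {K : Type*} [Field K] {σ : K →+* K} {q : ℕ} {V : Type*} [AddCommGroup V] [Module K V]

/-- If $H(v,v)=0$ for all $v$, polarization gives $H(u,v)=-H(v,u)$. Applying this to $\theta u$ with
$\sigma\theta\ne\theta$ yields $(\sigma\theta-\theta)H(u,v)=0$. No symmetry of $H$ is needed, which
allows the use for $(u,v)\mapsto H(u,X^nv)$. -/
lemma exists_nonisotropic (hσ : IsQuadConj σ q) {H : V →ₛₗ[σ] V →ₗ[K] K} (hH : H ≠ 0) :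
    ∃ e, H e e ≠ 0 := by
  by_contra hcon
  push Not at hcon
  have h1 : ∀ u v, H u v + H v u = 0 := fun u v => by
    have := hcon (u + v)
    simpa [hcon] using this
  obtain ⟨θ, hθ⟩ := hσ.moved
  refine hH (LinearMap.ext fun u => LinearMap.ext fun v => ?_)
  have h2 := h1 (θ • u) v
  rw [map_smulₛₗ, LinearMap.smul_apply, map_smul, smul_eq_mul, smul_eq_mul] at h2
  have h3 : (σ θ - θ) * H u v = 0 := by linear_combination h2 - θ * h1 u v
  simpa using (mul_eq_zero.1 h3).resolve_left (sub_ne_zero.2 hθ)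

lemma form_smul_smul (H : V →ₛₗ[σ] V →ₗ[K] K) (c : K) (v : V) :
    H (c • v) (c • v) = σ c * c * H v v := by
  rw [map_smul, map_smulₛₗ, LinearMap.smul_apply, smul_eq_mul, smul_eq_mul]
  ring

/-- The complement of a nonisotropic vector. -/
def splitVector {H : V →ₛₗ[σ] V →ₗ[K] K} {e : V} (he : H e e ≠ 0) :
    (K × LinearMap.ker (H e)) ≃ V where
  toFun p := p.1 • e + p.2.1
  invFun v := (H e v / H e e, ⟨v - (H e v / H e e) • e, by
    rw [LinearMap.mem_ker, map_sub, map_smul, smul_eq_mul, div_mul_cancel₀ _ he, sub_self]⟩)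
  left_inv := by
    rintro ⟨c, w, hw⟩
    rw [LinearMap.mem_ker] at hw
    simp [hw, he]
  right_inv v := by simp

lemma card_quad [Finite K] [FiniteDimensional K V] (hσ : IsQuadConj σ q) :
    Nat.card V = q ^ (2 * Module.finrank K V) := by
  rw [Module.natCard_eq_pow_finrank (K := K), hσ.card, ← pow_mul]

/-- Write vectors as $ce+w$ with $w\in W=\ker H(e,\cdot)$. By scaling and surjectivity of the norm,
each nonzero admissible value of $H(w,w)$ is taken the same number $M$ of times. With $n_0$
isotropic vectors in $W$, there are $n_0+(q^2-1)M$ in the whole space, while $|W|=n_0+(q-1)M$;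
eliminating $M$ gives the formula. -/
lemma card_isotropic_split [Finite K] [FiniteDimensional K V] (hσ : IsQuadConj σ q) {ε : K}
    {H : V →ₛₗ[σ] V →ₗ[K] K} (hε : ∀ u v, σ (H u v) = ε * H v u) {e : V} (he : H e e ≠ 0) :
    (Nat.card {v // H v v = 0} : ℝ) =
      Nat.card {w : LinearMap.ker (H e) // H w.1 w.1 = 0} + (q + 1) *
        (Nat.card (LinearMap.ker (H e)) -
          Nat.card {w : LinearMap.ker (H e) // H w.1 w.1 = 0}) := by
  classical
  have := Fintype.ofFinite K
  have : Finite V := Module.finite_of_finite K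
  have := Fintype.ofFinite V
  have := Fintype.ofFinite (LinearMap.ker (H e))
  set W := LinearMap.ker (H e) with hW
  set z := H e e with hz
  have horth : ∀ w : W, H w.1 e = 0 := by
    intro w
    have h1 : H e w.1 = 0 := w.2
    have h2 := hε e w.1
    rw [h1, map_zero] at h2
    rcases mul_eq_zero.1 h2.symm with h3 | h3
    · have h4 := hε e e
      rw [h3, zero_mul] at h4
      exact absurd ((map_eq_zero σ).1 h4) he
    · exact h3
  set M := Fintype.card {w : W // H w.1 w.1 = -z} with hM
  have hscale : ∀ c : K, c ≠ 0 → Fintype.card {w : W // H w.1 w.1 = -(σ c * c * z)} = M := by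
    intro c hc
    have hσc : σ c ≠ 0 := (map_ne_zero σ).2 hc
    exact (Fintype.card_congr ⟨fun w => ⟨c • w.1, by
        rw [Submodule.coe_smul, form_smul_smul, w.2]; ring⟩,
      fun w => ⟨c⁻¹ • w.1, by
        rw [Submodule.coe_smul, form_smul_smul, w.2, map_inv₀]; field_simp⟩,
      fun w => Subtype.ext (inv_smul_smul₀ hc w.1),
      fun w => Subtype.ext (smul_inv_smul₀ hc w.1)⟩).symm
  -- the isotropic vectors of the whole space
  have hfib : Fintype.card {v // H v v = 0} =
      ∑ c : K, Fintype.card {w : W // H w.1 w.1 = -(σ c * c * z)} := by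
    rw [← Fintype.card_sigma]
    have hval : ∀ p : K × W, H (splitVector he p) (splitVector he p) =
        σ p.1 * p.1 * z + H p.2.1 p.2.1 := by
      rintro ⟨c, w⟩
      have h1 : H e w.1 = 0 := w.2
      simp [splitVector, map_smulₛₗ, horth w, h1, hz]
      ring
    refine Fintype.card_congr (((splitVector he).subtypeEquiv
      (p := fun p => H p.2.1 p.2.1 = -(σ p.1 * p.1 * z)) fun p => ?_).symm.trans
      (Equiv.subtypeProdEquivSigmaSubtype fun (c : K) (w : W) => H w.1 w.1 = -(σ c * c * z)))
    rw [hval, add_comm, add_eq_zero_iff_eq_neg]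
  have h0 : Fintype.card {v // H v v = 0} =
      Fintype.card {w : W // H w.1 w.1 = 0} + (Fintype.card K - 1) * M := by
    rw [hfib, ← Finset.add_sum_erase _ _ (Finset.mem_univ (0 : K))]
    congr 1
    · exact Fintype.card_congr (Equiv.subtypeEquivRight fun w => by simp)
    · rw [Finset.sum_congr rfl fun c hc => hscale c (Finset.ne_of_mem_erase hc),
        Finset.sum_const, Finset.card_erase_of_mem (Finset.mem_univ _), Finset.card_univ,
        smul_eq_mul]
  -- all vectors of the complement
  have hfixed : ∀ a : {a // σ a = a}, Fintype.card {w : W // H w.1 w.1 = -(a.1 * z)} =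
      if a.1 = 0 then Fintype.card {w : W // H w.1 w.1 = 0} else M := by
    intro a
    split_ifs with ha
    · exact Fintype.card_congr (Equiv.subtypeEquivRight fun w => by simp [ha])
    · obtain ⟨c, hc, hca⟩ := hσ.norm a.1 a.2 ha
      rw [← hscale c hc, hca]
  have h1 : Fintype.card W = Fintype.card {w : W // H w.1 w.1 = 0} + (q - 1) * M := by
    have hsum : Fintype.card W = ∑ a : {a // σ a = a},
        Fintype.card {w : W // H w.1 w.1 = -(a.1 * z)} := by
      rw [← Fintype.card_sigma]
      refine Fintype.card_congr ⟨fun w => ⟨⟨-(H w.1 w.1) / z, ?_⟩, ⟨w, ?_⟩⟩, fun p => p.2.1,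
        fun w => rfl, ?_⟩
      -- The quotient $H(w,w)/H(e,e)$ is fixed by $\sigma$, since both values are twisted by the
      -- same $\varepsilon$.
      · have h1 := hε w.1 w.1
        have h2 := hε e e
        have hσz : σ z ≠ 0 := (map_ne_zero σ).2 he
        rw [map_div₀, map_neg, h1, hz, h2]
        have hε0 : ε ≠ 0 := by
          rintro rfl
          rw [zero_mul] at h2
          exact hσz h2
        rw [← hz]
        field_simp
      · field_simp
      · rintro ⟨⟨a, ha⟩, ⟨w, hw⟩⟩
        have : -(H w.1 w.1) / z = a := by rw [hw]; field_simp
        subst this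
        rfl
    have hcf : Fintype.card {a // σ a = a} = q := by
      rw [← Nat.card_eq_fintype_card, hσ.card_fixed]
    rw [hsum, Finset.sum_congr rfl fun a _ => hfixed a]
    have hz0 : (⟨0, map_zero σ⟩ : {a // σ a = a}) ∈ Finset.univ := Finset.mem_univ _
    rw [← Finset.add_sum_erase _ _ hz0, if_pos rfl,
      Finset.sum_congr rfl fun a ha => if_neg fun h => Finset.ne_of_mem_erase ha (Subtype.ext h),
      Finset.sum_const, Finset.card_erase_of_mem hz0, Finset.card_univ, smul_eq_mul,
      hcf]
  have hq := hσ.one_lt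
  have hK : Fintype.card K = q ^ 2 := by rw [← Nat.card_eq_fintype_card, hσ.card]
  simp only [Nat.card_eq_fintype_card]
  rw [hK] at h0
  have hq2 : 1 ≤ q ^ 2 := Nat.one_le_pow _ _ (by omega)
  rw [h0, h1]
  push_cast [Nat.cast_sub hq2, Nat.cast_sub hq.le]
  ring

/-- The number of isotropic vectors of a Hermitian or skew-Hermitian form, possibly degenerate. -/
lemma card_isotropic [Finite K] (hσ : IsQuadConj σ q) {ε : K} (d : ℕ) {V : Type*}
    [AddCommGroup V] [Module K V] [FiniteDimensional K V] (hd : Module.finrank K V = d)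
    {H : V →ₛₗ[σ] V →ₗ[K] K} (hε : ∀ u v, σ (H u v) = ε * H v u) :
    (q : ℝ) * Nat.card {v // H v v = 0} = (q : ℝ) ^ (2 * d) +
      (q : ℝ) ^ (2 * Module.finrank K (LinearMap.ker H)) *
        (-q : ℝ) ^ (d - Module.finrank K (LinearMap.ker H)) * (q - 1) := by
  induction d generalizing V with
  | zero =>
    have h0 : Subsingleton V := Module.finrank_zero_iff.1 hd
    have h1 : Module.finrank K (LinearMap.ker H) = 0 := by
      have := Submodule.finrank_le (LinearMap.ker H); omega
    have h2 : Nat.card {v // H v v = 0} = 1 := by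
      rw [Nat.card_eq_one_iff_unique]
      exact ⟨inferInstance, ⟨0, by simp⟩⟩
    rw [h1, h2]
    simp
  | succ d ih =>
    by_cases hH : H = 0
    · subst hH
      have h1 : Nat.card {v : V // (0 : V →ₛₗ[σ] V →ₗ[K] K) v v = 0} = Nat.card V :=
        Nat.card_congr (Equiv.subtypeUnivEquiv fun v => by simp)
      rw [h1, LinearMap.ker_zero, finrank_top, card_quad hσ, hd]
      push_cast
      simp
      ring
    · obtain ⟨e, he⟩ := exists_nonisotropic hσ hH
      have hsurj : LinearMap.range (H e) = ⊤ := by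
        rw [LinearMap.range_eq_top]
        exact LinearMap.surjective fun h => he (by rw [h, LinearMap.zero_apply])
      have hW : Module.finrank K (LinearMap.ker (H e)) = d := by
        have := LinearMap.finrank_range_add_finrank_ker (H e)
        rw [hsurj, finrank_top, Module.finrank_self, hd] at this
        omega
      have horth : ∀ w : V, H e w = 0 → H w e = 0 := by
        intro w h1
        have h2 := hε e w
        rw [h1, map_zero] at h2
        rcases mul_eq_zero.1 h2.symm with h3 | h3
        · have h4 := hε e e
          rw [h3, zero_mul] at h4
          exact absurd ((map_eq_zero σ).1 h4) he
        · exact h3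
      have hε0 : ε ≠ 0 := by
        rintro rfl
        have h4 := hε e e
        rw [zero_mul] at h4
        exact absurd ((map_eq_zero σ).1 h4) he
      set W := LinearMap.ker (H e)
      have key := ih (V := W) hW (H := H.domRestrict₁₂ W W) (fun u v => hε u.1 v.1)
      -- Passing to the complement of a nonisotropic vector keeps the radical and lowers the rank by
      -- one, which changes the correction term by one factor $-q$.
      have hker : Module.finrank K (LinearMap.ker (H.domRestrict₁₂ W W)) =
          Module.finrank K (LinearMap.ker H) := by
        rw [← Submodule.finrank_map_subtype_eq]
        have : Submodule.map W.subtype (LinearMap.ker (H.domRestrict₁₂ W W)) = LinearMap.ker H := by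
          ext v
          simp only [Submodule.mem_map, LinearMap.mem_ker, Submodule.subtype_apply]
          constructor
          · rintro ⟨w, hw, rfl⟩
            ext u
            obtain ⟨⟨c, u'⟩, rfl⟩ := (splitVector he).surjective u
            have h1 := LinearMap.congr_fun hw u'
            rw [LinearMap.domRestrict₁₂_apply] at h1
            simp [splitVector, horth w.1 w.2, h1]
          · intro hv
            refine ⟨⟨v, ?_⟩, ?_, rfl⟩
            · have h1 := hε v e
              rw [hv, LinearMap.zero_apply, map_zero] at h1
              exact (mul_eq_zero.1 h1.symm).resolve_left hε0
            · ext u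
              change H v u.1 = 0
              rw [hv, LinearMap.zero_apply]
        rw [this]
      rw [hker] at key
      have hle : Module.finrank K (LinearMap.ker H) ≤ d := by
        rw [← hker, ← hW]; exact Submodule.finrank_le _
      have hsplit := card_isotropic_split hσ hε he
      change (Nat.card {v // H v v = 0} : ℝ) = Nat.card {w : W // H w.1 w.1 = 0} + (q + 1) *
        (Nat.card W - Nat.card {w : W // H w.1 w.1 = 0}) at hsplit
      change (q : ℝ) * Nat.card {w : W // H w.1 w.1 = 0} = _ at key
      rw [card_quad (V := W) hσ, hW] at hsplit
      obtain ⟨m, hm⟩ := Nat.exists_eq_add_of_le hle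
      have e1 : d - Module.finrank K (LinearMap.ker H) = m := by omega
      have e2 : d + 1 - Module.finrank K (LinearMap.ker H) = m + 1 := by omega
      rw [e1] at key
      rw [e2, hsplit]
      push_cast
      have e3 : 2 * (d + 1) = 2 * d + 2 := by ring
      rw [e3, pow_add, pow_succ (-(q : ℝ))]
      linear_combination (-(q : ℝ)) * key

end Forms

/-! ## Classification of nilpotent skew-adjoint endomorphisms of Hermitian spaces -/

section Classification

variable {K : Type*} [Field K] {σ : K →+* K} {q : ℕ} {V : Type*} [AddCommGroup V] [Module K V]

/-- `H` is a nondegenerate Hermitian form, and `X` is skew-adjoint and nilpotent. -/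
structure IsHermSys (H : V →ₛₗ[σ] V →ₗ[K] K) (X : Module.End K V) : Prop where
  herm : ∀ u v, σ (H u v) = H v u
  nondeg : ∀ u, (∀ v, H u v = 0) → u = 0
  skew : ∀ u v, H (X u) v = -H u (X v)
  nilp : IsNilpotent X

lemma skew_pow {H : V →ₛₗ[σ] V →ₗ[K] K} {X : Module.End K V}
    (h : ∀ u v, H (X u) v = -H u (X v)) (i : ℕ) (u v : V) :
    H ((X ^ i) u) v = (-1) ^ i * H u ((X ^ i) v) := by
  induction i generalizing v with
  | zero => simp
  | succ i ih =>
    have e1 : (X ^ (i + 1)) u = X ((X ^ i) u) := by rw [pow_succ', Module.End.mul_apply]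
    have e2 : (X ^ (i + 1)) v = (X ^ i) (X v) := by rw [pow_succ, Module.End.mul_apply]
    rw [e1, e2, h, ih]
    ring

lemma pow_apply_pow (X : Module.End K V) (i j : ℕ) (v : V) :
    (X ^ i) ((X ^ j) v) = (X ^ (i + j)) v := by
  rw [pow_add, Module.End.mul_apply]

lemma pow_apply_eq_zero {X : Module.End K V} {k i : ℕ} {w : V} (hk : (X ^ k) w = 0) (h : k ≤ i) :
    (X ^ i) w = 0 := by
  obtain ⟨j, rfl⟩ := Nat.exists_eq_add_of_le' h
  rw [← pow_apply_pow, hk, map_zero]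

lemma form_pow_pow {H : V →ₛₗ[σ] V →ₗ[K] K} {X : Module.End K V}
    (h : ∀ u v, H (X u) v = -H u (X v)) (i j : ℕ) (u v : V) :
    H ((X ^ i) u) ((X ^ j) v) = (-1) ^ i * H u ((X ^ (i + j)) v) := by
  rw [skew_pow h, pow_apply_pow]

/-- The values `H(w, X^i w)` on a vector generating a top block may be prescribed. -/
lemma exists_normalized (hσ : IsQuadConj σ q) {H : V →ₛₗ[σ] V →ₗ[K] K} {X : Module.End K V}
    (hX : IsHermSys H X) {n : ℕ} (hn : X ^ (n + 1) = 0) {w₀ : V} (hw₀ : H w₀ ((X ^ n) w₀) ≠ 0)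
    {b : ℕ → K} (hb : ∀ i, σ (b i) = (-1) ^ i * b i) (hbn : b n ≠ 0) :
    ∃ w, ∀ i ≤ n, H w ((X ^ i) w) = b i := by
  have ha : ∀ w i, σ (H w ((X ^ i) w)) = (-1) ^ i * H w ((X ^ i) w) := fun w i => by
    rw [hX.herm, skew_pow hX.skew]
  have hzero : ∀ v i, n < i → (X ^ i) v = 0 := fun v i hi =>
    pow_apply_eq_zero (k := n + 1) (by rw [hn, LinearMap.zero_apply]) hi
  have hsq : ∀ i : ℕ, ((-1 : K)) ^ i * (-1) ^ i = 1 := fun i => by rw [← mul_pow]; simp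
  have hne : ∀ i : ℕ, ((-1 : K)) ^ i ≠ 0 := fun i => pow_ne_zero _ (by simp)
  -- The values are corrected from the top exponent $n$ downwards; after stage $l$ those with $i\ge
  -- n-l$ are right.
  suffices h : ∀ l ≤ n, ∃ w, ∀ i ≤ n, n ≤ i + l → H w ((X ^ i) w) = b i by
    obtain ⟨w, hw⟩ := h n le_rfl
    exact ⟨w, fun i hi => hw i hi (by omega)⟩
  intro l
  induction l with
  | zero =>
    intro _
    obtain ⟨c, hc, hca⟩ := hσ.norm (b n / H w₀ ((X ^ n) w₀)) (by
      rw [map_div₀, hb, ha, mul_div_mul_left _ _ (hne n)]) (div_ne_zero hbn hw₀)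
    refine ⟨c • w₀, fun i hi hi' => ?_⟩
    obtain rfl : i = n := by omega
    simp only [map_smul, map_smulₛₗ, LinearMap.smul_apply, smul_eq_mul]
    rw [eq_div_iff hw₀] at hca
    linear_combination hca
  | succ l ih =>
    intro hl
    obtain ⟨w, hw⟩ := ih (by omega)
    set d := b (n - (l + 1)) - H w ((X ^ (n - (l + 1))) w) with hd
    have hσd : σ d = (-1) ^ (n - (l + 1)) * d := by
      rw [hd, map_sub, hb, ha]; ring
    -- Replacing $w$ by $w+cX^{l+1}w$ keeps the values with $i>n-(l+1)$ and changes the one at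
    -- $n-(l+1)$ by $(c+(-1)^{l+1}\sigma(c))\,b_n=2c\,b_n$, which must equal the error $d$. Odd
    -- characteristic enters here.
    set c := d / (2 * b n) with hc
    have hσc : σ c = (-1) ^ (l + 1) * c := by
      have h1 : ((-1 : K)) ^ n = (-1) ^ (n - (l + 1)) * (-1) ^ (l + 1) := by
        rw [← pow_add]; congr 1; omega
      have h2 := hne (n - (l + 1))
      have h3 := hne (l + 1)
      have h4 := hσ.two
      rw [hc, map_div₀, map_mul, hσd, hb, map_ofNat, h1]
      field_simp
      rw [← pow_mul, mul_comm (l + 1) 2, pow_mul]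
      simp
    refine ⟨w + c • (X ^ (l + 1)) w, fun i hi hi' => ?_⟩
    have hexp : H (w + c • (X ^ (l + 1)) w) ((X ^ i) (w + c • (X ^ (l + 1)) w)) =
        H w ((X ^ i) w) + (c + (-1) ^ (l + 1) * σ c) * H w ((X ^ (i + (l + 1))) w) +
        σ c * c * (-1) ^ (l + 1) * H w ((X ^ (l + 1 + i + (l + 1))) w) := by
      simp only [map_add, map_smul, map_smulₛₗ, LinearMap.add_apply, LinearMap.smul_apply,
        smul_eq_mul, form_pow_pow hX.skew, pow_apply_pow]
      rw [add_comm (l + 1) i, ← add_assoc]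
      ring_nf
    rw [hexp, hzero w (l + 1 + i + (l + 1)) (by omega), map_zero, mul_zero, add_zero]
    by_cases h : n ≤ i + l
    · rw [hw i hi h, hzero w (i + (l + 1)) (by omega), map_zero, mul_zero, add_zero]
    · have h1 : i + (l + 1) = n := by omega
      have h2 : i = n - (l + 1) := by omega
      rw [h1, hw n le_rfl (by omega), hσc, ← mul_assoc, hsq, one_mul, h2]
      have h4 := hσ.two
      have h5 : (c + c) * b n = d := by rw [hc]; field_simp; norm_num
      rw [h5, hd]
      ring

/-- The map `c ↦ ∑ c_i X^i w`. -/
def cyc (X : Module.End K V) (w : V) (n : ℕ) : (Fin n → K) →ₗ[K] V :=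
  Fintype.linearCombination K fun i : Fin n => (X ^ (i : ℕ)) w

lemma cyc_apply (X : Module.End K V) (w : V) (n : ℕ) (c : Fin n → K) :
    cyc X w n c = ∑ i, c i • (X ^ (i : ℕ)) w := Fintype.linearCombination_apply ..

/-- The orthogonal complement of the span of the `X^i w`. -/
def cycPerp (H : V →ₛₗ[σ] V →ₗ[K] K) (X : Module.End K V) (w : V) : Submodule K V :=
  ⨅ i : ℕ, LinearMap.ker (H ((X ^ i) w))

lemma mem_cycPerp {H : V →ₛₗ[σ] V →ₗ[K] K} {X : Module.End K V} {w v : V} :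
    v ∈ cycPerp H X w ↔ ∀ i, H ((X ^ i) w) v = 0 := by
  simp [cycPerp]

variable {H : V →ₛₗ[σ] V →ₗ[K] K} {X : Module.End K V} {w : V} {n : ℕ}

lemma form_cyc (hX : IsHermSys H X) (i j : ℕ) (c : Fin n → K) :
    H ((X ^ i) w) ((X ^ j) (cyc X w n c)) =
      ∑ l, c l * ((-1) ^ i * H w ((X ^ (i + (j + l))) w)) := by
  simp only [cyc_apply, map_sum, map_smul, pow_apply_pow, form_pow_pow hX.skew, smul_eq_mul]

/-- The Gram matrix of $w,Xw,\dots,X^nw$ is triangular with respect to the second diagonal, whose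
entries are $\pm H(w,X^nw)\ne0$. Pairing with $X^{n-m}w$ isolates the $m$-th coefficient once the
earlier ones are known to vanish. -/
lemma eq_zero_of_form_cyc (hX : IsHermSys H X) (hw : (X ^ (n + 1)) w = 0)
    (hn : H w ((X ^ n) w) ≠ 0) {c : Fin (n + 1) → K}
    (hc : ∀ i, H ((X ^ i) w) (cyc X w (n + 1) c) = 0) : c = 0 := by
  have key : ∀ m (hm : m < n + 1), c ⟨m, hm⟩ = 0 := by
    intro m
    induction m using Nat.strong_induction_on with
    | _ m ih =>
      intro hm
      have h1 := hc (n - m)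
      have h2 := form_cyc (w := w) hX (n - m) 0 c
      rw [pow_zero, Module.End.one_apply, h1, Finset.sum_eq_single ⟨m, hm⟩] at h2
      · have h3 : n - m + (0 + m) = n := by omega
        simp only [h3] at h2
        have h4 : ((-1 : K)) ^ (n - m) * H w ((X ^ n) w) ≠ 0 :=
          mul_ne_zero (pow_ne_zero _ (by simp)) hn
        exact (mul_eq_zero.1 h2.symm).resolve_right h4
      · rintro ⟨l, hl⟩ _ hne
        rcases lt_trichotomy l m with h | h | h
        · rw [ih l h hl, zero_mul]
        · subst h; exact absurd rfl hne
        · simp only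
          rw [pow_apply_eq_zero hw (by omega), map_zero, mul_zero, mul_zero]
      · simp
  funext ⟨m, hm⟩
  exact key m hm

lemma apply_cyc_mem (hw : (X ^ (n + 1)) w = 0) (c : Fin (n + 1) → K) :
    X (cyc X w (n + 1) c) ∈ LinearMap.range (cyc X w (n + 1)) := by
  rw [cyc_apply, map_sum]
  refine Submodule.sum_mem _ fun i _ => ?_
  rw [map_smul]
  refine Submodule.smul_mem _ _ ?_
  rw [← Module.End.mul_apply, ← pow_succ']
  by_cases h : (i : ℕ) + 1 < n + 1
  · refine ⟨Pi.single ⟨i + 1, h⟩ 1, ?_⟩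
    rw [cyc, Fintype.linearCombination_apply_single, one_smul]
  · rw [pow_apply_eq_zero hw (by omega)]
    exact Submodule.zero_mem _

lemma pow_apply_cyc_mem (hw : (X ^ (n + 1)) w = 0) (j : ℕ) (c : Fin (n + 1) → K) :
    (X ^ j) (cyc X w (n + 1) c) ∈ LinearMap.range (cyc X w (n + 1)) := by
  induction j with
  | zero => exact ⟨c, rfl⟩
  | succ j ih =>
    obtain ⟨c', hc'⟩ := ih
    rw [pow_succ', Module.End.mul_apply, ← hc']
    exact apply_cyc_mem hw c'

lemma apply_mem_cycPerp (hX : IsHermSys H X) {v : V} (hv : v ∈ cycPerp H X w) :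
    X v ∈ cycPerp H X w := by
  rw [mem_cycPerp] at hv ⊢
  intro i
  have h1 := hX.skew ((X ^ i) w) v
  rw [← Module.End.mul_apply, ← pow_succ', hv (i + 1)] at h1
  exact neg_eq_zero.1 h1.symm

/-- The decomposition of the space into a block and its orthogonal complement. -/
def blockEquiv (hX : IsHermSys H X) (hw : (X ^ (n + 1)) w = 0) (hn : H w ((X ^ n) w) ≠ 0) :
    ((Fin (n + 1) → K) × cycPerp H X w) ≃ₗ[K] V :=
  LinearEquiv.ofBijective ((cyc X w (n + 1)).coprod (cycPerp H X w).subtype) (by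
    constructor
    · rw [injective_iff_map_eq_zero]
      rintro ⟨c, d⟩ h
      rw [LinearMap.coprod_apply, Submodule.subtype_apply] at h
      have hc : c = 0 := eq_zero_of_form_cyc hX hw hn fun i => by
        have h1 := congrArg (H ((X ^ i) w)) h
        rw [map_add, mem_cycPerp.1 d.2 i, add_zero, map_zero] at h1
        exact h1
      subst hc
      rw [map_zero, zero_add] at h
      exact Prod.ext rfl (Subtype.ext h)
    · intro v
      set Φ : V →ₗ[K] (Fin (n + 1) → K) := LinearMap.pi fun i : Fin (n + 1) => H ((X ^ (i : ℕ)) w)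
      have hext : ∀ u, Φ u = 0 → u ∈ cycPerp H X w := by
        intro u hu
        rw [mem_cycPerp]
        intro i
        by_cases hi : i < n + 1
        · exact congrFun hu ⟨i, hi⟩
        · rw [pow_apply_eq_zero hw (by omega), map_zero, LinearMap.zero_apply]
      have hinj : Function.Injective (Φ ∘ₗ cyc X w (n + 1)) := by
        rw [injective_iff_map_eq_zero]
        exact fun c hc => eq_zero_of_form_cyc hX hw hn (mem_cycPerp.1 (hext _ hc))
      obtain ⟨c, hc⟩ := LinearMap.injective_iff_surjective.1 hinj (Φ v)
      refine ⟨(c, ⟨v - cyc X w (n + 1) c, hext _ ?_⟩), ?_⟩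
      · rw [map_sub, ← hc]; exact sub_self _
      · rw [LinearMap.coprod_apply, Submodule.subtype_apply, add_sub_cancel])

lemma blockEquiv_apply (hX : IsHermSys H X) (hw : (X ^ (n + 1)) w = 0) (hn : H w ((X ^ n) w) ≠ 0)
    (p : (Fin (n + 1) → K) × cycPerp H X w) :
    blockEquiv hX hw hn p = cyc X w (n + 1) p.1 + p.2.1 := rfl

lemma form_perp_cyc (hX : IsHermSys H X) {v : V} (hv : v ∈ cycPerp H X w) (c : Fin n → K) :
    H v (cyc X w n c) = 0 := by
  rw [cyc_apply, map_sum]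
  refine Finset.sum_eq_zero fun i _ => ?_
  rw [map_smul, ← hX.herm, mem_cycPerp.1 hv, map_zero, smul_zero]

lemma form_cyc_perp (hX : IsHermSys H X) {v : V} (hv : v ∈ cycPerp H X w) (c : Fin n → K) :
    H (cyc X w n c) v = 0 := by
  rw [← hX.herm, form_perp_cyc hX hv, map_zero]

/-- The restriction of `X` to the complement of a block. -/
def perpRestrict (hX : IsHermSys H X) (w : V) : Module.End K (cycPerp H X w) :=
  X.restrict fun _ hv => apply_mem_cycPerp hX hv

lemma perpRestrict_pow (hX : IsHermSys H X) (j : ℕ) (v : cycPerp H X w) :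
    ((perpRestrict hX w ^ j) v : V) = (X ^ j) v := by
  induction j with
  | zero => rfl
  | succ j ih =>
    rw [pow_succ', Module.End.mul_apply, pow_succ', Module.End.mul_apply, ← ih]
    rfl

lemma isHermSys_perp (hX : IsHermSys H X) (hw : (X ^ (n + 1)) w = 0) (hn : H w ((X ^ n) w) ≠ 0) :
    IsHermSys (H.domRestrict₁₂ (cycPerp H X w) (cycPerp H X w)) (perpRestrict hX w) where
  herm u v := hX.herm u.1 v.1
  skew u v := hX.skew u.1 v.1
  nondeg u hu := by
    refine Subtype.ext (hX.nondeg u.1 fun v => ?_)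
    obtain ⟨⟨c, d⟩, rfl⟩ := (blockEquiv hX hw hn).surjective v
    rw [blockEquiv_apply, map_add, form_perp_cyc hX u.2, zero_add]
    exact hu d
  nilp := by
    obtain ⟨j, hj⟩ := hX.nilp
    refine ⟨j, LinearMap.ext fun v => Subtype.ext ?_⟩
    rw [perpRestrict_pow, hj]
    rfl

lemma finrank_ker_block [FiniteDimensional K V] (hX : IsHermSys H X) (hw : (X ^ (n + 1)) w = 0)
    (hn : H w ((X ^ n) w) ≠ 0) (j : ℕ) :
    Module.finrank K (LinearMap.ker (X ^ j)) =
      Module.finrank K (LinearMap.ker ((X ^ j) ∘ₗ cyc X w (n + 1))) +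
      Module.finrank K (LinearMap.ker (perpRestrict hX w ^ j)) := by
  set Y := (X ^ j) ∘ₗ cyc X w (n + 1)
  have hmem : ∀ p : LinearMap.ker Y × LinearMap.ker (perpRestrict hX w ^ j),
      blockEquiv hX hw hn (p.1.1, p.2.1) ∈ LinearMap.ker (X ^ j) := by
    rintro ⟨⟨c, hc⟩, ⟨d, hd⟩⟩
    rw [LinearMap.mem_ker] at hc hd ⊢
    have h1 : (X ^ j) d.1 = 0 := by rw [← perpRestrict_pow hX, hd]; rfl
    rw [blockEquiv_apply, map_add, h1, add_zero]
    exact hc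
  have e : (LinearMap.ker Y × LinearMap.ker (perpRestrict hX w ^ j)) ≃ₗ[K]
      LinearMap.ker (X ^ j) :=
    LinearEquiv.ofBijective (LinearMap.codRestrict _ ((blockEquiv hX hw hn).toLinearMap ∘ₗ
      ((LinearMap.ker Y).subtype.prodMap (LinearMap.ker (perpRestrict hX w ^ j)).subtype)) hmem) (by
      constructor
      · intro p p' h
        have h0 := congrArg Subtype.val h
        have h1 := (blockEquiv hX hw hn).injective (a₁ := (p.1.1, p.2.1)) (a₂ := (p'.1.1, p'.2.1)) h0
        have h2 := congrArg Prod.fst h1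
        have h3 := congrArg Prod.snd h1
        exact Prod.ext (Subtype.ext h2) (Subtype.ext h3)
      · rintro ⟨v, hv⟩
        obtain ⟨⟨c, d⟩, rfl⟩ := (blockEquiv hX hw hn).surjective v
        rw [LinearMap.mem_ker, blockEquiv_apply, map_add] at hv
        obtain ⟨c', hc'⟩ := pow_apply_cyc_mem hw j c
        have h1 : blockEquiv hX hw hn (c', (perpRestrict hX w ^ j) d) = 0 := by
          rw [blockEquiv_apply, perpRestrict_pow, hc']
          exact hv
        rw [LinearEquiv.map_eq_zero_iff] at h1
        have h2 : c' = 0 := congrArg Prod.fst h1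
        have h3 : (perpRestrict hX w ^ j) d = 0 := congrArg Prod.snd h1
        rw [h2, map_zero] at hc'
        exact ⟨(⟨c, hc'.symm⟩, ⟨d, h3⟩), rfl⟩)
  rw [← e.finrank_eq, Module.finrank_prod]

variable {V' : Type*} [AddCommGroup V'] [Module K V'] {H' : V' →ₛₗ[σ] V' →ₗ[K] K}
  {X' : Module.End K V'} {w' : V'}

/-- Vanishing of $X^j$ on a combination of the $X^iw$ is detected by pairing with this cyclic space,
hence by the values $H(w,X^iw)$ alone. Blocks with equal values therefore contribute equally to all
kernels. -/
lemma ker_cyc_le (hX : IsHermSys H X) (hX' : IsHermSys H' X')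
    (hw' : (X' ^ (n + 1)) w' = 0) (hn' : H' w' ((X' ^ n) w') ≠ 0)
    (hb : ∀ i, H w ((X ^ i) w) = H' w' ((X' ^ i) w')) (j : ℕ) :
    LinearMap.ker ((X ^ j) ∘ₗ cyc X w (n + 1)) ≤
      LinearMap.ker ((X' ^ j) ∘ₗ cyc X' w' (n + 1)) := by
  intro c hc
  rw [LinearMap.mem_ker, LinearMap.comp_apply] at hc ⊢
  obtain ⟨c', hc'⟩ := pow_apply_cyc_mem hw' j c
  rw [← hc']
  have : c' = 0 := eq_zero_of_form_cyc hX' hw' hn' fun i => by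
    rw [hc', form_cyc hX']
    simp only [← hb]
    rw [← form_cyc hX, hc, map_zero]
  rw [this, map_zero]

/-- Nondegeneracy makes $(u,v)\mapsto H(u,X^nv)$ a nonzero sesquilinear form, so it has a
nonisotropic vector. -/
lemma exists_form_ne_zero (hσ : IsQuadConj σ q) (hX : IsHermSys H X) (hn : X ^ n ≠ 0) :
    ∃ w, H w ((X ^ n) w) ≠ 0 := by
  have hne : H.compl₂ (X ^ n) ≠ 0 := by
    intro h0
    refine hn (LinearMap.ext fun v => hX.nondeg _ fun u => ?_)
    rw [← hX.herm, ← LinearMap.compl₂_apply, h0]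
    simp
  obtain ⟨w, hw⟩ := exists_nonisotropic hσ hne
  exact ⟨w, hw⟩

end Classification

universe u

lemma pow_eq_zero_iff_finrank_ker {K : Type*} [Field K] {V : Type*} [AddCommGroup V] [Module K V]
    [FiniteDimensional K V] (X : Module.End K V) (j : ℕ) :
    X ^ j = 0 ↔ Module.finrank K (LinearMap.ker (X ^ j)) = Module.finrank K V := by
  rw [← LinearMap.ker_eq_top]
  constructor
  · intro h; rw [h, finrank_top]
  · exact Submodule.eq_top_of_finrank_eq

/-- A nilpotent skew-adjoint endomorphism of a Hermitian space is determined up to isometry by the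
dimensions of the kernels of its powers. -/
theorem exists_isometry {K : Type*} [Field K] {σ : K →+* K} {q : ℕ} (hσ : IsQuadConj σ q) (d : ℕ)
    {V V' : Type u} [AddCommGroup V] [Module K V] [AddCommGroup V'] [Module K V']
    [FiniteDimensional K V] [FiniteDimensional K V'] (hd : Module.finrank K V = d)
    (hd' : Module.finrank K V' = d)
    {H : V →ₛₗ[σ] V →ₗ[K] K} {X : Module.End K V} (hX : IsHermSys H X)
    {H' : V' →ₛₗ[σ] V' →ₗ[K] K} {X' : Module.End K V'} (hX' : IsHermSys H' X')
    (hker : ∀ j, Module.finrank K (LinearMap.ker (X ^ j)) =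
      Module.finrank K (LinearMap.ker (X' ^ j))) :
    ∃ e : V ≃ₗ[K] V', (∀ u v, H' (e u) (e v) = H u v) ∧ ∀ v, e (X v) = X' (e v) := by
  induction d using Nat.strong_induction_on generalizing V V' with
  | _ d ih =>
    rcases Nat.eq_zero_or_pos d with h0 | h0
    · subst h0
      have h1 : Subsingleton V := Module.finrank_zero_iff.1 hd
      have h2 : Subsingleton V' := Module.finrank_zero_iff.1 hd'
      refine ⟨LinearEquiv.ofFinrankEq V V' (hd.trans hd'.symm), fun u v => ?_, fun v =>
        Subsingleton.elim _ _⟩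
      rw [Subsingleton.elim u 0]
      simp
    · classical
      have hex := hX.nilp
      set k := Nat.find hex with hk
      have hXk : X ^ k = 0 := Nat.find_spec hex
      have hmin : ∀ m < k, X ^ m ≠ 0 := fun m hm => Nat.find_min hex hm
      obtain ⟨n, hkn⟩ : ∃ n, k = n + 1 := by
        refine Nat.exists_eq_succ_of_ne_zero fun hk0 => ?_
        rw [hk0, pow_zero] at hXk
        have : Subsingleton V := subsingleton_of_forall_eq 0 fun v => LinearMap.congr_fun hXk v
        rw [Module.finrank_zero_of_subsingleton] at hd
        omega
      rw [hkn] at hXk hmin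
      -- Both operators have nilpotency index $n+1$, as this is visible from the kernel dimensions.
      have hXk' : X' ^ (n + 1) = 0 := by
        rw [pow_eq_zero_iff_finrank_ker, ← hker, hd', ← hd, ← pow_eq_zero_iff_finrank_ker, hXk]
      have hXn' : X' ^ n ≠ 0 := by
        rw [Ne, pow_eq_zero_iff_finrank_ker, ← hker, hd', ← hd, ← pow_eq_zero_iff_finrank_ker]
        exact hmin n (by omega)
      obtain ⟨w, hn⟩ := exists_form_ne_zero hσ hX (hmin n (by omega))
      obtain ⟨w₀, hw₀⟩ := exists_form_ne_zero hσ hX' hXn'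
      have hw : (X ^ (n + 1)) w = 0 := by rw [hXk, LinearMap.zero_apply]
      obtain ⟨w', hw'⟩ := exists_normalized hσ hX' hXk' hw₀ (b := fun i => H w ((X ^ i) w))
        (fun i => by rw [hX.herm, skew_pow hX.skew]) hn
      have hb : ∀ i, H w ((X ^ i) w) = H' w' ((X' ^ i) w') := by
        intro i
        by_cases hi : i ≤ n
        · exact (hw' i hi).symm
        · rw [pow_apply_eq_zero hw (by omega), pow_apply_eq_zero (k := n + 1)
            (by rw [hXk', LinearMap.zero_apply]) (by omega), map_zero, map_zero]
      have hwk' : (X' ^ (n + 1)) w' = 0 := by rw [hXk', LinearMap.zero_apply]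
      have hn' : H' w' ((X' ^ n) w') ≠ 0 := by rw [← hb]; exact hn
      have hdim : Module.finrank K (cycPerp H X w) + (n + 1) = d := by
        have := (blockEquiv hX hw hn).finrank_eq
        rw [Module.finrank_prod, Module.finrank_fin_fun, hd] at this
        omega
      have hdim' : Module.finrank K (cycPerp H' X' w') + (n + 1) = d := by
        have := (blockEquiv hX' hwk' hn').finrank_eq
        rw [Module.finrank_prod, Module.finrank_fin_fun, hd'] at this
        omega
      -- The split-off blocks have identical kernels, so their contributions cancel in the equality
      -- of kernel dimensions and the induction hypothesis applies to the orthogonal complements.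
      obtain ⟨e₀, he₀, he₀'⟩ := ih (d - (n + 1)) (by omega) (V := cycPerp H X w)
        (V' := cycPerp H' X' w') (by omega) (by omega) (isHermSys_perp hX hw hn)
        (isHermSys_perp hX' hwk' hn') (fun j => by
          have h1 := finrank_ker_block hX hw hn j
          have h2 := finrank_ker_block hX' hwk' hn' j
          rw [le_antisymm (ker_cyc_le hX hX' hwk' hn' hb j)
            (ker_cyc_le hX' hX hw hn (fun i => (hb i).symm) j), hker, h2] at h1
          omega)
      set e : V ≃ₗ[K] V' := (blockEquiv hX hw hn).symm.trans
        (((LinearEquiv.refl K (Fin (n + 1) → K)).prodCongr e₀).trans (blockEquiv hX' hwk' hn'))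
      have he : ∀ c (d : cycPerp H X w),
          e (cyc X w (n + 1) c + d.1) = cyc X' w' (n + 1) c + (e₀ d).1 := by
        intro c d
        change blockEquiv hX' hwk' hn' ((LinearEquiv.refl K (Fin (n + 1) → K)).prodCongr e₀
          ((blockEquiv hX hw hn).symm (blockEquiv hX hw hn (c, d)))) = _
        rw [LinearEquiv.symm_apply_apply]
        rfl
      have he1 : ∀ c, e (cyc X w (n + 1) c) = cyc X' w' (n + 1) c := fun c => by
        simpa using he c 0
      have he2 : ∀ d : cycPerp H X w, e d.1 = (e₀ d).1 := fun d => by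
        simpa using he 0 d
      have hepow : ∀ i, e ((X ^ i) w) = (X' ^ i) w' := by
        intro i
        by_cases hi : i < n + 1
        · have h1 := he1 (Pi.single ⟨i, hi⟩ 1)
          simpa [cyc, Fintype.linearCombination_apply_single] using h1
        · rw [pow_apply_eq_zero hw (by omega), pow_apply_eq_zero hwk' (by omega), map_zero]
      refine ⟨e, fun u v => ?_, fun v => ?_⟩
      · obtain ⟨⟨c, a⟩, rfl⟩ := (blockEquiv hX hw hn).surjective u
        obtain ⟨⟨c', a'⟩, rfl⟩ := (blockEquiv hX hw hn).surjective v
        simp only [blockEquiv_apply, he, map_add, LinearMap.add_apply, form_cyc_perp hX a'.2,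
          form_perp_cyc hX a.2, form_cyc_perp hX' (e₀ a').2, form_perp_cyc hX' (e₀ a).2]
        have h1 : H' (e₀ a).1 (e₀ a').1 = H a.1 a'.1 := he₀ a a'
        have h2 : H' (cyc X' w' (n + 1) c) (cyc X' w' (n + 1) c') =
            H (cyc X w (n + 1) c) (cyc X w (n + 1) c') := by
          rw [cyc_apply X' w' _ c, cyc_apply X w _ c]
          simp only [map_sum, LinearMap.sum_apply, map_smulₛₗ, LinearMap.smul_apply]
          refine Finset.sum_congr rfl fun i _ => ?_
          have h3 := form_cyc (w := w) hX i 0 c'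
          have h4 := form_cyc (w := w') hX' i 0 c'
          rw [pow_zero, Module.End.one_apply] at h3 h4
          rw [h3, h4]
          simp only [hb]
        rw [h1, h2]
      · obtain ⟨⟨c, a⟩, rfl⟩ := (blockEquiv hX hw hn).surjective v
        rw [blockEquiv_apply, he]
        simp only [map_add]
        congr 1
        · rw [cyc_apply, cyc_apply]
          simp only [map_sum, map_smul]
          refine Finset.sum_congr rfl fun i _ => ?_
          rw [← Module.End.mul_apply, ← pow_succ', hepow, ← Module.End.mul_apply, ← pow_succ']
        · have h1 := he2 (perpRestrict hX w a)
          have h2 := congrArg Subtype.val (he₀' a)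
          exact h1.trans h2

/-! ## Jordan types of nilpotent endomorphisms -/

section Types

variable {K : Type*} [Field K] {V : Type*} [AddCommGroup V] [Module K V]

/-- The dimension of the kernel of `X ^ j`. -/
def kerDim (X : Module.End K V) (j : ℕ) : ℕ := Module.finrank K (LinearMap.ker (X ^ j))

/-- The number of Jordan blocks of size greater than `j`. -/
def jordanCol (X : Module.End K V) (j : ℕ) : ℕ := kerDim X (j + 1) - kerDim X j

/-- The Jordan type; its column lengths are the numbers of blocks of size greater than `j`. -/
def jordanType (X : Module.End K V) : YoungDiagram := ofColLen (jordanCol X)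

/-- The subspace `im X + ker X^j`. -/
def levelSpace (X : Module.End K V) (j : ℕ) : Submodule K V :=
  LinearMap.range X ⊔ LinearMap.ker (X ^ j)

lemma kerDim_zero (X : Module.End K V) : kerDim X 0 = 0 := by
  rw [kerDim, pow_zero, Module.End.one_eq_id, LinearMap.ker_id, finrank_bot]

lemma ker_pow_mono (X : Module.End K V) {i j : ℕ} (h : i ≤ j) :
    LinearMap.ker (X ^ i) ≤ LinearMap.ker (X ^ j) :=
  fun _ hv => pow_apply_eq_zero hv h

lemma mem_levelSpace {X : Module.End K V} {j : ℕ} {x : V} :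
    x ∈ levelSpace X j ↔ ∃ u w, (X ^ j) w = 0 ∧ x = X u + w := by
  rw [levelSpace, Submodule.mem_sup]
  constructor
  · rintro ⟨_, ⟨u, rfl⟩, w, hw, rfl⟩
    exact ⟨u, w, hw, rfl⟩
  · rintro ⟨u, w, hw, rfl⟩
    exact ⟨_, ⟨u, rfl⟩, w, hw, rfl⟩

lemma levelSpace_mono (X : Module.End K V) {i j : ℕ} (h : i ≤ j) :
    levelSpace X i ≤ levelSpace X j :=
  sup_le_sup le_rfl (ker_pow_mono X h)

variable [FiniteDimensional K V]

lemma kerDim_mono (X : Module.End K V) {i j : ℕ} (h : i ≤ j) : kerDim X i ≤ kerDim X j :=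
  Submodule.finrank_mono (ker_pow_mono X h)

lemma kerDim_succ (X : Module.End K V) (j : ℕ) : kerDim X (j + 1) = kerDim X j + jordanCol X j := by
  have := kerDim_mono X (by omega : j ≤ j + 1)
  rw [jordanCol]; omega

/-- The map $X^j$ sends $\operatorname{im}X+\ker X^j$ onto $\operatorname{im}X^{j+1}$ and its kernel
$\ker X^j$ lies in that space; rank-nullity does the rest. -/
lemma finrank_levelSpace (X : Module.End K V) (j : ℕ) :
    Module.finrank K (levelSpace X j) + jordanCol X j = Module.finrank K V := by
  have hmap : (levelSpace X j).map (X ^ j) = LinearMap.range (X ^ (j + 1)) := by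
    rw [levelSpace, Submodule.map_sup]
    have h1 : (LinearMap.ker (X ^ j)).map (X ^ j) = ⊥ := by
      exact (LinearMap.le_ker_iff_map).1 le_rfl
    rw [h1, sup_bot_eq, ← LinearMap.range_comp, pow_succ]
    rfl
  have hle : LinearMap.ker (X ^ j) ≤ levelSpace X j := le_sup_right
  have h2 := LinearMap.finrank_range_add_finrank_ker ((X ^ j).domRestrict (levelSpace X j))
  rw [LinearMap.range_domRestrict, hmap] at h2
  have h3 : Module.finrank K (LinearMap.ker ((X ^ j).domRestrict (levelSpace X j))) =
      kerDim X j := by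
    rw [kerDim, LinearMap.ker_domRestrict]
    exact (Submodule.submoduleOfEquivOfLe hle).finrank_eq
  have h4 := LinearMap.finrank_range_add_finrank_ker (X ^ (j + 1))
  have h5 := kerDim_succ X j
  rw [h3] at h2
  change _ + kerDim X (j + 1) = _ at h4
  omega

/-- These numbers are the codimensions of an increasing chain of subspaces. -/
lemma jordanCol_antitone (X : Module.End K V) : Antitone (jordanCol X) := by
  refine antitone_nat_of_succ_le fun j => ?_
  have h1 := finrank_levelSpace X j
  have h2 := finrank_levelSpace X (j + 1)
  have h3 := Submodule.finrank_mono (levelSpace_mono X (by omega : j ≤ j + 1))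
  omega

lemma pow_finrank_eq_zero {X : Module.End K V} (hX : IsNilpotent X) :
    X ^ Module.finrank K V = 0 := by
  obtain ⟨m, hm⟩ := hX
  rw [← LinearMap.ker_eq_top, ← Module.End.ker_pow_eq_ker_pow_finrank_of_le
    (le_max_right m (Module.finrank K V)), LinearMap.ker_eq_top]
  exact pow_eq_zero_of_le (le_max_left _ _) hm

lemma jordanCol_finrank {X : Module.End K V} (hX : IsNilpotent X) :
    jordanCol X (Module.finrank K V) = 0 := by
  rw [jordanCol, kerDim, kerDim, pow_succ, pow_finrank_eq_zero hX, zero_mul, Nat.sub_self]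

lemma colLen_jordanType {X : Module.End K V} (hX : IsNilpotent X) (j : ℕ) :
    (jordanType X).colLen j = jordanCol X j :=
  colLen_ofColLen (exists_colLen (jordanCol_antitone X) (jordanCol_finrank hX)) j

lemma sum_jordanCol (X : Module.End K V) (n : ℕ) :
    ∑ j ∈ Finset.range n, jordanCol X j = kerDim X n := by
  induction n with
  | zero => rw [kerDim_zero, Finset.sum_range_zero]
  | succ n ih => rw [Finset.sum_range_succ, ih, kerDim_succ]

lemma card_eq_sum_colLen (μ : YoungDiagram) {D : ℕ} (hD : μ.rowLen 0 ≤ D) :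
    μ.card = ∑ j ∈ Finset.range D, μ.colLen j := by
  rw [YoungDiagram.card, Finset.card_eq_sum_card_fiberwise (f := Prod.snd) (t := Finset.range D)]
  · refine Finset.sum_congr rfl fun j _ => ?_
    rw [YoungDiagram.colLen_eq_card]
    rfl
  · rintro ⟨i, j⟩ h
    have h1 := YoungDiagram.mem_iff_lt_rowLen.1 ((YoungDiagram.mem_cells _).1 h)
    have h2 := μ.rowLen_anti 0 i (by omega)
    simp only [Finset.coe_range, Set.mem_Iio]
    omega

lemma card_jordanType {X : Module.End K V} (hX : IsNilpotent X) :
    (jordanType X).card = Module.finrank K V := by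
  set D := max (Module.finrank K V) ((jordanType X).rowLen 0)
  rw [card_eq_sum_colLen _ (le_max_right (Module.finrank K V) _)]
  simp only [colLen_jordanType hX]
  rw [sum_jordanCol, kerDim, pow_eq_zero_of_le (le_max_left _ _) (pow_finrank_eq_zero hX),
    LinearMap.ker_zero, finrank_top]

lemma kerDim_eq_of_jordanType_eq {V' : Type*} [AddCommGroup V'] [Module K V']
    [FiniteDimensional K V'] {X : Module.End K V} {X' : Module.End K V'} (hX : IsNilpotent X)
    (hX' : IsNilpotent X') (h : jordanType X = jordanType X') (j : ℕ) :
    kerDim X j = kerDim X' j := by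
  rw [← sum_jordanCol, ← sum_jordanCol]
  simp only [← colLen_jordanType hX, ← colLen_jordanType hX', h]

end Types

/-! ## The extension of a skew-adjoint endomorphism by an isotropic line -/

section Extension

variable {K : Type*} [Field K] {σ : K →+* K} {V : Type*} [AddCommGroup V] [Module K V]

/-- The endomorphism of `K × V × K` with matrix `(0, -H(x, ·), y; 0, X, x; 0, 0, 0)`. -/
def extEnd (H : V →ₛₗ[σ] V →ₗ[K] K) (X : Module.End K V) (x : V) (y : K) :
    Module.End K (K × V × K) where
  toFun p := (-H x p.2.1 + p.2.2 * y, X p.2.1 + p.2.2 • x, 0)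
  map_add' p p' := by
    refine Prod.ext ?_ (Prod.ext ?_ ?_)
    · simp only [Prod.snd_add, Prod.fst_add, map_add]; ring
    · simp only [Prod.snd_add, Prod.fst_add, map_add, add_smul]; abel
    · simp
  map_smul' c p := by
    refine Prod.ext ?_ (Prod.ext ?_ ?_)
    · simp only [Prod.smul_snd, Prod.smul_fst, map_smul, smul_eq_mul, RingHom.id_apply]; ring
    · simp only [Prod.smul_snd, Prod.smul_fst, map_smul, smul_add, smul_smul, RingHom.id_apply,
        smul_eq_mul]
    · simp

/-- The corner entries of the powers of `extEnd`. -/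
def cornerEntry (H : V →ₛₗ[σ] V →ₗ[K] K) (X : Module.End K V) (x : V) (y : K) : ℕ → K
  | 0 => y
  | k + 1 => -H x ((X ^ k) x)

variable {H : V →ₛₗ[σ] V →ₗ[K] K} {X : Module.End K V} {x : V} {y : K}

lemma extEnd_pow_apply (k : ℕ) (p : K × V × K) :
    (extEnd H X x y ^ (k + 1)) p =
      (-H x ((X ^ k) p.2.1) + p.2.2 * cornerEntry H X x y k,
        (X ^ (k + 1)) p.2.1 + p.2.2 • (X ^ k) x, 0) := by
  induction k generalizing p with
  | zero => simp [extEnd, cornerEntry]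
  | succ k ih =>
    rw [pow_succ, Module.End.mul_apply, ih]
    have e1 : ∀ v, (X ^ (k + 1)) v = (X ^ k) (X v) := fun v => by
      rw [pow_succ, Module.End.mul_apply]
    have e2 : ∀ v, (X ^ (k + 1 + 1)) v = (X ^ (k + 1)) (X v) := fun v => by
      rw [pow_succ, Module.End.mul_apply]
    refine Prod.ext ?_ (Prod.ext ?_ rfl)
    · simp only [extEnd, LinearMap.coe_mk, AddHom.coe_mk, map_add, map_smul, smul_eq_mul, zero_mul,
        add_zero, cornerEntry, e1]
      ring
    · simp only [extEnd, LinearMap.coe_mk, AddHom.coe_mk, map_add, map_smul, zero_smul,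
        add_zero, e2]

lemma isNilpotent_extEnd_iff : IsNilpotent (extEnd H X x y) ↔ IsNilpotent X := by
  constructor
  · rintro ⟨m, hm⟩
    refine ⟨m + 1, LinearMap.ext fun v => ?_⟩
    have h1 := extEnd_pow_apply (H := H) (X := X) (x := x) (y := y) m (0, v, 0)
    rw [pow_succ, hm, zero_mul] at h1
    have h2 := congrArg (fun p => p.2.1) h1
    simpa using h2.symm
  · rintro ⟨m, hm⟩
    refine ⟨m + 1 + 1, LinearMap.ext fun p => ?_⟩
    rw [extEnd_pow_apply]
    have h0 : ∀ j, m ≤ j → X ^ j = 0 := fun j hj => pow_eq_zero_of_le hj hm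
    simp [h0 (m + 1) (by omega), h0 (m + 1 + 1) (by omega), cornerEntry, hm]

/-! ### Kernels of bordered endomorphisms -/

section Kernel

variable [FiniteDimensional K V] {T : Module.End K (K × V × K)} {f : V →ₗ[K] K}
  {G : Module.End K V} {p : V} {z : K}

/-- As $p$ is outside the image, a kernel vector has last coordinate $0$. The condition $f(v)=0$
then costs one dimension of $\ker G$, which the free first coordinate restores. -/
lemma finrank_ker_border₀ (hT : ∀ a, T a = (f a.2.1 + a.2.2 * z, G a.2.1 + a.2.2 • p, 0))
    (hp : p ∉ LinearMap.range G) {v₀ : V} (hv₀ : G v₀ = 0) (hf : f v₀ ≠ 0) :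
    Module.finrank K (LinearMap.ker T) = Module.finrank K (LinearMap.ker G) := by
  set φ : LinearMap.ker G →ₗ[K] K × V × K :=
    (f ∘ₗ (LinearMap.ker G).subtype).prod
      (((LinearMap.ker G).subtype - ((f v₀)⁻¹ • f ∘ₗ (LinearMap.ker G).subtype).smulRight v₀).prod 0)
  have hφ : ∀ v : LinearMap.ker G, φ v = (f v, v - ((f v₀)⁻¹ * f v) • v₀, 0) := fun v => rfl
  have hinj : Function.Injective φ := by
    rw [injective_iff_map_eq_zero]
    intro v hv
    rw [hφ] at hv
    have h1 : f v = 0 := congrArg Prod.fst hv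
    have h2 : (v : V) - ((f v₀)⁻¹ * f v) • v₀ = 0 := congrArg (fun p => p.2.1) hv
    rw [h1, mul_zero, zero_smul, sub_zero] at h2
    exact Subtype.ext h2
  rw [← LinearMap.finrank_range_of_inj hinj]
  have : LinearMap.ker T = LinearMap.range φ := by
    ext ⟨a, v, b⟩
    rw [LinearMap.mem_ker, hT, LinearMap.mem_range]
    constructor
    · intro h
      have h1 : f v + b * z = 0 := congrArg Prod.fst h
      have h2 : G v + b • p = 0 := congrArg (fun p => p.2.1) h
      have hb : b = 0 := by
        by_contra hb
        refine hp ⟨(-b⁻¹) • v, ?_⟩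
        rw [map_smul, eq_neg_of_add_eq_zero_left h2, smul_neg, neg_smul, neg_neg, smul_smul,
          inv_mul_cancel₀ hb, one_smul]
      subst hb
      rw [zero_smul, add_zero] at h2
      rw [zero_mul, add_zero] at h1
      refine ⟨⟨v + ((f v₀)⁻¹ * a) • v₀, ?_⟩, ?_⟩
      · rw [LinearMap.mem_ker, map_add, map_smul, h2, hv₀, smul_zero, add_zero]
      · have h3 : f (v + ((f v₀)⁻¹ * a) • v₀) = a := by
          rw [map_add, map_smul, h1, smul_eq_mul, zero_add]; field_simp
        rw [hφ]
        simp only [h3, add_sub_cancel_right]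
    · rintro ⟨w, hw⟩
      rw [hφ] at hw
      have h2 : (w : V) - ((f v₀)⁻¹ * f w) • v₀ = v := congrArg (fun p => p.2.1) hw
      have h3 : 0 = b := congrArg (fun p => p.2.2) hw
      subst h2 h3
      have hw0 : G w = 0 := w.2
      simp only [map_sub, map_smul, hw0, hv₀, smul_eq_mul]
      refine Prod.ext ?_ (Prod.ext ?_ rfl)
      · simp only [Prod.fst_zero]; field_simp; ring
      · simp
  rw [this]

/-- After the shift $v\mapsto v+bu$ the first coordinate reads $b(z-f(u))=0$, which forces $b=0$;
only the first coordinate is an additional degree of freedom. -/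
lemma finrank_ker_border₁ (hT : ∀ a, T a = (f a.2.1 + a.2.2 * z, G a.2.1 + a.2.2 • p, 0))
    {u : V} (hp : p = G u) (hf : ∀ v, G v = 0 → f v = 0) (hz : z - f u ≠ 0) :
    Module.finrank K (LinearMap.ker T) = Module.finrank K (LinearMap.ker G) + 1 := by
  set φ : K × LinearMap.ker G →ₗ[K] K × V × K :=
    (LinearMap.fst K K _).prod
      (((LinearMap.ker G).subtype ∘ₗ LinearMap.snd K K (LinearMap.ker G)).prod 0)
  have hφ : ∀ v, φ v = (v.1, v.2.1, 0) := fun v => rfl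
  have hinj : Function.Injective φ := by
    rw [injective_iff_map_eq_zero]
    rintro ⟨a, v⟩ hv
    rw [hφ] at hv
    have h1 : a = 0 := congrArg Prod.fst hv
    have h2 : (v : V) = 0 := congrArg (fun p => p.2.1) hv
    exact Prod.ext h1 (Subtype.ext h2)
  have : LinearMap.ker T = LinearMap.range φ := by
    ext ⟨a, v, b⟩
    rw [LinearMap.mem_ker, hT, LinearMap.mem_range]
    constructor
    · intro h
      have h1 : f v + b * z = 0 := congrArg Prod.fst h
      have h2 : G v + b • p = 0 := congrArg (fun p => p.2.1) h
      have h3 : f (v + b • u) = 0 := hf _ (by rw [map_add, map_smul, ← hp, h2])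
      rw [map_add, map_smul, smul_eq_mul] at h3
      have hb : b = 0 := by
        have : b * (z - f u) = 0 := by linear_combination h1 - h3
        exact (mul_eq_zero.1 this).resolve_right hz
      subst hb
      rw [zero_smul, add_zero] at h2
      exact ⟨(a, ⟨v, h2⟩), rfl⟩
    · rintro ⟨⟨c, w⟩, hw⟩
      rw [hφ] at hw
      have h2 : (w : V) = v := congrArg (fun p => p.2.1) hw
      have h3 : 0 = b := congrArg (fun p => p.2.2) hw
      subst h2 h3
      have hw0 : G w = 0 := w.2
      simp [hw0, hf]
  rw [this, LinearMap.finrank_range_of_inj hinj, Module.finrank_prod, Module.finrank_self, add_comm]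

/-- Now the same condition is void, and both outer coordinates are free. -/
lemma finrank_ker_border₂ (hT : ∀ a, T a = (f a.2.1 + a.2.2 * z, G a.2.1 + a.2.2 • p, 0))
    {u : V} (hp : p = G u) (hf : ∀ v, G v = 0 → f v = 0) (hz : z - f u = 0) :
    Module.finrank K (LinearMap.ker T) = Module.finrank K (LinearMap.ker G) + 2 := by
  set φ : (K × K) × LinearMap.ker G →ₗ[K] K × V × K :=
    (LinearMap.fst K K K ∘ₗ LinearMap.fst K (K × K) _).prod
      (((LinearMap.ker G).subtype ∘ₗ LinearMap.snd K (K × K) (LinearMap.ker G) -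
        (LinearMap.snd K K K ∘ₗ LinearMap.fst K (K × K) _).smulRight u).prod
        (LinearMap.snd K K K ∘ₗ LinearMap.fst K (K × K) _))
  have hφ : ∀ v, φ v = (v.1.1, v.2.1 - v.1.2 • u, v.1.2) := fun v => rfl
  have hinj : Function.Injective φ := by
    rw [injective_iff_map_eq_zero]
    rintro ⟨⟨a, b⟩, v⟩ hv
    rw [hφ] at hv
    have h1 : a = 0 := congrArg Prod.fst hv
    have h2 : b = 0 := congrArg (fun p => p.2.2) hv
    have h3 : (v : V) - b • u = 0 := congrArg (fun p => p.2.1) hv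
    rw [h2, zero_smul, sub_zero] at h3
    exact Prod.ext (Prod.ext h1 h2) (Subtype.ext h3)
  have : LinearMap.ker T = LinearMap.range φ := by
    ext ⟨a, v, b⟩
    rw [LinearMap.mem_ker, hT, LinearMap.mem_range]
    constructor
    · intro h
      have h2 : G v + b • p = 0 := congrArg (fun p => p.2.1) h
      exact ⟨((a, b), ⟨v + b • u, by rw [LinearMap.mem_ker, map_add, map_smul, ← hp, h2]⟩), by
        rw [hφ]; simp⟩
    · rintro ⟨⟨⟨c, d⟩, w⟩, hw⟩
      rw [hφ] at hw
      have h2 : (w : V) - d • u = v := congrArg (fun p => p.2.1) hw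
      have h3 : d = b := congrArg (fun p => p.2.2) hw
      subst h2 h3
      have hw0 : G w = 0 := w.2
      refine Prod.ext ?_ (Prod.ext ?_ rfl)
      · simp only [map_sub, map_smul, hf _ hw0, smul_eq_mul, Prod.fst_zero]
        linear_combination d * hz
      · simp [hw0, hp]
  rw [this, LinearMap.finrank_range_of_inj hinj, Module.finrank_prod, Module.finrank_prod,
    Module.finrank_self, add_comm]

end Kernel

/-! ### Level spaces as orthogonal complements -/

section Duality

variable [FiniteDimensional K V]

/-- Nondegeneracy gives an injection from $V$ into its dual, a finite set of the same size. -/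
lemma form_surjective [Finite K] (hnd : ∀ u, (∀ v, H u v = 0) → u = 0) (φ : V →ₗ[K] K) :
    ∃ u, H u = φ := by
  have : Finite V := Module.finite_of_finite K
  have : Finite (V →ₗ[K] K) := Module.finite_of_finite K
  have hinj : Function.Injective H := by
    rw [injective_iff_map_eq_zero]
    intro u hu
    exact hnd u fun v => by rw [hu, LinearMap.zero_apply]
  have hcard : Nat.card (V →ₗ[K] K) ≤ Nat.card V := by
    rw [Module.natCard_eq_pow_finrank (K := K), Module.natCard_eq_pow_finrank (K := K) (V := V),
      Module.finrank_linearMap, Module.finrank_self, mul_one]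
  exact (hinj.bijective_of_nat_card_le hcard).2 φ

/-- The level space is the annihilator of $X^j(\ker X^{j+1})$. For the converse, $v\mapsto
H(x,X^jv)$ kills $\ker X^{j+1}$, so it factors through $X^{j+1}$ and equals $H(u,X^{j+1}v)$ for some
$u$; skewness then gives $X^j(x+Xu)=0$. -/
lemma mem_levelSpace_iff_form [Finite K] (hnd : ∀ u, (∀ v, H u v = 0) → u = 0)
    (hskew : ∀ u v, H (X u) v = -H u (X v)) (j : ℕ) (x : V) :
    x ∈ levelSpace X j ↔ ∀ v, (X ^ (j + 1)) v = 0 → H x ((X ^ j) v) = 0 := by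
  have hne : ∀ i : ℕ, ((-1 : K)) ^ i ≠ 0 := fun i => pow_ne_zero _ (by simp)
  constructor
  · rw [mem_levelSpace]
    rintro ⟨u, w, hw, rfl⟩ v hv
    have h1 := skew_pow hskew j w v
    rw [hw, map_zero, LinearMap.zero_apply] at h1
    rw [map_add, LinearMap.add_apply, hskew, ← Module.End.mul_apply, ← pow_succ', hv, map_zero,
      neg_zero, zero_add]
    exact (mul_eq_zero.1 h1.symm).resolve_left (hne j)
  · intro h
    have h1 : (H x ∘ₗ (X ^ j)) ∈ LinearMap.range (X ^ (j + 1)).dualMap := by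
      rw [LinearMap.range_dualMap_eq_dualAnnihilator_ker, Submodule.mem_dualAnnihilator]
      exact fun v hv => h v hv
    obtain ⟨φ, hφ⟩ := h1
    obtain ⟨u, rfl⟩ := form_surjective hnd φ
    have h2 : (X ^ j) x + (X ^ (j + 1)) u = 0 := by
      refine hnd _ fun v => ?_
      have h3 : H u ((X ^ (j + 1)) v) = H x ((X ^ j) v) := LinearMap.congr_fun hφ v
      rw [map_add, LinearMap.add_apply, skew_pow hskew, skew_pow hskew, h3]
      ring
    rw [mem_levelSpace]
    refine ⟨-u, x + X u, ?_, by rw [map_neg]; abel⟩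
    rw [map_add, ← Module.End.mul_apply, ← pow_succ, h2]

end Duality

/-! ### How the kernels of powers grow under extension -/

section KerDim

variable [FiniteDimensional K V]

/-- Being outside the level space means both that $X^kx\notin\operatorname{im}X^{k+1}$ and, by
duality, that $H(x,X^k\cdot)$ is nonzero on $\ker X^{k+1}$. This is the situation of
`finrank_ker_border₀`. -/
lemma kerDim_extEnd_of_notMem [Finite K] (hnd : ∀ u, (∀ v, H u v = 0) → u = 0)
    (hskew : ∀ u v, H (X u) v = -H u (X v)) {k : ℕ} (hx : x ∉ levelSpace X k) :
    kerDim (extEnd H X x y) (k + 1) = kerDim X (k + 1) := by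
  have h1 := hx
  rw [mem_levelSpace_iff_form hnd hskew] at h1
  push Not at h1
  obtain ⟨v₀, hv₀, hf⟩ := h1
  refine finrank_ker_border₀ (f := -(H x ∘ₗ (X ^ k))) (p := (X ^ k) x)
    (z := cornerEntry H X x y k) (v₀ := v₀) (extEnd_pow_apply k) ?_ hv₀ ?_
  · rintro ⟨u, hu⟩
    refine hx (mem_levelSpace.2 ⟨u, x - X u, ?_, by abel⟩)
    rw [map_sub, ← Module.End.mul_apply, ← pow_succ, hu, sub_self]
  · simpa using hf

/-- The quantity deciding whether the kernel of a power of the extension grows by `1` or `2`. -/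
lemma kerDim_extEnd_of_mem [Finite K] (hnd : ∀ u, (∀ v, H u v = 0) → u = 0)
    (hskew : ∀ u v, H (X u) v = -H u (X v)) {k : ℕ} {u w : V} (hw : (X ^ k) w = 0)
    (hx : x = X u + w) :
    (cornerEntry H X x y k + H x ((X ^ k) u) = 0 →
      kerDim (extEnd H X x y) (k + 1) = kerDim X (k + 1) + 2) ∧
    (cornerEntry H X x y k + H x ((X ^ k) u) ≠ 0 →
      kerDim (extEnd H X x y) (k + 1) = kerDim X (k + 1) + 1) := by
  have hp : (X ^ k) x = (X ^ (k + 1)) u := by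
    rw [hx, map_add, hw, add_zero, pow_succ, Module.End.mul_apply]
  have hf : ∀ v, (X ^ (k + 1)) v = 0 → (-(H x ∘ₗ (X ^ k))) v = 0 := by
    intro v hv
    have := (mem_levelSpace_iff_form hnd hskew k x).1 (mem_levelSpace.2 ⟨u, w, hw, hx⟩) v hv
    simp [this]
  have e : cornerEntry H X x y k - (-(H x ∘ₗ (X ^ k))) u =
      cornerEntry H X x y k + H x ((X ^ k) u) := by simp
  constructor
  · intro h
    exact finrank_ker_border₂ (extEnd_pow_apply k) hp hf (by rw [e, h])
  · intro h
    exact finrank_ker_border₁ (extEnd_pow_apply k) hp hf (by rw [e]; exact h)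

/-- At positive levels the deciding quantity does not involve $y$; it is a value of the form on
$\ker X^{j+1}$. -/
lemma corner_succ (hskew : ∀ u v, H (X u) v = -H u (X v)) {j : ℕ} {u w : V}
    (hw : (X ^ (j + 1)) w = 0) (hx : x = X u + w) :
    cornerEntry H X x y (j + 1) + H x ((X ^ (j + 1)) u) = -H w ((X ^ j) w) := by
  have h1 : (X ^ (j + 1)) u = (X ^ j) x - (X ^ j) w := by
    rw [hx, map_add, add_sub_cancel_right, pow_succ, Module.End.mul_apply]
  have h2 : H x ((X ^ j) w) = H w ((X ^ j) w) := by
    rw [hx, map_add, LinearMap.add_apply, hskew, ← Module.End.mul_apply, ← pow_succ', hw, map_zero,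
      neg_zero, zero_add]
  rw [cornerEntry, h1, map_sub, h2]
  ring

/-- Strictly above the level of $x$ the deciding quantity $-H(w,X^{k-1}w)$ vanishes, because already
$X^{k-1}w=0$. -/
lemma kerDim_extEnd_of_lt [Finite K] (hnd : ∀ u, (∀ v, H u v = 0) → u = 0)
    (hskew : ∀ u v, H (X u) v = -H u (X v)) {l k : ℕ} (hlk : l < k) (hx : x ∈ levelSpace X l) :
    kerDim (extEnd H X x y) (k + 1) = kerDim X (k + 1) + 2 := by
  obtain ⟨u, w, hw, hx⟩ := mem_levelSpace.1 hx
  obtain ⟨j, rfl⟩ : ∃ j, k = j + 1 := ⟨k - 1, by omega⟩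
  refine (kerDim_extEnd_of_mem hnd hskew (pow_apply_eq_zero hw (by omega)) hx).1 ?_
  rw [corner_succ hskew (pow_apply_eq_zero hw (by omega)) hx,
    pow_apply_eq_zero hw (by omega : l ≤ j), map_zero, neg_zero]

/-- The Jordan type of the extension, when `l` is minimal with `x ∈ im X + ker X^l`. -/
lemma jordanType_extEnd [Finite K] (hnd : ∀ u, (∀ v, H u v = 0) → u = 0)
    (hskew : ∀ u v, H (X u) v = -H u (X v)) (hnil : IsNilpotent X) {l : ℕ} {u w : V}
    (hw : (X ^ l) w = 0) (hx : x = X u + w) (hmin : ∀ k < l, x ∉ levelSpace X k) :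
    (cornerEntry H X x y l + H x ((X ^ l) u) = 0 →
      jordanType (extEnd H X x y) = addB (jordanType X) l) ∧
    (cornerEntry H X x y l + H x ((X ^ l) u) ≠ 0 →
      jordanType (extEnd H X x y) = addA (jordanType X) l) := by
  -- The kernel dimensions do not grow up to the power $l$, grow by $1$ or $2$ at $l+1$, and by $2$
  -- afterwards. Consecutive differences show in which columns the two boxes appear.
  have hlow : ∀ i ≤ l, kerDim (extEnd H X x y) i = kerDim X i := by
    intro i hi
    rcases i with _ | i
    · rw [kerDim_zero, kerDim_zero]
    · exact kerDim_extEnd_of_notMem hnd hskew (hmin i (by omega))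
  have hhigh : ∀ i, l + 1 < i → kerDim (extEnd H X x y) i = kerDim X i + 2 := by
    intro i hi
    obtain ⟨k, rfl⟩ : ∃ k, i = k + 1 := ⟨i - 1, by omega⟩
    exact kerDim_extEnd_of_lt hnd hskew (by omega : l < k) (mem_levelSpace.2 ⟨u, w, hw, hx⟩)
  have hmid := kerDim_extEnd_of_mem (y := y) hnd hskew hw hx
  have hmono : ∀ i, kerDim X i ≤ kerDim X (i + 1) := fun i => kerDim_mono X (by omega : i ≤ i + 1)
  constructor
  · intro h
    refine congrArg ofColLen (funext fun i => ?_)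
    rw [colLen_jordanType hnil, jordanCol, jordanCol]
    have h1 := hmono i
    rcases lt_trichotomy i l with hi | hi | hi
    · rw [hlow i (by omega), hlow (i + 1) (by omega), if_neg (by omega), add_zero]
    · subst hi
      rw [hlow i le_rfl, hmid.1 h, if_pos rfl]
      omega
    · rw [hhigh (i + 1) (by omega), if_neg (by omega)]
      by_cases hi' : i = l + 1
      · subst hi'; rw [hmid.1 h]; omega
      · rw [hhigh i (by omega)]; omega
  · intro h
    refine congrArg ofColLen (funext fun i => ?_)
    rw [colLen_jordanType hnil, jordanCol, jordanCol]
    have h1 := hmono i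
    rcases lt_trichotomy i l with hi | hi | hi
    · rw [hlow i (by omega), hlow (i + 1) (by omega), if_neg (by omega), add_zero]
    · subst hi
      rw [hlow i le_rfl, hmid.2 h, if_pos (Or.inl rfl)]
      omega
    · rw [hhigh (i + 1) (by omega)]
      by_cases hi' : i = l + 1
      · subst hi'; rw [hmid.2 h, if_pos (Or.inr rfl)]; omega
      · rw [hhigh i (by omega), if_neg (by omega)]; omega

end KerDim

end Extension

/-! ## Counting the extensions of a given Jordan type -/

section Counting

variable {K : Type*} [Field K] [Finite K] {σ : K →+* K} {q : ℕ}

/-- Multiplication by the skew element $\theta-\sigma\theta\ne0$ is a bijection from the fixed field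
onto the skew elements. -/
lemma card_skew (hσ : IsQuadConj σ q) : Nat.card {y : K // σ y = -y} = q := by
  obtain ⟨θ, hθ⟩ := hσ.moved
  set δ := θ - σ θ with hδ
  have hδ0 : δ ≠ 0 := fun h => hθ (sub_eq_zero.1 h).symm
  have hσδ : σ δ = -δ := by rw [hδ, map_sub, hσ.invol]; ring
  rw [← hσ.card_fixed]
  refine Nat.card_congr ⟨fun y => ⟨y.1 / δ, ?_⟩, fun a => ⟨a.1 * δ, ?_⟩, fun y => ?_, fun a => ?_⟩
  · rw [map_div₀, y.2, hσδ, neg_div_neg_eq]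
  · rw [map_mul, a.2, hσδ, mul_neg]
  · exact Subtype.ext (div_mul_cancel₀ _ hδ0)
  · exact Subtype.ext (mul_div_cancel_right₀ _ hδ0)

lemma card_preimage_linearMap {M M' : Type*} [AddCommGroup M] [Module K M] [AddCommGroup M']
    [Module K M'] [Finite M] (φ : M →ₗ[K] M') (P : M' → Prop) (hP : ∀ x, P x → ∃ m, φ m = x) :
    Nat.card {m // P (φ m)} = Nat.card {x // P x} * Nat.card (LinearMap.ker φ) := by
  choose! g hg using hP
  rw [← Nat.card_prod]
  refine Nat.card_congr ⟨fun m => (⟨φ m.1, m.2⟩, ⟨m.1 - g (φ m.1), ?_⟩),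
    fun p => ⟨p.2.1 + g p.1.1, ?_⟩, fun m => ?_, fun p => ?_⟩
  · rw [LinearMap.mem_ker, map_sub, hg _ m.2, sub_self]
  · rw [map_add, p.2.2, zero_add, hg _ p.1.2]
    exact p.1.2
  · exact Subtype.ext (sub_add_cancel _ _)
  · have h : φ (p.2.1 + g p.1.1) = p.1.1 := by rw [map_add, p.2.2, zero_add, hg _ p.1.2]
    refine Prod.ext (Subtype.ext h) (Subtype.ext ?_)
    simp only [h, add_sub_cancel_right]

variable {V : Type*} [AddCommGroup V] [Module K V] [FiniteDimensional K V]
  {H : V →ₛₗ[σ] V →ₗ[K] K} {X : Module.End K V}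

/-- The vectors `x = X u + w` with `X^(j+1) w = 0` and `H(w, X^j w) = 0`. -/
def IsotropicAt (H : V →ₛₗ[σ] V →ₗ[K] K) (X : Module.End K V) (j : ℕ) (x : V) : Prop :=
  ∃ u w, (X ^ (j + 1)) w = 0 ∧ x = X u + w ∧ H w ((X ^ j) w) = 0

/-- Two choices of $w$ differ by an element of $\operatorname{im}X$, which pairs to zero with
$X^j(\ker X^{j+1})$; the value therefore depends on $x$ alone. -/
lemma form_eq_of_sub_mem_range (hX : IsHermSys H X) {j : ℕ} {u u' w w' : V}
    (hw : (X ^ (j + 1)) w = 0) (hw' : (X ^ (j + 1)) w' = 0) (h : X u + w = X u' + w') :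
    H w ((X ^ j) w) = H w' ((X ^ j) w') := by
  have e : w = X (u' - u) + w' := by
    rw [map_sub, sub_add_eq_add_sub, ← h, add_sub_cancel_left]
  have hz : ∀ a b, (X ^ (j + 1)) b = 0 → H (X a) ((X ^ j) b) = 0 := fun a b hb => by
    rw [hX.skew, ← Module.End.mul_apply, ← pow_succ', hb, map_zero, neg_zero]
  have h1 : H w ((X ^ j) w) = H w' ((X ^ j) w) := by
    rw [e, map_add H, LinearMap.add_apply, ← e, hz _ _ hw, zero_add]
  have h2 : H w' ((X ^ j) (X (u' - u))) = 0 := by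
    have h3 := skew_pow hX.skew (j + 1) w' (u' - u)
    rw [hw', map_zero, LinearMap.zero_apply] at h3
    rw [← Module.End.mul_apply, ← pow_succ]
    exact (mul_eq_zero.1 h3.symm).resolve_left (pow_ne_zero _ (by simp))
  rw [h1, e, map_add (X ^ j), map_add (H w'), h2, zero_add]

lemma isotropicAt_iff (hX : IsHermSys H X) {j : ℕ} {u w : V} (hw : (X ^ (j + 1)) w = 0) :
    IsotropicAt H X j (X u + w) ↔ H w ((X ^ j) w) = 0 := by
  constructor
  · rintro ⟨u', w', hw', h, h0⟩
    rw [form_eq_of_sub_mem_range hX hw hw' h, h0]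
  · exact fun h => ⟨u, w, hw, rfl, h⟩

lemma isotropicAt_of_mem {j : ℕ} {x : V} (hx : x ∈ levelSpace X j) : IsotropicAt H X j x := by
  obtain ⟨u, w, hw, hx⟩ := mem_levelSpace.1 hx
  exact ⟨u, w, pow_apply_eq_zero hw (by omega), hx, by rw [hw, map_zero]⟩

lemma mem_of_isotropicAt {j : ℕ} {x : V} (hx : IsotropicAt H X j x) :
    x ∈ levelSpace X (j + 1) := by
  obtain ⟨u, w, hw, hx, -⟩ := hx
  exact mem_levelSpace.2 ⟨u, w, hw, hx⟩

lemma card_submodule (hσ : IsQuadConj σ q) (S : Submodule K V) :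
    (Nat.card S : ℝ) = (q : ℝ) ^ (2 * Module.finrank K S) := by
  rw [card_quad hσ]; push_cast; rfl

/-- The form `(w, w') ↦ H(w, X^j w')` on `ker X^(j+1)`. -/
def kerForm (H : V →ₛₗ[σ] V →ₗ[K] K) (X : Module.End K V) (j : ℕ) :
    LinearMap.ker (X ^ (j + 1)) →ₛₗ[σ] LinearMap.ker (X ^ (j + 1)) →ₗ[K] K :=
  LinearMap.mk₂'ₛₗ σ (RingHom.id K) (fun w w' => H w ((X ^ j) w'))
    (fun a b c => by simp) (fun a b c => by simp) (fun a b c => by simp) (fun a b c => by simp)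

/-- By duality the radical is $\ker X^{j+1}\cap(\operatorname{im}X+\ker X^j)$. The rank is thus the
jump in dimension between consecutive level spaces, the number of Jordan blocks of size exactly
$j+1$. -/
lemma finrank_ker_kerForm (hX : IsHermSys H X) (j : ℕ) :
    kerDim X (j + 1) - Module.finrank K (LinearMap.ker (kerForm H X j)) =
      jordanCol X j - jordanCol X (j + 1) ∧
    Module.finrank K (LinearMap.ker (kerForm H X j)) ≤ kerDim X (j + 1) := by
  have h1 : (LinearMap.ker (kerForm H X j)).map (LinearMap.ker (X ^ (j + 1))).subtype =
      LinearMap.ker (X ^ (j + 1)) ⊓ levelSpace X j := by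
    ext w
    rw [Submodule.mem_map, Submodule.mem_inf, mem_levelSpace_iff_form hX.nondeg hX.skew]
    constructor
    · rintro ⟨w, hw, rfl⟩
      refine ⟨w.2, fun v hv => ?_⟩
      exact LinearMap.congr_fun (LinearMap.mem_ker.1 hw) ⟨v, hv⟩
    · rintro ⟨h1, h2⟩
      refine ⟨⟨w, h1⟩, ?_, rfl⟩
      rw [LinearMap.mem_ker]
      ext v
      exact h2 v.1 v.2
  have h2 : Module.finrank K (LinearMap.ker (kerForm H X j)) =
      Module.finrank K ↥(LinearMap.ker (X ^ (j + 1)) ⊓ levelSpace X j) := by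
    rw [← h1]
    exact (Submodule.finrank_map_subtype_eq _ _).symm
  have h3 := Submodule.finrank_sup_add_finrank_inf_eq (LinearMap.ker (X ^ (j + 1))) (levelSpace X j)
  have h4 : LinearMap.ker (X ^ (j + 1)) ⊔ levelSpace X j = levelSpace X (j + 1) := by
    refine le_antisymm (sup_le le_sup_right (levelSpace_mono X (by omega))) ?_
    exact sup_le (le_sup_of_le_right le_sup_left) le_sup_left
  have h5 := finrank_levelSpace X j
  have h6 := finrank_levelSpace X (j + 1)
  have h7 := jordanCol_antitone X (by omega : j ≤ j + 1)
  have h8 : Module.finrank K (LinearMap.ker (X ^ (j + 1))) = kerDim X (j + 1) := rfl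
  rw [h4, ← h2] at h3
  omega

/-- Addition $\operatorname{im}X\times\ker X^{j+1}\to V$ has fibres of constant size over its image,
the level space. Hence the proportion of isotropic $x$ there equals the proportion of isotropic $w$
in $\ker X^{j+1}$, given by `card_isotropic`. -/
lemma card_isotropicAt (hσ : IsQuadConj σ q) (hX : IsHermSys H X) (j : ℕ) :
    (q : ℝ) * Nat.card {x // IsotropicAt H X j x} =
      Nat.card (levelSpace X (j + 1)) *
        (1 + (-(q : ℝ)⁻¹) ^ (jordanCol X j - jordanCol X (j + 1)) * (q - 1)) := by
  have : Finite V := Module.finite_of_finite K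
  have hq : (q : ℝ) ≠ 0 := by have := hσ.one_lt; positivity
  set κ := LinearMap.ker (X ^ (j + 1))
  set φ : LinearMap.range X × κ →ₗ[K] V := (LinearMap.range X).subtype.coprod κ.subtype
  have hφ : ∀ p, φ p = p.1 + p.2 := fun p => rfl
  have hS : ∀ x ∈ levelSpace X (j + 1), ∃ m, φ m = x := by
    intro x hx
    obtain ⟨u, w, hw, rfl⟩ := mem_levelSpace.1 hx
    exact ⟨(⟨X u, u, rfl⟩, ⟨w, hw⟩), rfl⟩
  have hmem : ∀ m, φ m ∈ levelSpace X (j + 1) := by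
    rintro ⟨⟨_, u, rfl⟩, w⟩
    exact mem_levelSpace.2 ⟨u, w, w.2, rfl⟩
  have c1 := card_preimage_linearMap φ (IsotropicAt H X j) fun x hx => hS x (mem_of_isotropicAt hx)
  have c2 := card_preimage_linearMap φ (· ∈ levelSpace X (j + 1)) hS
  have c3 : Nat.card {m // φ m ∈ levelSpace X (j + 1)} = Nat.card (LinearMap.range X) * Nat.card κ := by
    rw [← Nat.card_prod]
    exact Nat.card_congr (Equiv.subtypeUnivEquiv hmem)
  have c4 : Nat.card {m // IsotropicAt H X j (φ m)} =
      Nat.card (LinearMap.range X) * Nat.card {w : κ // kerForm H X j w w = 0} := by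
    rw [← Nat.card_prod]
    have hiff : ∀ m, IsotropicAt H X j (φ m) ↔ kerForm H X j m.2 m.2 = 0 := by
      rintro ⟨⟨_, u, rfl⟩, w⟩
      exact isotropicAt_iff hX w.2
    refine Nat.card_congr ⟨fun m => (m.1.1, ⟨m.1.2, (hiff _).1 m.2⟩),
      fun p => ⟨(p.1, p.2.1), (hiff _).2 p.2.2⟩, fun m => rfl, fun p => rfl⟩
  have c5 := card_isotropic hσ (kerDim X (j + 1)) (V := κ) rfl (H := kerForm H X j)
    (ε := (-1) ^ j) (by
      intro u v
      change σ (H u ((X ^ j) v)) = _ * H v ((X ^ j) u)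
      rw [hX.herm, skew_pow hX.skew])
  have c6 := card_submodule hσ κ
  obtain ⟨h1, h2⟩ := finrank_ker_kerForm hX j
  set m := jordanCol X j - jordanCol X (j + 1)
  set r := Module.finrank K (LinearMap.ker (kerForm H X j))
  have hκ : Module.finrank K κ = r + m := by
    have : Module.finrank K κ = kerDim X (j + 1) := rfl
    omega
  have hκ' : kerDim X (j + 1) = r + m := by omega
  rw [h1, hκ'] at c5
  rw [hκ] at c6
  rw [c4] at c1
  rw [c3] at c2
  have hk0 : (Nat.card (LinearMap.ker φ) : ℝ) ≠ 0 := by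
    exact_mod_cast Nat.card_pos.ne'
  have c1' : (Nat.card (LinearMap.range X) : ℝ) * Nat.card {w : κ // kerForm H X j w w = 0} =
      Nat.card {x // IsotropicAt H X j x} * Nat.card (LinearMap.ker φ) := by exact_mod_cast c1
  have c2' : (Nat.card (LinearMap.range X) : ℝ) * Nat.card κ =
      Nat.card (levelSpace X (j + 1)) * Nat.card (LinearMap.ker φ) := by exact_mod_cast c2
  have key : (q : ℝ) ^ (2 * (r + m)) + (q : ℝ) ^ (2 * r) * (-(q : ℝ)) ^ m * (q - 1) =
      (q : ℝ) ^ (2 * (r + m)) * (1 + (-(q : ℝ)⁻¹) ^ m * (q - 1)) := by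
    have : (q : ℝ) ^ (2 * m) * (-(q : ℝ)⁻¹) ^ m = (-(q : ℝ)) ^ m := by
      rw [pow_mul, ← mul_pow]
      congr 1
      field_simp
    rw [mul_add 2 r m, pow_add, ← this]
    ring
  rw [key] at c5
  refine mul_right_cancel₀ hk0 ?_
  calc (q : ℝ) * Nat.card {x // IsotropicAt H X j x} * Nat.card (LinearMap.ker φ)
      = Nat.card (LinearMap.range X) * (q * Nat.card {w : κ // kerForm H X j w w = 0}) := by
        rw [mul_assoc, ← c1']; ring
    _ = (Nat.card (LinearMap.range X) * Nat.card κ) * (1 + (-(q : ℝ)⁻¹) ^ m * (q - 1)) := by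
        rw [c5, c6]; ring
    _ = _ := by rw [c2']; ring

/-- The number of pairs `(x, y)` for which the extension has type `addA μ j`. -/
def numA (q N : ℕ) (μ : YoungDiagram) (j : ℕ) : ℝ :=
  (q : ℝ) ^ (2 * N + 1) * ((q : ℝ)⁻¹) ^ (μ.colLen j + μ.colLen (j + 1)) * xiA (-(q : ℝ)⁻¹) μ j

/-- The number of pairs `(x, y)` for which the extension has type `addB μ j`. -/
def numB (q N : ℕ) (μ : YoungDiagram) (j : ℕ) : ℝ :=
  (q : ℝ) ^ (2 * N + 1) * ((q : ℝ)⁻¹) ^ (2 * μ.colLen j + 1) * xiB (-(q : ℝ)⁻¹) μ j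

variable [Fintype V] [Fintype {y : K // σ y = -y}]

lemma card_levelSpace (hσ : IsQuadConj σ q) (X : Module.End K V) (j : ℕ) :
    (Nat.card (levelSpace X j) : ℝ) =
      (q : ℝ) ^ (2 * Module.finrank K V) * ((q : ℝ)⁻¹) ^ (2 * jordanCol X j) := by
  have hq : (q : ℝ) ≠ 0 := by have := hσ.one_lt; positivity
  rw [card_submodule hσ, ← finrank_levelSpace X j, mul_add, pow_add, mul_assoc, ← mul_pow,
    mul_inv_cancel₀ hq, one_pow, mul_one]

/-- For $x=Xu$ the deciding quantity is $y+H(x,u)$, and $-H(Xu,u)$ is itself skew. Exactly one of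
the $q$ values of $y$ gives two boxes in the first column. -/
lemma sum_jordanType_extEnd_of_mem_range (hσ : IsQuadConj σ q) (hX : IsHermSys H X)
    (G : YoungDiagram → ℝ) {x : V} (hx : x ∈ levelSpace X 0) :
    ∑ y : {y : K // σ y = -y}, G (jordanType (extEnd H X x y.1)) =
      (q - 1) * G (addA (jordanType X) 0) + G (addB (jordanType X) 0) := by
  classical
  obtain ⟨u, w, hw, hx⟩ := mem_levelSpace.1 hx
  have h0 := fun y => jordanType_extEnd (y := y) hX.nondeg hX.skew hX.nilp hw hx
    (fun k hk => absurd hk (by omega))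
  have hw0 : w = 0 := hw
  have hσ0 : σ (-(H x u)) = -(-(H x u)) := by
    rw [hx, hw0, add_zero, map_neg, hX.skew, map_neg, hX.herm, ← hX.skew, neg_neg]
  set y₀ : {y : K // σ y = -y} := ⟨-(H x u), hσ0⟩
  have h1 : ∀ y : {y : K // σ y = -y}, G (jordanType (extEnd H X x y.1)) =
      G (addA (jordanType X) 0) + if y = y₀ then
        G (addB (jordanType X) 0) - G (addA (jordanType X) 0) else 0 := by
    intro y
    split_ifs with hy
    · rw [(h0 y).1 (by rw [hy]; simp [cornerEntry, y₀])]; ring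
    · rw [(h0 y).2 (fun h => hy (Subtype.ext (eq_neg_of_add_eq_zero_left (by
        simpa [cornerEntry] using h))))]
      ring
  simp only [h1, Finset.sum_add_distrib, Finset.sum_ite_eq', Finset.mem_univ, if_true,
    Finset.sum_const, Finset.card_univ, nsmul_eq_mul]
  rw [← Nat.card_eq_fintype_card, card_skew hσ]
  ring

open Classical in
-- At positive level the type is independent of $y$, whence the factor $q$.
lemma sum_jordanType_extEnd_of_level (hσ : IsQuadConj σ q) (hX : IsHermSys H X)
    (G : YoungDiagram → ℝ) {j : ℕ} {x : V} (hx : x ∈ levelSpace X (j + 1))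
    (hx' : x ∉ levelSpace X j) :
    ∑ y : {y : K // σ y = -y}, G (jordanType (extEnd H X x y.1)) =
      q * if IsotropicAt H X j x then G (addB (jordanType X) (j + 1)) else
        G (addA (jordanType X) (j + 1)) := by
  obtain ⟨u, w, hw, hx⟩ := mem_levelSpace.1 hx
  have h0 := fun y => jordanType_extEnd (y := y) hX.nondeg hX.skew hX.nilp hw hx
    (fun k hk hk' => hx' (levelSpace_mono X (by omega) hk'))
  have h1 : ∀ y : {y : K // σ y = -y}, G (jordanType (extEnd H X x y.1)) =
      if IsotropicAt H X j x then G (addB (jordanType X) (j + 1)) else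
        G (addA (jordanType X) (j + 1)) := by
    intro y
    have h2 := h0 y
    rw [corner_succ hX.skew hw hx, neg_eq_zero, ne_eq, neg_eq_zero, ← isotropicAt_iff hX (u := u) hw,
      ← hx] at h2
    split_ifs with h
    · rw [h2.1 h]
    · rw [h2.2 h]
  simp only [h1, Finset.sum_const, Finset.card_univ, nsmul_eq_mul]
  rw [← Nat.card_eq_fintype_card, card_skew hσ]

open Classical in
lemma sum_ite_eq_card (P : V → Prop) (c : ℝ) :
    ∑ x, (if P x then c else 0) = Nat.card {x // P x} * c := by
  rw [← Finset.sum_filter, Finset.sum_const, nsmul_eq_mul, Nat.card_eq_fintype_card,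
    Fintype.card_subtype]

/-- Here $s=q^{-1}$, $Q=q^{2\dim V}$, $d$ is the length of column $j+2$, and $m,m'$ are the
multiplicities of the row lengths $j+1,j+2$. The number $P$ counts isotropic $x$, so the left sides
count pairs $(x,y)$ of the two kinds. -/
lemma count_identities {q s Q P : ℝ} (hqs : q * s = 1) {m m' d : ℕ}
    (hP : q * P = Q * s ^ (2 * (d + m')) * (1 + (-s) ^ m * (q - 1))) :
    q * (Q * s ^ (2 * (d + m')) - P) =
      Q * q * s ^ (d + m' + d) * ((1 + -s) * (- -s) ^ m' * (1 - (-s) ^ m)) ∧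
    q * (P - Q * s ^ (2 * (d + m' + m))) =
      Q * q * s ^ (2 * (d + m') + 1) * ((1 - (-s) ^ m) * (1 - (-s) ^ (m - 1))) := by
  constructor
  · rw [mul_sub, hP, neg_neg, mul_assoc (Q * q), show s ^ (d + m' + d) * ((1 + -s) * s ^ m' * (1 - (-s) ^ m)) =
      s ^ (2 * (d + m')) * ((1 + -s) * (1 - (-s) ^ m)) by ring]
    linear_combination Q * s ^ (2 * (d + m')) * (1 - (-s) ^ m) * hqs
  · have hss : s ^ (2 * m) = (-s) ^ m * (-s) ^ m := by rw [← mul_pow, pow_mul]; congr 1; ring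
    rw [mul_sub, hP, mul_add 2 (d + m') m, pow_add s _ (2 * m), hss, pow_succ s]
    rcases m with _ | m
    · simp only [pow_zero]
      ring
    · rw [Nat.add_sub_cancel, pow_succ (-s) m]
      linear_combination (Q * s ^ (2 * (d + m'))) * (-1 - s * (-s) ^ m) * hqs

open Classical in
-- The isotropic vectors lie between two consecutive level spaces and split the difference into its
-- two types.
lemma sum_level_succ (hσ : IsQuadConj σ q) (hX : IsHermSys H X) (a b : ℝ) (j : ℕ) (g : V → ℝ)
    (hg : ∀ x, x ∈ levelSpace X (j + 1) → x ∉ levelSpace X j →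
      g x = q * if IsotropicAt H X j x then b else a) :
    ∑ x, ((if x ∈ levelSpace X (j + 1) then g x else 0) - if x ∈ levelSpace X j then g x else 0) =
      numA q (Module.finrank K V) (jordanType X) (j + 1) * a +
        numB q (Module.finrank K V) (jordanType X) (j + 1) * b := by
  have hpt : ∀ x, ((if x ∈ levelSpace X (j + 1) then g x else 0) -
      if x ∈ levelSpace X j then g x else 0) =
      ((if IsotropicAt H X j x then q * b else 0) - if x ∈ levelSpace X j then q * b else 0) +
      ((if x ∈ levelSpace X (j + 1) then q * a else 0) -
        if IsotropicAt H X j x then q * a else 0) := by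
    intro x
    by_cases h1 : x ∈ levelSpace X j
    · simp [h1, isotropicAt_of_mem h1, levelSpace_mono X (by omega : j ≤ j + 1) h1]
    · by_cases h2 : x ∈ levelSpace X (j + 1)
      · rw [if_pos h2, if_neg h1, if_neg h1, if_pos h2, hg x h2 h1]
        split_ifs <;> ring
      · have h3 : ¬ IsotropicAt H X j x := fun h => h2 (mem_of_isotropicAt h)
        simp [h1, h2, h3]
  simp only [hpt, Finset.sum_add_distrib, Finset.sum_sub_distrib]
  rw [sum_ite_eq_card, sum_ite_eq_card, sum_ite_eq_card, sum_ite_eq_card]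
  have c1 := card_isotropicAt hσ hX j
  have c2 := card_levelSpace hσ X (j + 1)
  have c3 := card_levelSpace hσ X j
  have hq : (q : ℝ) ≠ 0 := by have := hσ.one_lt; positivity
  have hanti := jordanCol_antitone X (by omega : j ≤ j + 1)
  have hanti' := jordanCol_antitone X (by omega : j + 1 ≤ j + 1 + 1)
  rw [numA, numB, xiA, xiB, if_neg (by omega), if_neg (by omega)]
  simp only [cmult, colLen_jordanType hX.nilp, Nat.add_sub_cancel]
  change _ * (Nat.card {x // IsotropicAt H X j x} : ℝ) = _ at c1
  have e1 : (Nat.card {x // x ∈ levelSpace X (j + 1)} : ℝ) = _ := c2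
  have e2 : (Nat.card {x // x ∈ levelSpace X j} : ℝ) = _ := c3
  rw [c2] at c1
  rw [e1, e2]
  obtain ⟨m, hm⟩ := Nat.exists_eq_add_of_le hanti
  obtain ⟨m', hm'⟩ := Nat.exists_eq_add_of_le hanti'
  rw [hm, Nat.add_sub_cancel_left] at c1
  rw [hm, Nat.add_sub_cancel_left]
  rw [hm'] at c1 ⊢
  rw [Nat.add_sub_cancel_left]
  obtain ⟨hA, hB⟩ := count_identities (mul_inv_cancel₀ hq) c1
  rw [pow_succ (q : ℝ)]
  linear_combination a * hA + b * hB

/-- The distribution of the Jordan types of the extensions. -/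
lemma sum_jordanType_extEnd (hσ : IsQuadConj σ q) (hX : IsHermSys H X) (G : YoungDiagram → ℝ) :
    ∑ x : V, ∑ y : {y : K // σ y = -y}, G (jordanType (extEnd H X x y.1)) =
      ∑ j ∈ Finset.range (Module.finrank K V + 1),
        (numA q (Module.finrank K V) (jordanType X) j * G (addA (jordanType X) j) +
          numB q (Module.finrank K V) (jordanType X) j * G (addB (jordanType X) j)) := by
  classical
  set g : V → ℝ := fun x => ∑ y : {y : K // σ y = -y}, G (jordanType (extEnd H X x y.1))
  set f : ℕ → ℝ := fun j => ∑ x, if x ∈ levelSpace X j then g x else 0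
  -- The level space at $\dim V$ is everything, so the sum over $V$ telescopes along the levels.
  have htop : ∑ x, g x = f (Module.finrank K V) := by
    refine Finset.sum_congr rfl fun x _ => (if_pos ?_).symm
    exact mem_levelSpace.2 ⟨0, x, by rw [pow_finrank_eq_zero hX.nilp]; rfl, by simp⟩
  rw [htop, Finset.sum_range_succ', ← sub_add_cancel (f (Module.finrank K V)) (f 0),
    ← Finset.sum_range_sub]
  congr 1
  · refine Finset.sum_congr rfl fun j _ => ?_
    rw [← sum_level_succ hσ hX, ← Finset.sum_sub_distrib]
    exact fun x h1 h2 => sum_jordanType_extEnd_of_level hσ hX G h1 h2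
  · have h0 : f 0 = ∑ x, if x ∈ levelSpace X 0 then
        (q - 1) * G (addA (jordanType X) 0) + G (addB (jordanType X) 0) else 0 := by
      refine Finset.sum_congr rfl fun x _ => ?_
      split_ifs with hx
      · exact sum_jordanType_extEnd_of_mem_range hσ hX G hx
      · rfl
    have hq : (q : ℝ) ≠ 0 := by have := hσ.one_lt; positivity
    have hanti := jordanCol_antitone X (by omega : 0 ≤ 0 + 1)
    have e1 : (Nat.card {x // x ∈ levelSpace X 0} : ℝ) = _ := card_levelSpace hσ X 0
    rw [h0, sum_ite_eq_card, e1, numA, numB, xiA, xiB, if_pos rfl, if_pos rfl]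
    simp only [cmult, colLen_jordanType hX.nilp, Nat.add_sub_cancel]
    obtain ⟨m, hm⟩ := Nat.exists_eq_add_of_le hanti
    rw [hm, Nat.add_sub_cancel_left]
    rw [neg_neg, pow_succ (q : ℝ), pow_succ (q : ℝ)⁻¹]
    linear_combination (q : ℝ) ^ (2 * Module.finrank K V) *
      ((q : ℝ)⁻¹ ^ (2 * (jordanCol X (0 + 1) + m))) *
      (G (addA (jordanType X) 0) - G (addB (jordanType X) 0)) * mul_inv_cancel₀ hq

end Counting

/-! ## The standard Hermitian form and the unitary Lie algebra -/

lemma pow_intertwine {K V V' : Type*} [Field K] [AddCommGroup V] [Module K V] [AddCommGroup V']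
    [Module K V'] {X : Module.End K V} {X' : Module.End K V'} (e : V →ₗ[K] V')
    (h : ∀ v, e (X v) = X' (e v)) (j : ℕ) (v : V) : e ((X ^ j) v) = (X' ^ j) (e v) := by
  induction j generalizing v with
  | zero => rfl
  | succ j ih => rw [pow_succ, pow_succ, Module.End.mul_apply, Module.End.mul_apply, ih, h]

lemma jordanType_eq_of_equiv {K V V' : Type*} [Field K] [AddCommGroup V] [Module K V]
    [AddCommGroup V'] [Module K V'] {X : Module.End K V} {X' : Module.End K V'} (e : V ≃ₗ[K] V')
    (h : ∀ v, e (X v) = X' (e v)) : jordanType X = jordanType X' := by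
  have hk : kerDim X = kerDim X' := by
    funext j
    have hp : ∀ v, e ((X ^ j) v) = (X' ^ j) (e v) := pow_intertwine e.toLinearMap h j
    have hm : (LinearMap.ker (X ^ j)).map e.toLinearMap = LinearMap.ker (X' ^ j) := by
      ext v
      rw [Submodule.mem_map]
      constructor
      · rintro ⟨w, hw, rfl⟩
        have hw : (X ^ j) w = 0 := hw
        change (X' ^ j) (e w) = 0
        rw [← hp, hw, map_zero]
      · intro hv
        have hv : (X' ^ j) v = 0 := hv
        refine ⟨e.symm v, ?_, e.apply_symm_apply v⟩
        rw [LinearMap.mem_ker, ← e.map_eq_zero_iff, hp, e.apply_symm_apply, hv]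
    rw [kerDim, kerDim, ← hm]
    exact (LinearEquiv.finrank_map_eq e _).symm
  refine congrArg ofColLen (funext fun j => ?_)
  rw [jordanCol, jordanCol, hk]

lemma isNilpotent_of_equiv {K V V' : Type*} [Field K] [AddCommGroup V] [Module K V]
    [AddCommGroup V'] [Module K V'] {X : Module.End K V} {X' : Module.End K V'} (e : V ≃ₗ[K] V')
    (h : ∀ v, e (X v) = X' (e v)) (hX : IsNilpotent X) : IsNilpotent X' := by
  obtain ⟨m, hm⟩ := hX
  refine ⟨m, LinearMap.ext fun v => ?_⟩
  have := pow_intertwine e.toLinearMap h m (e.symm v)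
  rw [hm] at this
  simpa using this.symm

section Standard

variable (k K : Type*) [Field k] [Fintype k] [Field K] [Algebra k K]

/-- The hermitian form `u^* J v`. -/
def stdForm (n : ℕ) : (Fin n → K) →ₛₗ[(conj k K : K →+* K)] (Fin n → K) →ₗ[K] K :=
  LinearMap.mk₂'ₛₗ _ (RingHom.id K) (fun u v => ∑ i, conj k K (u i) * v i.rev)
    (fun a b c => by
      simp only [Pi.add_apply, map_add, add_mul, Finset.sum_add_distrib])
    (fun a b c => by
      simp only [Pi.smul_apply, smul_eq_mul, map_mul, Finset.mul_sum, mul_assoc]; rfl)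
    (fun a b c => by simp only [Pi.add_apply, mul_add, Finset.sum_add_distrib])
    (fun a b c => by
      simp only [Pi.smul_apply, smul_eq_mul, RingHom.id_apply, Finset.mul_sum, mul_left_comm])

variable {K} {n : ℕ}

lemma stdForm_apply (u v : Fin n → K) :
    stdForm k K n u v = ∑ i, conj k K (u i) * v i.rev := rfl

lemma stdForm_eq_dotProduct (u v : Fin n → K) :
    stdForm k K n u v = (fun i => conj k K (u i)) ⬝ᵥ (J K n *ᵥ v) := by
  rw [stdForm_apply, dotProduct]
  refine Finset.sum_congr rfl fun i _ => ?_
  congr 1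
  simp [Matrix.mulVec, dotProduct, J]

lemma stdForm_single (u : Fin n → K) (s : Fin n) :
    stdForm k K n u (Pi.single s 1) = conj k K (u s.rev) := by
  rw [stdForm_apply, Finset.sum_eq_single s.rev]
  · rw [Fin.rev_rev, Pi.single_eq_same, mul_one]
  · intro i _ hi
    rw [Pi.single_eq_of_ne, mul_zero]
    intro h
    exact hi (by rw [← h, Fin.rev_rev])
  · simp

lemma single_stdForm (r : Fin n) (v : Fin n → K) :
    stdForm k K n (Pi.single r 1) v = v r.rev := by
  rw [stdForm_apply, Finset.sum_eq_single r]
  · rw [Pi.single_eq_same, map_one, one_mul]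
  · intro i _ hi
    rw [Pi.single_eq_of_ne hi, map_zero, zero_mul]
  · simp

variable {k}

lemma stdForm_herm (hinv : ∀ x : K, conj k K (conj k K x) = x) (u v : Fin n → K) :
    conj k K (stdForm k K n u v) = stdForm k K n v u := by
  rw [stdForm_apply, stdForm_apply, map_sum]
  refine Fintype.sum_equiv Fin.revPerm _ _ fun i => ?_
  rw [map_mul, hinv, Fin.revPerm_apply, Fin.rev_rev, mul_comm]

lemma stdForm_nondeg (u : Fin n → K) (h : ∀ v, stdForm k K n u v = 0) : u = 0 := by
  funext s
  have := h (Pi.single s.rev 1)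
  rw [stdForm_single, Fin.rev_rev] at this
  exact (map_eq_zero _).1 this

lemma mem_lie_iff_form {X : Matrix (Fin n) (Fin n) K} :
    X ∈ lie k K n ↔ ∀ u v, stdForm k K n (Matrix.toLin' X u) v =
      -stdForm k K n u (Matrix.toLin' X v) := by
  rw [mem_lie_iff]
  constructor
  · intro h u v
    rw [stdForm_apply, stdForm_apply]
    simp only [Matrix.toLin'_apply, Matrix.mulVec, dotProduct, map_sum, map_mul, Finset.sum_mul,
      Finset.mul_sum]
    rw [Finset.sum_comm, ← Finset.sum_neg_distrib]
    refine Finset.sum_congr rfl fun i _ => ?_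
    rw [← Finset.sum_neg_distrib]
    refine Fintype.sum_equiv Fin.revPerm _ _ fun j => ?_
    rw [h i.rev, Fin.revPerm_apply, Fin.rev_rev, Fin.rev_rev]
    ring
  · intro h r s
    have := h (Pi.single r.rev 1) (Pi.single s 1)
    rw [stdForm_single, single_stdForm, Matrix.toLin'_apply, Matrix.toLin'_apply,
      Matrix.mulVec_single_one, Matrix.mulVec_single_one, Fin.rev_rev] at this
    change conj k K (X s.rev r.rev) = - X r s at this
    rw [this, neg_neg]

lemma orbit_eq_iff {X X' : lie k K n} :
    orbit k X = orbit k X' ↔ ∃ e : (Fin n → K) ≃ₗ[K] (Fin n → K),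
      (∀ u v, stdForm k K n (e u) (e v) = stdForm k K n u v) ∧
      ∀ v, e (Matrix.toLin' X.1 v) = Matrix.toLin' X'.1 (e v) := by
  constructor
  · intro h
    obtain ⟨g, hg⟩ : ∃ g : unitary k K n, Ad k g X = X' := Quotient.exact h
    have h1 : g.1.1 * (g.1⁻¹).1 = 1 := by rw [← Units.val_mul]; simp
    have h2 : (g.1⁻¹).1 * g.1.1 = 1 := by rw [← Units.val_mul]; simp
    refine ⟨LinearEquiv.ofLinearMap (Matrix.toLin' g.1.1) (Matrix.toLin' (g.1⁻¹).1)
      (by rw [← Matrix.toLin'_mul, h1, Matrix.toLin'_one])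
      (by rw [← Matrix.toLin'_mul, h2, Matrix.toLin'_one]), fun u v => ?_, fun v => ?_⟩
    · have hu : adj k g.1.1 * J K n * g.1.1 = J K n := g.2
      have e1 : (fun i => conj k K ((g.1.1 *ᵥ u) i)) = (fun i => conj k K (u i)) ᵥ* adj k g.1.1 := by
        funext i
        simp only [Matrix.mulVec, Matrix.vecMul, dotProduct, map_sum, map_mul, adj,
          Matrix.transpose_apply, Matrix.map_apply, mul_comm]
      change stdForm k K n (g.1.1 *ᵥ u) (g.1.1 *ᵥ v) = _
      rw [stdForm_eq_dotProduct, e1, ← Matrix.dotProduct_mulVec, Matrix.mulVec_mulVec,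
        Matrix.mulVec_mulVec, hu, stdForm_eq_dotProduct]
    · change Matrix.toLin' g.1.1 (Matrix.toLin' X.1 v) =
        Matrix.toLin' X'.1 (Matrix.toLin' g.1.1 v)
      simp only [Matrix.toLin'_apply]
      change g.1.1 *ᵥ (X.1 *ᵥ v) = X'.1 *ᵥ (g.1.1 *ᵥ v)
      rw [← hg, Matrix.mulVec_mulVec, Matrix.mulVec_mulVec]
      congr 1
      change _ = g.1.1 * X.1 * (g.1⁻¹).1 * g.1.1
      rw [Matrix.mul_assoc _ _ g.1.1, h2, Matrix.mul_one]
  · rintro ⟨e, he, hX⟩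
    have h1 : LinearMap.toMatrix' e.toLinearMap * LinearMap.toMatrix' e.symm.toLinearMap = 1 := by
      rw [← LinearMap.toMatrix'_comp]; simp
    have h2 : LinearMap.toMatrix' e.symm.toLinearMap * LinearMap.toMatrix' e.toLinearMap = 1 := by
      rw [← LinearMap.toMatrix'_comp]; simp
    set g : GL (Fin n) K := ⟨_, _, h1, h2⟩
    have hg : g ∈ unitary k K n := by
      change adj k g.1 * J K n * g.1 = J K n
      ext r s
      rw [Matrix.mul_assoc, Matrix.mul_apply]
      simp only [J_mul]
      have := he (Pi.single r 1) (Pi.single s 1)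
      rw [single_stdForm, stdForm_apply] at this
      have hcol : ∀ i r, g.1 i r = e (Pi.single r 1) i := fun i r => by
        change LinearMap.toMatrix' e.toLinearMap i r = _
        rw [LinearMap.toMatrix'_apply]
        rfl
      simp only [adj, Matrix.transpose_apply, Matrix.map_apply, hcol]
      refine this.trans ?_
      simp only [J, Pi.single_apply, eq_comm]
    refine Quotient.sound (s := orbitSetoid k K n) ⟨⟨g, hg⟩, Subtype.ext ?_⟩
    change g.1 * X.1 * (g⁻¹).1 = X'.1
    have h3 : g.1 * X.1 = X'.1 * g.1 := by
      apply (Matrix.toLin' (R := K)).injective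
      refine LinearMap.ext fun v => ?_
      rw [Matrix.toLin'_mul, Matrix.toLin'_mul]
      have hge : Matrix.toLin' g.1 = e.toLinearMap := Matrix.toLin'_toMatrix' _
      rw [hge]
      exact hX v
    have h4 : g.1 * (g⁻¹).1 = 1 := h1
    rw [h3, Matrix.mul_assoc, h4, Matrix.mul_one]

variable (K n) in
/-- Assemble a vector of length `2n + 2` from its first, middle and last coordinates. -/
def assemble : (K × (Fin (2 * n) → K) × K) ≃ₗ[K] (Fin (2 * (n + 1)) → K) where
  toFun p := Fin.cons (n := 2 * n + 1) (α := fun _ => K) p.1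
    (Fin.snoc (n := 2 * n) (α := fun _ => K) p.2.1 p.2.2)
  invFun v := (v (0 : Fin (2 * n + 1 + 1)),
    (fun i => v (Fin.castSucc i : Fin (2 * n + 1)).succ), v (Fin.last (2 * n)).succ)
  map_add' p p' := by
    funext i
    change Fin (2 * n + 1 + 1) at i
    refine Fin.cases ?_ (fun i => Fin.lastCases ?_ (fun i => ?_) i) i <;> simp
  map_smul' c p := by
    funext i
    change Fin (2 * n + 1 + 1) at i
    refine Fin.cases ?_ (fun i => Fin.lastCases ?_ (fun i => ?_) i) i <;> simp
  left_inv p := by simp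
  right_inv v := by
    funext i
    change Fin (2 * n + 1 + 1) at i
    refine Fin.cases ?_ (fun i => Fin.lastCases ?_ (fun i => ?_) i) i <;> simp

/-- The two outer coordinates span a hyperbolic plane orthogonal to the middle. -/
lemma stdForm_assemble (p p' : K × (Fin (2 * n) → K) × K) :
    stdForm k K (2 * (n + 1)) (assemble K n p) (assemble K n p') =
      conj k K p.1 * p'.2.2 + stdForm k K (2 * n) p.2.1 p'.2.1 + conj k K p.2.2 * p'.1 := by
  have h : ∀ f : Fin (2 * n + 1 + 1) → K, ∑ i : Fin (2 * (n + 1)), f i =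
      f 0 + ((∑ i : Fin (2 * n), f (Fin.castSucc i).succ) + f (Fin.last (2 * n)).succ) := by
    intro f
    exact (Fin.sum_univ_succ f).trans (by rw [Fin.sum_univ_castSucc])
  rw [stdForm_apply]
  refine (h (fun i => conj k K ((assemble K n p) i) * (assemble K n p') (Fin.rev i))).trans ?_
  have e1 : (0 : Fin (2 * n + 1 + 1)).rev = (Fin.last (2 * n)).succ := Fin.rev_zero _
  have e2 : ∀ i : Fin (2 * n), (Fin.castSucc i).succ.rev = (Fin.castSucc i.rev).succ := by
    intro i
    rw [Fin.rev_succ, Fin.rev_castSucc, Fin.succ_castSucc]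
  have e3 : (Fin.last (2 * n)).succ.rev = (0 : Fin (2 * n + 1 + 1)) := by
    rw [Fin.rev_succ, Fin.rev_last]; rfl
  rw [e1, e3, stdForm_apply]
  simp only [e2]
  simp [assemble, -FiniteField.frobeniusAlgHom_apply]
  ring

lemma toLin'_extend (X : Matrix (Fin (2 * n)) (Fin (2 * n)) K) (x : Fin (2 * n) → K) (y : K)
    (p : K × (Fin (2 * n) → K) × K) :
    assemble K n (extEnd (stdForm k K (2 * n)) (Matrix.toLin' X) x y p) =
      Matrix.toLin' (extend k X x y) (assemble K n p) := by
  have h : ∀ f : Fin (2 * n + 1 + 1) → K, ∑ i : Fin (2 * (n + 1)), f i =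
      f 0 + ((∑ i : Fin (2 * n), f (Fin.castSucc i).succ) + f (Fin.last (2 * n)).succ) := by
    intro f
    exact (Fin.sum_univ_succ f).trans (by rw [Fin.sum_univ_castSucc])
  funext i
  rw [Matrix.toLin'_apply, Matrix.mulVec, dotProduct]
  refine Eq.trans ?_ (h (fun j => extend k X x y i j * assemble K n p j)).symm
  change Fin (2 * n + 1 + 1) at i
  refine Fin.cases ?_ (fun i => Fin.lastCases ?_ (fun i => ?_) i) i
  · simp [assemble, extend, extEnd, adj, mul_J, stdForm_apply, -FiniteField.frobeniusAlgHom_apply]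
    rw [Fintype.sum_equiv Fin.revPerm (fun i => conj k K (x i) * p.2.1 i.rev)
      (fun i => conj k K (x i.rev) * p.2.1 i) fun i => by rw [Fin.revPerm_apply, Fin.rev_rev],
      mul_comm p.2.2]
  · simp [assemble, extend, extEnd]
  · simp [assemble, extend, extEnd, Matrix.mulVec, dotProduct, mul_comm]

lemma extend_mem_lie (hinv : ∀ x : K, conj k K (conj k K x) = x)
    {X : Matrix (Fin (2 * n)) (Fin (2 * n)) K} (hX : X ∈ lie k K (2 * n))
    (x : Fin (2 * n) → K) {y : K} (hy : conj k K y = -y) :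
    extend k X x y ∈ lie k K (2 * (n + 1)) := by
  rw [mem_lie_iff_form] at hX ⊢
  intro u v
  obtain ⟨p, rfl⟩ := (assemble K n).surjective u
  obtain ⟨p', rfl⟩ := (assemble K n).surjective v
  rw [← toLin'_extend, ← toLin'_extend, stdForm_assemble, stdForm_assemble]
  have h := stdForm_herm (k := k) hinv x p.2.1
  simp only [extEnd, LinearMap.coe_mk, AddHom.coe_mk, map_add, map_neg, map_mul, h, hy, hX,
    LinearMap.add_apply, map_smulₛₗ, LinearMap.smul_apply, smul_eq_mul, map_zero, RingHom.id_apply]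
  change _ + (_ + conj k K p.2.2 * _) + _ = _
  ring

end Standard

/-! ## Nilpotent orbits and their extensions -/

section Orbits

variable {k K : Type*} [Field k] [Fintype k] [Field K] [Algebra k K] {n : ℕ}

variable (k K) in
/-- The elements `y` of `K` with `y ^ q = -y`. -/
abbrev Skew := {y : K // (conj k K : K →+* K) y = -y}

variable (k K) in
/-- The hypothesis that `x ↦ x ^ q` is the involution of a quadratic extension. -/
abbrev IsQuad : Prop := IsQuadConj (conj k K : K →+* K) (Fintype.card k)

/-- The extension of an element of `𝔲(2n)` to one of `𝔲(2n + 2)`. -/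
def extLie (hq : IsQuad k K) (X : lie k K (2 * n)) (x : Fin (2 * n) → K) (y : Skew k K) :
    lie k K (2 * (n + 1)) :=
  ⟨extend k X.1 x y.1, extend_mem_lie hq.invol X.2 x y.2⟩

/-- The Jordan type of an orbit. -/
def orbitType : Orbits k K n → YoungDiagram :=
  Quotient.lift (fun X : lie k K n => jordanType (Matrix.toLin' X.1)) fun X X' h => by
    obtain ⟨e, -, he⟩ := orbit_eq_iff.1 (Quotient.sound h)
    exact jordanType_eq_of_equiv e he

lemma isNilp_orbit_iff {X : lie k K n} : IsNilp k (orbit k X) ↔ IsNilpotent X.1 := by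
  refine ⟨fun h => h X rfl, fun h X' hX' => ?_⟩
  obtain ⟨e, -, he⟩ := orbit_eq_iff.1 hX'.symm
  rw [← Matrix.isNilpotent_toLin'_iff] at h ⊢
  exact isNilpotent_of_equiv e he h

lemma isHermSys_toLin' (hq : IsQuad k K) {X : lie k K n} (hX : IsNilpotent X.1) :
    IsHermSys (stdForm k K n) (Matrix.toLin' X.1) where
  herm := stdForm_herm hq.invol
  nondeg := stdForm_nondeg
  skew := mem_lie_iff_form.1 X.2
  nilp := (Matrix.isNilpotent_toLin'_iff _).2 hX

lemma isNilpotent_extLie_iff (hq : IsQuad k K) {X : lie k K (2 * n)} {x : Fin (2 * n) → K}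
    {y : Skew k K} : IsNilpotent (extLie hq X x y).1 ↔ IsNilpotent X.1 := by
  have h := toLin'_extend (k := k) X.1 x y.1
  rw [← Matrix.isNilpotent_toLin'_iff, ← Matrix.isNilpotent_toLin'_iff (A := X.1),
    ← isNilpotent_extEnd_iff (H := stdForm k K (2 * n)) (x := x) (y := y.1)]
  constructor
  · refine isNilpotent_of_equiv (assemble K n).symm fun v => ?_
    obtain ⟨p, rfl⟩ := (assemble K n).surjective v
    rw [LinearEquiv.symm_apply_eq, LinearEquiv.symm_apply_apply, h]
    rfl
  · exact isNilpotent_of_equiv (assemble K n) h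

lemma orbitType_extLie (hq : IsQuad k K) (X : lie k K (2 * n)) (x : Fin (2 * n) → K)
    (y : Skew k K) : orbitType (orbit k (extLie hq X x y)) =
      jordanType (extEnd (stdForm k K (2 * n)) (Matrix.toLin' X.1) x y.1) :=
  (jordanType_eq_of_equiv (assemble K n) (toLin'_extend X.1 x y.1)).symm

/-- The isometry is extended by the identity on the hyperbolic plane. Consequently the counts in
`link` do not depend on the representative. -/
lemma orbit_extLie_eq (hq : IsQuad k K) {X X' : lie k K (2 * n)}
    (e : (Fin (2 * n) → K) ≃ₗ[K] (Fin (2 * n) → K))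
    (he : ∀ u v, stdForm k K (2 * n) (e u) (e v) = stdForm k K (2 * n) u v)
    (hX : ∀ v, e (Matrix.toLin' X.1 v) = Matrix.toLin' X'.1 (e v)) (x : Fin (2 * n) → K)
    (y : Skew k K) : orbit k (extLie hq X x y) = orbit k (extLie hq X' (e x) y) := by
  rw [orbit_eq_iff]
  set E : (K × (Fin (2 * n) → K) × K) ≃ₗ[K] (K × (Fin (2 * n) → K) × K) :=
    (LinearEquiv.refl K K).prodCongr (e.prodCongr (LinearEquiv.refl K K))
  have hE : ∀ p, E p = (p.1, e p.2.1, p.2.2) := fun p => rfl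
  refine ⟨(assemble K n).symm.trans (E.trans (assemble K n)), fun u v => ?_, fun v => ?_⟩
  · obtain ⟨p, rfl⟩ := (assemble K n).surjective u
    obtain ⟨p', rfl⟩ := (assemble K n).surjective v
    simp only [LinearEquiv.trans_apply, LinearEquiv.symm_apply_apply, stdForm_assemble, hE, he]
  · obtain ⟨p, rfl⟩ := (assemble K n).surjective v
    simp only [LinearEquiv.trans_apply, LinearEquiv.symm_apply_apply]
    have h1 := toLin'_extend (k := k) X.1 x y.1 p
    have h2 := toLin'_extend (k := k) X'.1 (e x) y.1 (E p)
    change assemble K n (E ((assemble K n).symm (Matrix.toLin' (extend k X.1 x y.1) _))) = 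
      Matrix.toLin' (extend k X'.1 (e x) y.1) _
    rw [← h1, ← h2, LinearEquiv.symm_apply_apply]
    congr 1
    rw [hE, hE]
    simp only [extEnd, LinearMap.coe_mk, AddHom.coe_mk, map_add, map_smul, hX, he]

variable [Fintype K]

instance : Fintype (Skew k K) := Fintype.ofFinite _

/-- A sum weighted by `link` is a sum over all extensions of any representative. -/
lemma sum_link (hq : IsQuad k K) (X : lie k K (2 * n)) (F : Orbits k K (2 * (n + 1)) → ℝ) :
    ∑ lam, (link k lam (orbit k X) : ℝ) * F lam =
      ∑ x, ∑ y, F (orbit k (extLie hq X x y)) := by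
  classical
  set X₀ := (orbit k X).out
  obtain ⟨e, he, hX⟩ := orbit_eq_iff.1 (show orbit k X₀ = orbit k X from Quotient.out_eq _)
  have h1 : ∑ x, ∑ y, F (orbit k (extLie hq X x y)) =
      ∑ x, ∑ y, F (orbit k (extLie hq X₀ x y)) := by
    refine (Fintype.sum_equiv e.toEquiv _ _ fun x => ?_).symm
    refine Finset.sum_congr rfl fun y _ => ?_
    rw [orbit_extLie_eq hq e he hX]
    rfl
  have h2 : ∀ lam, link k lam (orbit k X) =
      (Finset.univ.filter fun p : (Fin (2 * n) → K) × Skew k K =>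
        orbit k (extLie hq X₀ p.1 p.2) = lam).card := by
    intro lam
    rw [← Fintype.card_subtype, ← Nat.card_eq_fintype_card]
    exact Nat.card_congr ⟨fun p => ⟨(p.1.1, ⟨p.1.2, p.2.1⟩), p.2.2.2⟩,
      fun p => ⟨(p.1.1, p.1.2.1), p.1.2.2, (extLie hq X₀ p.1.1 p.1.2).2, p.2⟩,
      fun p => rfl, fun p => rfl⟩
  rw [h1, ← Fintype.sum_prod_type',
    ← Finset.sum_fiberwise Finset.univ fun p : (Fin (2 * n) → K) × Skew k K =>
      orbit k (extLie hq X₀ p.1 p.2)]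
  refine Finset.sum_congr rfl fun lam _ => ?_
  rw [h2, ← nsmul_eq_mul, ← Finset.sum_const]
  exact Finset.sum_congr rfl fun p hp => by rw [(Finset.mem_filter.1 hp).2]

lemma link_eq_zero_iff_isNilp (hq : IsQuad k K) {lam : Orbits k K (2 * (n + 1))}
    {mu : Orbits k K (2 * n)} (h : link k lam mu ≠ 0) : IsNilp k lam ↔ IsNilp k mu := by
  obtain ⟨p, hp, hp', rfl⟩ : Nonempty _ := (Nat.card_ne_zero.1 h).1
  conv_rhs => rw [← Quotient.out_eq mu]
  change _ ↔ IsNilp k (orbit k mu.out)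
  rw [isNilp_orbit_iff, isNilp_orbit_iff]
  exact isNilpotent_extLie_iff hq (X := mu.out) (x := p.1) (y := ⟨p.2, hp⟩)

lemma sum_link_orbitType (hq : IsQuad k K) {mu : Orbits k K (2 * n)} (hmu : IsNilp k mu)
    (G : YoungDiagram → ℝ) :
    ∑ lam, (link k lam mu : ℝ) * G (orbitType lam) =
      ∑ j ∈ Finset.range (2 * n + 1),
        (numA (Fintype.card k) (2 * n) (orbitType mu) j * G (addA (orbitType mu) j) +
          numB (Fintype.card k) (2 * n) (orbitType mu) j * G (addB (orbitType mu) j)) := by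
  induction mu using Quotient.inductionOn with
  | h X =>
  have hX : IsNilpotent X.1 := isNilp_orbit_iff.1 hmu
  have h := sum_jordanType_extEnd hq (isHermSys_toLin' hq hX) G
  rw [Module.finrank_fin_fun] at h
  refine (sum_link hq X fun lam => G (orbitType lam)).trans ?_
  simp only [orbitType_extLie]
  exact h

lemma card_orbitType {o : Orbits k K n} (ho : IsNilp k o) : (orbitType o).card = n := by
  induction o using Quotient.inductionOn with
  | h X =>
  have hX : IsNilpotent X.1 := isNilp_orbit_iff.1 ho
  exact (card_jordanType ((Matrix.isNilpotent_toLin'_iff _).2 hX)).trans (Module.finrank_fin_fun K)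

lemma orbitType_injOn (hq : IsQuad k K) {o o' : Orbits k K n} (ho : IsNilp k o)
    (ho' : IsNilp k o') (h : orbitType o = orbitType o') : o = o' := by
  induction o using Quotient.inductionOn with
  | h X =>
  induction o' using Quotient.inductionOn with
  | h X' =>
  have h1 := isHermSys_toLin' hq (isNilp_orbit_iff.1 ho)
  have h2 := isHermSys_toLin' hq (isNilp_orbit_iff.1 ho')
  exact orbit_eq_iff.2 (exists_isometry hq n (Module.finrank_fin_fun K) (Module.finrank_fin_fun K)
    h1 h2 (kerDim_eq_of_jordanType_eq h1.nilp h2.nilp h))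

lemma abs_neg_inv_lt_one {q : ℕ} (hq : 1 < q) : |(-(q : ℝ)⁻¹)| < 1 := by
  have : (1 : ℝ) < q := by exact_mod_cast hq
  rw [abs_neg, abs_of_nonneg (by positivity)]
  exact inv_lt_one_of_one_lt₀ this

lemma one_sub_pow_nonneg {t : ℝ} (ht : |t| < 1) (m : ℕ) : 0 ≤ 1 - t ^ m := by
  rcases m with _ | m
  · simp
  · exact (one_sub_pow_pos ht m).le

lemma xiA_nonneg {q : ℕ} (hq : 1 < q) (μ : YoungDiagram) (j : ℕ) : 0 ≤ xiA (-(q : ℝ)⁻¹) μ j := by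
  have h1 := abs_neg_inv_lt_one hq
  have h2 := (abs_lt.1 h1).1
  rw [xiA]
  refine mul_nonneg (mul_nonneg (by linarith) (by rw [neg_neg]; positivity)) ?_
  split_ifs
  · exact zero_le_one
  · exact one_sub_pow_nonneg h1 _

lemma xiB_nonneg {q : ℕ} (hq : 1 < q) (μ : YoungDiagram) (j : ℕ) : 0 ≤ xiB (-(q : ℝ)⁻¹) μ j := by
  have h1 := abs_neg_inv_lt_one hq
  rw [xiB]
  split_ifs
  · exact zero_le_one
  · exact mul_nonneg (one_sub_pow_nonneg h1 _) (one_sub_pow_nonneg h1 _)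

lemma xiA_ne_zero {q : ℕ} (hq : 1 < q) {μ : YoungDiagram} {j : ℕ} (h : j = 0 ∨ 1 ≤ cmult μ j) :
    xiA (-(q : ℝ)⁻¹) μ j ≠ 0 := by
  have h1 := abs_neg_inv_lt_one hq
  have h2 := (abs_lt.1 h1).1
  have h3 : (0 : ℝ) < q := by positivity
  rw [xiA]
  refine (mul_pos (mul_pos (by linarith) (by rw [neg_neg]; positivity)) ?_).ne'
  split_ifs with hj
  · exact zero_lt_one
  · rw [← Nat.sub_add_cancel (h.resolve_left hj)]
    exact one_sub_pow_pos h1 _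

lemma xiB_ne_zero {q : ℕ} (hq : 1 < q) {μ : YoungDiagram} {j : ℕ} (h : j = 0 ∨ 2 ≤ cmult μ j) :
    xiB (-(q : ℝ)⁻¹) μ j ≠ 0 := by
  have h1 := abs_neg_inv_lt_one hq
  rw [xiB]
  split_ifs with hj
  · exact one_ne_zero
  · obtain ⟨m, hm⟩ := Nat.exists_eq_add_of_le' (h.resolve_left hj)
    rw [hm]
    exact (mul_pos (one_sub_pow_pos h1 _) (one_sub_pow_pos h1 m)).ne'

lemma numA_nonneg {q : ℕ} (hq : 1 < q) (N : ℕ) (μ : YoungDiagram) (j : ℕ) : 0 ≤ numA q N μ j :=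
  mul_nonneg (by positivity) (xiA_nonneg hq μ j)

lemma numB_nonneg {q : ℕ} (hq : 1 < q) (N : ℕ) (μ : YoungDiagram) (j : ℕ) : 0 ≤ numB q N μ j :=
  mul_nonneg (by positivity) (xiB_nonneg hq μ j)

lemma numA_pos {q : ℕ} (hq : 1 < q) (N : ℕ) {μ : YoungDiagram} {j : ℕ}
    (h : j = 0 ∨ 1 ≤ cmult μ j) : 0 < numA q N μ j :=
  mul_pos (by positivity) ((xiA_nonneg hq μ j).lt_of_ne' (xiA_ne_zero hq h))

lemma numB_pos {q : ℕ} (hq : 1 < q) (N : ℕ) {μ : YoungDiagram} {j : ℕ}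
    (h : j = 0 ∨ 2 ≤ cmult μ j) : 0 < numB q N μ j :=
  mul_pos (by positivity) ((xiB_nonneg hq μ j).lt_of_ne' (xiB_ne_zero hq h))

lemma index_le_card {μ : YoungDiagram} {j : ℕ} (h : j = 0 ∨ 1 ≤ cmult μ j) : j ≤ μ.card := by
  rcases h with rfl | h
  · exact Nat.zero_le _
  · by_contra hj
    have h1 := rowLen_zero_le_card (μ := μ)
    have : μ.colLen (j - 1) = 0 := colLen_eq_zero μ (by omega)
    rw [cmult, this] at h
    omega

/-- Every diagram with at least two boxes arises from a smaller one by a two-box step, and the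
number of extensions realizing a given step is positive. No explicit representative is constructed.
-/
lemma exists_orbitType_eq (hq : IsQuad k K) (n : ℕ) (ν : YoungDiagram) (hν : ν.card = 2 * n) :
    ∃ o : Orbits k K (2 * n), IsNilp k o ∧ orbitType o = ν := by
  classical
  induction n generalizing ν with
  | zero =>
    have h0 : IsNilp k (orbit k (0 : lie k K (2 * 0))) := isNilp_orbit_iff.2 IsNilpotent.zero
    refine ⟨_, h0, ?_⟩
    have h1 := card_orbitType h0
    have h2 : ∀ μ : YoungDiagram, μ.card = 0 → μ.cells = ∅ := fun μ h => Finset.card_eq_zero.1 h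
    exact YoungDiagram.ext ((h2 _ h1).trans (h2 _ hν).symm)
  | succ n ih =>
    obtain ⟨μ, j, hμ⟩ := exists_add ν (by omega)
    have hcard : ν.card = μ.card + 2 := by
      rcases hμ with ⟨h, rfl⟩ | ⟨h, rfl⟩
      · exact (twoStep_addA h).card_eq
      · exact (twoStep_addB h).card_eq
    obtain ⟨o, ho, rfl⟩ := ih μ (by omega)
    have hj : j ∈ Finset.range (2 * n + 1) := by
      have : j ≤ (orbitType o).card := by
        rcases hμ with ⟨h, -⟩ | ⟨h, -⟩ <;> exact index_le_card (by omega)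
      rw [Finset.mem_range]
      omega
    -- The indicator of $\nu$ as test function yields the number of extensions of type $\nu$.
    have hsum := sum_link_orbitType hq ho fun μ => if μ = ν then 1 else 0
    have h1 := hq.one_lt
    have hpos : (0 : ℝ) < ∑ j ∈ Finset.range (2 * n + 1),
        (numA (Fintype.card k) (2 * n) (orbitType o) j *
            (if addA (orbitType o) j = ν then 1 else 0) +
          numB (Fintype.card k) (2 * n) (orbitType o) j *
            (if addB (orbitType o) j = ν then 1 else 0)) := by
      have hi : ∀ p : Prop, [Decidable p] → (0 : ℝ) ≤ if p then 1 else 0 := fun p _ => by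
        split_ifs <;> norm_num
      refine Finset.sum_pos' (fun i _ => add_nonneg
        (mul_nonneg (numA_nonneg h1 _ _ _) (hi _)) (mul_nonneg (numB_nonneg h1 _ _ _) (hi _)))
        ⟨j, hj, ?_⟩
      rcases hμ with ⟨h, hν⟩ | ⟨h, hν⟩
      · refine add_pos_of_pos_of_nonneg ?_ (mul_nonneg (numB_nonneg h1 _ _ _) (hi _))
        rw [if_pos hν.symm, mul_one]
        exact numA_pos h1 _ h
      · refine add_pos_of_nonneg_of_pos (mul_nonneg (numA_nonneg h1 _ _ _) (hi _)) ?_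
        rw [if_pos hν.symm, mul_one]
        exact numB_pos h1 _ h
    rw [← hsum] at hpos
    obtain ⟨lam, -, hlam⟩ := Finset.exists_ne_zero_of_sum_ne_zero hpos.ne'
    refine ⟨lam, (link_eq_zero_iff_isNilp hq (mu := o) fun h => hlam ?_).2 ho, ?_⟩
    · rw [h, Nat.cast_zero, zero_mul]
    · by_contra hne
      exact hlam (by rw [if_neg hne, mul_zero])

/-- Nilpotent orbits are classified by partitions. -/
def nilpEquiv (hq : IsQuad k K) (n : ℕ) :
    {o : Orbits k K (2 * n) // IsNilp k o} ≃ {ν : YoungDiagram // ν.card = 2 * n} :=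
  Equiv.ofBijective (fun o => ⟨orbitType o.1, card_orbitType o.2⟩)
    ⟨fun o o' h => Subtype.ext (orbitType_injOn hq o.2 o'.2 (congrArg Subtype.val h)),
      fun ν => by
        obtain ⟨o, ho, h⟩ := exists_orbitType_eq hq n ν.1 ν.2
        exact ⟨⟨o, ho⟩, Subtype.ext h⟩⟩

end Orbits

/-! ## Isomorphisms of cones of harmonic functions -/

lemma nonempty_coneEquiv {E F : Type*} [AddCommGroup E] [Module ℝ E] [AddCommGroup F] [Module ℝ F]
    {C : PointedCone ℝ E} {D : PointedCone ℝ F} (f : E →ₗ[ℝ] F) (g : F →ₗ[ℝ] E)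
    (hf : ∀ x ∈ C, f x ∈ D) (hg : ∀ y ∈ D, g y ∈ C) (hgf : ∀ x ∈ C, g (f x) = x)
    (hfg : ∀ y ∈ D, f (g y) = y) : Nonempty (C ≃ₗ[{c : ℝ // 0 ≤ c}] D) :=
  ⟨{ toFun := fun x => ⟨f x.1, hf _ x.2⟩
     invFun := fun y => ⟨g y.1, hg _ y.2⟩
     map_add' := fun x y => Subtype.ext (f.map_add x.1 y.1)
     map_smul' := fun c x => Subtype.ext (f.map_smul (c : ℝ) x.1)
     left_inv := fun x => Subtype.ext (hgf _ x.2)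
     right_inv := fun y => Subtype.ext (hfg _ y.2) }⟩

/-- Two graphs that differ by a relabelling and a positive gauge have isomorphic cones. -/
lemma nonempty_harmEquiv {Γ Δ : GradedGraph} (e : ∀ n, Γ.V n ≃ Δ.V n) (c : ∀ n, Γ.V n → ℝ)
    (hc : ∀ n v, 0 < c n v)
    (h : ∀ n v (f : Δ.V (n + 1) → ℝ), ∑ w, Γ.weight n w v * (c (n + 1) w * f (e (n + 1) w)) =
      c n v * ∑ w, Δ.weight n w (e n v) * f w) :
    Nonempty (Γ.harm ≃ₗ[{c : ℝ // 0 ≤ c}] Δ.harm) := by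
  have hc' : ∀ n v, c n v ≠ 0 := fun n v => (hc n v).ne'
  let φ : ((n : ℕ) → Γ.V n → ℝ) →ₗ[ℝ] ((n : ℕ) → Δ.V n → ℝ) :=
    { toFun := fun F n v => (c n ((e n).symm v))⁻¹ * F n ((e n).symm v)
      map_add' := fun F G => by funext n v; simp only [Pi.add_apply, mul_add]
      map_smul' := fun r F => by
        funext n v; simp only [Pi.smul_apply, smul_eq_mul, RingHom.id_apply, mul_left_comm] }
  let ψ : ((n : ℕ) → Δ.V n → ℝ) →ₗ[ℝ] ((n : ℕ) → Γ.V n → ℝ) :=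
    { toFun := fun F n v => c n v * F n (e n v)
      map_add' := fun F G => by funext n v; simp only [Pi.add_apply, mul_add]
      map_smul' := fun r F => by
        funext n v; simp only [Pi.smul_apply, smul_eq_mul, RingHom.id_apply, mul_left_comm] }
  have hψφ : ∀ F, ψ (φ F) = F := fun F => by
    funext n v
    change c n v * ((c n ((e n).symm (e n v)))⁻¹ * F n ((e n).symm (e n v))) = _
    rw [Equiv.symm_apply_apply, mul_inv_cancel_left₀ (hc' n v)]
  have hφψ : ∀ F, φ (ψ F) = F := fun F => by
    funext n v
    change (c n ((e n).symm v))⁻¹ * (c n ((e n).symm v) * F n (e n ((e n).symm v))) = _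
    rw [Equiv.apply_symm_apply, inv_mul_cancel_left₀ (hc' n _)]
  have hψ : ∀ F ∈ Δ.harm, ψ F ∈ Γ.harm := fun F hF =>
    ⟨fun n v => mul_nonneg (hc n v).le (hF.1 n _), fun n v => by
      change c n v * F n (e n v) = _
      rw [hF.2 n (e n v)]
      exact (h n v (F (n + 1))).symm⟩
  refine nonempty_coneEquiv φ ψ (fun F hF => ⟨fun n v => ?_, fun n v => ?_⟩) hψ
    (fun F _ => hψφ F) fun F _ => hφψ F
  · exact mul_nonneg (inv_nonneg.2 (hc n _).le) (hF.1 n _)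
  · have h1 := hF.2 n ((e n).symm v)
    have h2 := h n ((e n).symm v) (φ F (n + 1))
    rw [Equiv.apply_symm_apply] at h2
    refine mul_left_cancel₀ (hc' n ((e n).symm v)) ?_
    rw [← h2]
    change c n _ * ((c n _)⁻¹ * F n _) = ∑ w, Γ.weight n w _ * ψ (φ F) (n + 1) w
    rw [mul_inv_cancel_left₀ (hc' n _), hψφ, h1]

/-! ### The nilpotent graph as a gauge transform of the even Young graph -/

section Young

variable {k K : Type*} [Field k] [Fintype k] [Field K] [Algebra k K] [Fintype K]

/-- The level factor `∏_{i<n} q^{4i+1}` of the gauge. -/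
def levelFactor (q : ℝ) (n : ℕ) : ℝ := ∏ i ∈ Finset.range n, q ^ (2 * (2 * i) + 1)

/-- Adding the boxes raises `rowSum` by precisely the exponent of $q^{-1}$ in the count, so the
gauge $q^{n(\mu)}$ removes it. -/
lemma numA_mul_pow {q : ℕ} (hq : 1 < q) (N : ℕ) (μ : YoungDiagram) (j : ℕ) :
    numA q N μ j * (q : ℝ) ^ rowSum (addA μ j) =
      (q : ℝ) ^ (2 * N + 1) * (q : ℝ) ^ rowSum μ * xiA (-(q : ℝ)⁻¹) μ j := by
  have h0 : (q : ℝ) ≠ 0 := by positivity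
  rw [numA]
  by_cases h : xiA (-(q : ℝ)⁻¹) μ j = 0
  · rw [h]; ring
  · rw [rowSum_addA (valid_of_xiA_ne_zero h), pow_add (q : ℝ) (rowSum μ), inv_pow]
    field_simp

lemma numB_mul_pow {q : ℕ} (hq : 1 < q) (N : ℕ) (μ : YoungDiagram) (j : ℕ) :
    numB q N μ j * (q : ℝ) ^ rowSum (addB μ j) =
      (q : ℝ) ^ (2 * N + 1) * (q : ℝ) ^ rowSum μ * xiB (-(q : ℝ)⁻¹) μ j := by
  have h0 : (q : ℝ) ≠ 0 := by positivity
  rw [numB]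
  by_cases h : xiB (-(q : ℝ)⁻¹) μ j = 0
  · rw [h]; ring
  · rw [rowSum_addB (valid_of_xiB_ne_zero h), pow_add (q : ℝ) (rowSum μ), inv_pow, ← add_assoc,
      ← two_mul]
    field_simp

lemma sum_graphUB₀ (hq : IsQuad k K) {n : ℕ} (v : (graphUB₀ k K).V n) (G : YoungDiagram → ℝ) :
    ∑ w : (graphUB₀ k K).V (n + 1), (graphUB₀ k K).weight n w v * G (orbitType w.1) =
      ∑ lam, (link k lam v.1 : ℝ) * G (orbitType lam) := by
  classical
  have h : ∀ lam : Orbits k K (2 * (n + 1)), ¬ IsNilp k lam →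
      (link k lam v.1 : ℝ) * G (orbitType lam) = 0 := by
    intro lam hlam
    have : link k lam v.1 = 0 := by
      by_contra h
      exact hlam ((link_eq_zero_iff_isNilp hq h).2 v.2)
    rw [this, Nat.cast_zero, zero_mul]
  rw [← Finset.sum_subset (Finset.subset_univ (Finset.univ.filter fun lam => IsNilp k lam))
    fun lam _ hlam => h lam (by simpa using hlam)]
  symm
  exact Finset.sum_subtype _ (by simp) fun lam => (link k lam v.1 : ℝ) * G (orbitType lam)

/-- The gauge has two parts: $q^{n(\mu)}$ takes care of the dependence on the diagrams, and
`levelFactor` of the remaining factor $q^{4n+1}$ of each level. -/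
lemma nonempty_harm₀_equiv (hq : IsQuad k K) :
    Nonempty ((graphUB₀ k K).harm ≃ₗ[{c : ℝ // 0 ≤ c}]
      (evenYoungGraph (-(Fintype.card k : ℝ)⁻¹)).harm) := by
  classical
  have h1 := hq.one_lt
  set q := Fintype.card k
  have h0 : (0 : ℝ) < q := by positivity
  have hl : ∀ n, 0 < levelFactor q n := fun n => Finset.prod_pos fun i _ => pow_pos h0 _
  refine nonempty_harmEquiv (nilpEquiv hq)
    (fun n v => (levelFactor q n)⁻¹ * (q : ℝ) ^ rowSum (orbitType v.1))
    (fun n v => mul_pos (inv_pos.2 (hl n)) (pow_pos h0 _)) fun n v f => ?_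
  set f' : YoungDiagram → ℝ := fun ν => if h : ν.card = 2 * (n + 1) then f ⟨ν, h⟩ else 0
  have hf' : ∀ w : (evenYoungGraph (-(q : ℝ)⁻¹)).V (n + 1), f w = f' w.1 := fun w => by
    have : f' w.1 = f ⟨w.1, w.2⟩ := dif_pos w.2
    exact this.symm
  simp only [hf']
  rw [sum_evenYoungGraph (abs_neg_inv_lt_one h1)]
  refine ((sum_graphUB₀ hq v fun ν => (levelFactor q (n + 1))⁻¹ * (q : ℝ) ^ rowSum ν * f' ν).trans
    (sum_link_orbitType hq v.2 fun ν => (levelFactor q (n + 1))⁻¹ * (q : ℝ) ^ rowSum ν * f' ν)).trans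
    ?_
  rw [Finset.mul_sum]
  refine Finset.sum_congr rfl fun j _ => ?_
  have hA := numA_mul_pow h1 (2 * n) (orbitType v.1) j
  have hB := numB_mul_pow h1 (2 * n) (orbitType v.1) j
  have hn : levelFactor q (n + 1) = levelFactor q n * (q : ℝ) ^ (2 * (2 * n) + 1) :=
    Finset.prod_range_succ _ _
  have hinv : (levelFactor q (n + 1))⁻¹ * (q : ℝ) ^ (2 * (2 * n) + 1) = (levelFactor q n)⁻¹ := by
    have := (hl n).ne'
    rw [hn]
    field_simp
  change _ = _ * (xiA _ (orbitType v.1) j * f' (addA (orbitType v.1) j) +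
    xiB _ (orbitType v.1) j * f' (addB (orbitType v.1) j))
  rw [← hinv]
  linear_combination (levelFactor q (n + 1))⁻¹ * f' (addA (orbitType v.1) j) * hA +
    (levelFactor q (n + 1))⁻¹ * f' (addB (orbitType v.1) j) * hB

end Young

/-! ## Parabolic induction from the indicator function of zero -/

section Parabolic

variable {k K : Type*} [Field k] [Fintype k] [Field K] [Algebra k K] {n : ℕ}

/-- Transport along an equality of levels. -/
def castLie {a b : ℕ} (h : a = b) (Y : lie k K (2 * a)) : lie k K (2 * b) :=
  cast (congrArg (fun m => ↥(lie k K (2 * m))) h) Y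

lemma castLie_apply {a b : ℕ} (h : a = b) (Y : lie k K (2 * a)) (r s : Fin (2 * b)) :
    (castLie h Y).1 r s = Y.1 (Fin.cast (by rw [h]) r) (Fin.cast (by rw [h]) s) := by
  subst h; rfl

lemma orbit_castLie {a b : ℕ} (h : a = b) (Y : lie k K (2 * a))
    (φ : ∀ m, Orbits k K (2 * m) → ℝ) : φ b (orbit k (castLie h Y)) = φ a (orbit k Y) := by
  subst h; rfl

lemma index_cases {P : Fin (2 * (1 + n)) → Prop} (h0 : P (topIdx 1 n 0))
    (hm : ∀ i, P (midIdx 1 n i)) (hl : P (topIdx 1 n 0).rev) (r : Fin (2 * (1 + n))) : P r := by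
  rcases Nat.lt_or_ge r.1 1 with h | h
  · have : r = topIdx 1 n 0 := Fin.ext (by simp only [topIdx, Fin.val_zero]; omega)
    rwa [this]
  · rcases Nat.lt_or_ge r.1 (1 + 2 * n) with h' | h'
    · have : r = midIdx 1 n ⟨r.1 - 1, by omega⟩ := Fin.ext (by simp only [midIdx]; omega)
      rw [this]
      exact hm _
    · have : r = (topIdx 1 n 0).rev := Fin.ext (by
        have := r.2
        simp only [topIdx, Fin.val_rev, Fin.val_zero]
        omega)
      rwa [this]

/-- The extension of an element of `𝔲(2n)`, as an element of `𝔲(2(1 + n))`. -/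
def extLie' (hq : IsQuad k K) (X : lie k K (2 * n)) (x : Fin (2 * n) → K) (y : Skew k K) :
    lie k K (2 * (1 + n)) :=
  castLie (Nat.add_comm n 1) (extLie hq X x y)

section Entries

variable (hq : IsQuad k K) (X : lie k K (2 * n)) (x : Fin (2 * n) → K) (y : Skew k K)

lemma extLie'_apply (r s : Fin (2 * n + 1 + 1)) :
    (extLie' hq X x y).1 (Fin.cast (by omega) r) (Fin.cast (by omega) s) =
      extend k X.1 x y.1 r s :=
  castLie_apply _ _ _ _

lemma topIdx_eq : topIdx 1 n 0 = Fin.cast (by omega) (0 : Fin (2 * n + 1 + 1)) := rfl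

lemma midIdx_eq (i : Fin (2 * n)) :
    midIdx 1 n i = Fin.cast (by omega) (i.castSucc.succ : Fin (2 * n + 1 + 1)) := by
  apply Fin.ext
  simp only [midIdx, Fin.val_cast, Fin.val_succ, Fin.val_castSucc]
  omega

lemma topIdx_rev_eq :
    (topIdx 1 n 0).rev = Fin.cast (by omega) ((Fin.last (2 * n)).succ : Fin (2 * n + 1 + 1)) := by
  apply Fin.ext
  simp only [topIdx, Fin.val_cast, Fin.val_succ, Fin.val_last, Fin.val_rev, Fin.val_zero]
  omega

lemma extLie'_top_top : (extLie' hq X x y).1 (topIdx 1 n 0) (topIdx 1 n 0) = 0 := by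
  rw [topIdx_eq, extLie'_apply]
  simp [extend]

lemma extLie'_mid_top (i : Fin (2 * n)) :
    (extLie' hq X x y).1 (midIdx 1 n i) (topIdx 1 n 0) = 0 := by
  rw [topIdx_eq, midIdx_eq, extLie'_apply]
  simp [extend]

lemma extLie'_mid_mid (i j : Fin (2 * n)) :
    (extLie' hq X x y).1 (midIdx 1 n i) (midIdx 1 n j) = X.1 i j := by
  rw [midIdx_eq, midIdx_eq, extLie'_apply]
  simp [extend]

lemma extLie'_mid_bot (i : Fin (2 * n)) :
    (extLie' hq X x y).1 (midIdx 1 n i) (topIdx 1 n 0).rev = x i := by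
  rw [topIdx_rev_eq, midIdx_eq, extLie'_apply]
  simp [extend]

lemma extLie'_top_bot : (extLie' hq X x y).1 (topIdx 1 n 0) (topIdx 1 n 0).rev = y.1 := by
  rw [topIdx_rev_eq, topIdx_eq, extLie'_apply]
  simp [extend]

lemma extLie'_bot (r : Fin (2 * (1 + n))) :
    (extLie' hq X x y).1 (topIdx 1 n 0).rev r = 0 := by
  rw [topIdx_rev_eq]
  refine (extLie'_apply hq X x y _ (Fin.cast (by omega) r)).trans ?_
  simp [extend]

end Entries

lemma blk_top : blk 1 n (topIdx 1 n 0) = 0 := ((topIdx_spec 1 n).2 _).2 ⟨0, rfl⟩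

lemma blk_mid (i : Fin (2 * n)) : blk 1 n (midIdx 1 n i) = 1 := ((midIdx_spec 1 n).2 _).2 ⟨i, rfl⟩

lemma blk_bot : blk 1 n (topIdx 1 n 0).rev = 2 := by
  rw [blk, if_neg, if_neg] <;> simp only [topIdx, Fin.val_rev, Fin.val_zero] <;> omega

lemma extLie'_blockTriangular (hq : IsQuad k K) (X : lie k K (2 * n)) (x : Fin (2 * n) → K)
    (y : Skew k K) : (extLie' hq X x y).1.BlockTriangular (blk 1 n) := by
  intro r s hrs
  induction r using index_cases with
  | h0 =>
    rw [blk_top] at hrs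
    exact absurd hrs (Nat.not_lt_zero _)
  | hm i =>
    induction s using index_cases with
    | h0 => exact extLie'_mid_top hq X x y i
    | hm j => rw [blk_mid, blk_mid] at hrs; exact absurd hrs (lt_irrefl _)
    | hl => rw [blk_mid, blk_bot] at hrs; omega
  | hl => exact extLie'_bot hq X x y s

lemma topBlock_extLie' (hq : IsQuad k K) (X : lie k K (2 * n)) (x : Fin (2 * n) → K)
    (y : Skew k K) : topBlock k (extLie' hq X x y) = 0 := by
  ext r s
  rw [Subsingleton.elim r 0, Subsingleton.elim s 0]
  exact extLie'_top_top hq X x y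

lemma midBlock_extLie' (hq : IsQuad k K) (X : lie k K (2 * n)) (x : Fin (2 * n) → K)
    (y : Skew k K) : midBlock k (extLie' hq X x y) = X := by
  apply Subtype.ext
  ext r s
  exact extLie'_mid_mid hq X x y r s

/-- The middle part of the first row and the last diagonal entry are determined by the last column
and the first diagonal entry through the skew-Hermitian relation. -/
lemma lie_ext {Y Y' : lie k K (2 * (1 + n))} (hY : Y.1.BlockTriangular (blk 1 n))
    (hY' : Y'.1.BlockTriangular (blk 1 n)) (htop : topBlock k Y = topBlock k Y')
    (hmid : midBlock k Y = midBlock k Y')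
    (hx : ∀ i, Y.1 (midIdx 1 n i) (topIdx 1 n 0).rev = Y'.1 (midIdx 1 n i) (topIdx 1 n 0).rev)
    (hy : Y.1 (topIdx 1 n 0) (topIdx 1 n 0).rev = Y'.1 (topIdx 1 n 0) (topIdx 1 n 0).rev) :
    Y = Y' := by
  have h00 : Y.1 (topIdx 1 n 0) (topIdx 1 n 0) = Y'.1 (topIdx 1 n 0) (topIdx 1 n 0) :=
    congrFun (congrFun htop 0) 0
  have hl := (mem_lie_iff k).1 Y.2
  have hl' := (mem_lie_iff k).1 Y'.2
  apply Subtype.ext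
  ext r s
  induction r using index_cases with
  | h0 =>
    induction s using index_cases with
    | h0 => exact h00
    | hm j => rw [hl, hl', ← midIdx_rev, hx]
    | hl => exact hy
  | hm i =>
    induction s using index_cases with
    | h0 => rw [hY, hY'] <;> rw [blk_mid, blk_top] <;> omega
    | hm j => exact congrFun (congrFun (congrArg Subtype.val hmid) i) j
    | hl => exact hx i
  | hl =>
    induction s using index_cases with
    | h0 => rw [hY, hY'] <;> rw [blk_bot, blk_top] <;> omega
    | hm j => rw [hY, hY'] <;> rw [blk_mid, blk_bot] <;> omega
    | hl => rw [hl, hl', Fin.rev_rev, h00]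

variable [Fintype K]

instance : Fintype (lie k K n) := Fintype.ofFinite _

open Classical in
/-- The sum of an inflated function over `𝔲(2 (1 + n))` as a sum over extensions. -/
lemma sum_inflate (hq : IsQuad k K) (b : lie k K (2 * n) → ℝ) (φ : lie k K (2 * (1 + n)) → ℝ) :
    ∑ Y, inflate k (fun Z : Matrix (Fin 1) (Fin 1) K => if Z = 0 then 1 else 0) b Y * φ Y =
      ∑ X, b X * ∑ x, ∑ y, φ (extLie' hq X x y) := by
  have h : ∑ X, b X * ∑ x, ∑ y, φ (extLie' hq X x y) =
      ∑ p : lie k K (2 * n) × (Fin (2 * n) → K) × Skew k K,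
        b p.1 * φ (extLie' hq p.1 p.2.1 p.2.2) := by
    simp only [Fintype.sum_prod_type, Finset.mul_sum]
  rw [h]
  symm
  refine Fintype.sum_of_injective (fun p => extLie' hq p.1 p.2.1 p.2.2) ?_ _ _ ?_ ?_
  · rintro ⟨X, x, y⟩ ⟨X', x', y'⟩ h
    dsimp only at h
    refine Prod.ext ?_ (Prod.ext (funext fun i => ?_) (Subtype.ext ?_))
    · rw [← midBlock_extLie' hq X x y, h, midBlock_extLie']
    · change x i = x' i
      rw [← extLie'_mid_bot hq X x y, h, extLie'_mid_bot]
    · change y.1 = y'.1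
      rw [← extLie'_top_bot hq X x y, h, extLie'_top_bot]
  · intro Y hY
    rw [inflate]
    split_ifs with h1 h2
    -- A matrix in the support of the inflated function is itself an extension: its last column
    -- supplies $x$ and $y$, and the skewness of $y$ is the Lie algebra relation at the corner.
    · refine absurd ⟨(midBlock k Y, fun i => Y.1 (midIdx 1 n i) (topIdx 1 n 0).rev,
        ⟨Y.1 (topIdx 1 n 0) (topIdx 1 n 0).rev, ?_⟩), ?_⟩ hY
      · have h3 := (mem_lie_iff k).1 Y.2 (topIdx 1 n 0) (topIdx 1 n 0).rev
        rw [Fin.rev_rev] at h3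
        exact neg_eq_iff_eq_neg.1 h3.symm
      · refine lie_ext (extLie'_blockTriangular hq _ _ _) h1 ?_ ?_ (fun i => ?_) ?_
        · rw [topBlock_extLie', h2]
        · rw [midBlock_extLie']
        · rw [extLie'_mid_bot]
        · rw [extLie'_top_bot]
    · rw [zero_mul, zero_mul]
    · rw [zero_mul]
  · rintro ⟨X, x, y⟩
    dsimp only
    rw [inflate, if_pos (extLie'_blockTriangular hq X x y), if_pos (topBlock_extLie' hq X x y),
      midBlock_extLie', one_mul]

lemma orbit_Ad (g : unitary k K n) (X : lie k K n) : orbit k (Ad k g X) = orbit k X :=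
  (Quotient.sound (s := orbitSetoid k K n) ⟨g, rfl⟩).symm

/-- Conjugating the summation variable by a coset representative leaves the invariant function
unchanged, so each coset contributes the same sum. -/
lemma sum_induce {i j : ℕ} (a : Matrix (Fin i) (Fin i) K → ℝ) (b : lie k K (2 * j) → ℝ)
    (φ : Orbits k K (2 * (i + j)) → ℝ) :
    ∑ Y, induce k a b Y * φ (orbit k Y) =
      Fintype.card (unitary k K (2 * (i + j)) ⧸ parabolic k K i j) *
        ∑ Y, inflate k a b Y * φ (orbit k Y) := by
  simp only [induce, Finset.sum_mul]
  rw [Finset.sum_comm, ← nsmul_eq_mul, ← Finset.card_univ, ← Finset.sum_const]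
  refine Finset.sum_congr rfl fun c _ => ?_
  refine Fintype.sum_equiv ⟨Ad k c.out⁻¹, Ad k c.out, fun Y => ?_, fun Y => ?_⟩ _ _ fun Y => ?_
  · rw [← Ad_mul, mul_inv_cancel, Ad_one]
  · rw [← Ad_mul, inv_mul_cancel, Ad_one]
  · rw [Equiv.coe_fn_mk, orbit_Ad]

/-- The number of elements of an orbit. -/
def orbitCard (o : Orbits k K n) : ℝ := Nat.card {X : lie k K n // orbit k X = o}

lemma orbitCard_pos (o : Orbits k K n) : 0 < orbitCard o := by
  have : Nonempty {X : lie k K n // orbit k X = o} := ⟨⟨o.out, Quotient.out_eq _⟩⟩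
  exact Nat.cast_pos.2 Nat.card_pos

lemma sum_orbit (f : Orbits k K n → ℝ) :
    ∑ X : lie k K n, f (orbit k X) = ∑ o, orbitCard o * f o := by
  classical
  rw [← Finset.sum_fiberwise Finset.univ fun X : lie k K n => orbit k X]
  refine Finset.sum_congr rfl fun o _ => ?_
  rw [orbitCard, Nat.card_eq_fintype_card, Fintype.card_subtype, ← nsmul_eq_mul,
    ← Finset.sum_const]
  exact Finset.sum_congr rfl fun X hX => by rw [(Finset.mem_filter.1 hX).2]

end Parabolic

/-! ## Harmonic functionals as harmonic functions -/

section Functionals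

variable {k K : Type*} [Field k] [Fintype k] [Field K] [Algebra k K] [Fintype K]

lemma invU_apply_out {n : ℕ} (b : invU k K n) (X : lie k K n) : b.1 (orbit k X).out = b.1 X := by
  obtain ⟨g, hg⟩ : ∃ g : unitary k K n, Ad k g X = (orbit k X).out :=
    Quotient.exact (Quotient.out_eq (orbit k X)).symm
  rw [← hg]
  exact b.2 g X

/-- An invariant function is a combination of indicator functions of orbits. -/
lemma lof_eq_sum_chi (n : ℕ) (b : invU k K (2 * n)) :
    DirectSum.lof ℝ ℕ (fun n => invU k K (2 * n)) n b =
      ∑ o : Orbits k K (2 * n), b.1 o.out • chi k o := by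
  classical
  simp only [chi, ← map_smul, ← map_sum]
  congr 1
  apply Subtype.ext
  funext X
  rw [← invU_apply_out]
  simp [Finset.sum_apply]

lemma dual_ext {φ ψ : Module.Dual ℝ (B k K)} (h : ∀ (n : ℕ) (o : Orbits k K (2 * n)),
    φ (chi k o) = ψ (chi k o)) : φ = ψ := by
  refine DirectSum.linearMap_ext ℝ fun n => LinearMap.ext fun b => ?_
  rw [LinearMap.comp_apply, LinearMap.comp_apply, lof_eq_sum_chi, map_sum, map_sum]
  exact Finset.sum_congr rfl fun o _ => by rw [map_smul, map_smul, h]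

/-- The number of cosets of the parabolic subgroup with Levi factor `GL(1) × U(2n)`. -/
def cosetCard (k K : Type*) [Field k] [Fintype k] [Field K] [Algebra k K] [Fintype K] (n : ℕ) : ℝ :=
  Fintype.card (unitary k K (2 * (1 + n)) ⧸ parabolic k K 1 n)

lemma cosetCard_pos (n : ℕ) : 0 < cosetCard k K n := Nat.cast_pos.2 Fintype.card_pos

open Classical in
lemma nablaTilde_xOne_lof (n : ℕ) (b : invU k K (2 * n)) :
    ∃ b' : invU k K (2 * (1 + n)), b'.1 = induce k (fun X => if X = 0 then 1 else 0) b.1 ∧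
      nablaTilde k K (xOne K ⊗ₜ[ℝ] DirectSum.lof ℝ ℕ (fun n => invU k K (2 * n)) n b) =
        DirectSum.lof ℝ ℕ (fun n => invU k K (2 * n)) (1 + n) b' := by
  refine ⟨induceLin k K 1 n ⟨fun X => if X = 0 then 1 else 0, fun g X => ?_⟩ b, rfl, ?_⟩
  · simp only [Units.mul_left_eq_zero, Units.mul_right_eq_zero]
  · rw [nablaTilde, TensorProduct.lift.tmul, xOne, DirectSum.toModule_lof, LinearMap.flip_apply,
      DirectSum.toModule_lof, LinearMap.flip_apply, LinearMap.compr₂_apply]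

/-- Expanding in indicators turns $\psi$ into summation over the Lie algebra against
$\psi(\chi_\lambda)/|\lambda|$. Then `sum_induce` removes the cosets, `sum_inflate` leaves a sum
over extensions, and `sum_link` collects these by orbit. -/
lemma apply_nablaTilde_chi (hq : IsQuad k K) (ψ : Module.Dual ℝ (B k K)) {n : ℕ}
    (o : Orbits k K (2 * n)) :
    ψ (nablaTilde k K (xOne K ⊗ₜ[ℝ] chi k o)) = cosetCard k K n * orbitCard o *
      ∑ lam, (link k lam o : ℝ) * (ψ (chi k lam) / orbitCard lam) := by
  classical
  rw [chi]
  obtain ⟨b', hb', h⟩ := nablaTilde_xOne_lof (k := k) (K := K) n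
    ⟨fun X => if orbit k X = o then 1 else 0, fun g X => by simp only [orbit_Ad]⟩
  set φ : ∀ m, Orbits k K (2 * m) → ℝ := fun m lam => ψ (chi k lam) / orbitCard lam
  rw [h, lof_eq_sum_chi, map_sum]
  have h1 : ∀ lam : Orbits k K (2 * (1 + n)), ψ (b'.1 lam.out • chi k lam) =
      orbitCard lam * (b'.1 lam.out * φ _ lam) := by
    intro lam
    have := (orbitCard_pos lam).ne'
    simp only [φ]
    rw [map_smul, smul_eq_mul]
    field_simp
  rw [Finset.sum_congr rfl fun lam _ => h1 lam,
    ← sum_orbit fun lam => b'.1 lam.out * φ (1 + n) lam]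
  simp only [invU_apply_out]
  rw [hb', sum_induce, sum_inflate hq]
  have h2 : ∀ (X : lie k K (2 * n)) x y, φ (1 + n) (orbit k (extLie' hq X x y)) =
      φ (n + 1) (orbit k (extLie hq X x y)) := fun X x y => orbit_castLie _ _ φ
  simp only [h2]
  have h3 : ∀ X : lie k K (2 * n), (∑ x, ∑ y, φ (n + 1) (orbit k (extLie hq X x y))) =
      ∑ lam, (link k lam (orbit k X) : ℝ) * φ (n + 1) lam :=
    fun X => (sum_link hq X (φ (n + 1))).symm
  simp only [h3]
  rw [sum_orbit fun o' => (if o' = o then 1 else 0) *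
    ∑ lam, (link k lam o' : ℝ) * φ (n + 1) lam]
  simp only [ite_mul, one_mul, zero_mul, mul_ite, mul_zero, Finset.sum_ite_eq', Finset.mem_univ,
    if_true]
  rw [cosetCard, mul_assoc]

lemma mem_functionals_iff (hq : IsQuad k K) (ψ : Module.Dual ℝ (B k K)) :
    ψ ∈ functionals k K ↔ (∀ (n : ℕ) (o : Orbits k K (2 * n)), 0 ≤ ψ (chi k o)) ∧
      ∀ (n : ℕ) (o : Orbits k K (2 * n)), ψ (chi k o) = cosetCard k K n * orbitCard o *
        ∑ lam, (link k lam o : ℝ) * (ψ (chi k lam) / orbitCard lam) := by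
  refine and_congr_right fun _ => ?_
  simp only [← apply_nablaTilde_chi hq]
  refine ⟨fun h n o => h _, fun h b => ?_⟩
  have : ψ = ψ ∘ₗ nablaTilde k K ∘ₗ TensorProduct.mk ℝ (A K) (B k K) (xOne K) :=
    dual_ext fun n o => h n o
  exact LinearMap.congr_fun this b

/-- The ratio between the value of a functional on the indicator function of an orbit and the
corresponding value of a harmonic function. -/
def ratio {n : ℕ} (o : Orbits k K (2 * n)) : ℝ :=
  orbitCard o / ∏ i ∈ Finset.range n, cosetCard k K i

lemma ratio_pos {n : ℕ} (o : Orbits k K (2 * n)) : 0 < ratio o :=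
  div_pos (orbitCard_pos o) (Finset.prod_pos fun i _ => cosetCard_pos i)

/-- The functional attached to a function on the vertices of the graph. -/
def toFunctional : ((n : ℕ) → Orbits k K (2 * n) → ℝ) →ₗ[ℝ] Module.Dual ℝ (B k K) where
  toFun F := DirectSum.toModule ℝ ℕ ℝ fun n =>
    ∑ o : Orbits k K (2 * n), (ratio o * F n o) •
      (LinearMap.proj o.out ∘ₗ (invU k K (2 * n)).subtype)
  map_add' F G := by
    refine DirectSum.linearMap_ext ℝ fun n => LinearMap.ext fun b => ?_
    simp [mul_add, add_mul, Finset.sum_add_distrib]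
  map_smul' c F := by
    refine DirectSum.linearMap_ext ℝ fun n => LinearMap.ext fun b => ?_
    simp [Finset.mul_sum, mul_left_comm, mul_assoc]

lemma toFunctional_chi (F : (n : ℕ) → Orbits k K (2 * n) → ℝ) {n : ℕ} (o : Orbits k K (2 * n)) :
    toFunctional F (chi k o) = ratio o * F n o := by
  classical
  have : ∀ o' : Orbits k K (2 * n), orbit k o'.out = o' := fun o' => Quotient.out_eq _
  simp [toFunctional, chi, this]

/-- The function on the vertices of the graph attached to a functional. -/
def ofFunctional : Module.Dual ℝ (B k K) →ₗ[ℝ] ((n : ℕ) → Orbits k K (2 * n) → ℝ) where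
  toFun ψ n o := (ratio o)⁻¹ * ψ (chi k o)
  map_add' φ ψ := by funext n o; simp [mul_add]
  map_smul' c ψ := by funext n o; simp [mul_left_comm]

lemma ofFunctional_toFunctional (F : (n : ℕ) → Orbits k K (2 * n) → ℝ) :
    ofFunctional (toFunctional F) = F := by
  funext n o
  change (ratio o)⁻¹ * toFunctional F (chi k o) = _
  rw [toFunctional_chi, inv_mul_cancel_left₀ (ratio_pos o).ne']

lemma toFunctional_ofFunctional (ψ : Module.Dual ℝ (B k K)) :
    toFunctional (ofFunctional ψ) = ψ := by
  refine dual_ext fun n o => ?_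
  rw [toFunctional_chi]
  exact mul_inv_cancel_left₀ (ratio_pos o).ne' _

/-- In `ratio` the orbit sizes cancel those of the link formula, and the product of coset numbers
absorbs the factor acquired at each level. -/
lemma toFunctional_mem_iff (hq : IsQuad k K) (F : (n : ℕ) → Orbits k K (2 * n) → ℝ) :
    toFunctional F ∈ functionals k K ↔ F ∈ (graphUB k K).harm := by
  rw [mem_functionals_iff hq]
  simp only [toFunctional_chi]
  refine and_congr ?_ ?_
  · exact forall_congr' fun n => forall_congr' fun o => mul_nonneg_iff_of_pos_left (ratio_pos o)
  · refine forall_congr' fun n => forall_congr' fun o => ?_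
    have h1 : ∀ lam : Orbits k K (2 * (n + 1)), ratio lam * F (n + 1) lam / orbitCard lam =
        (∏ i ∈ Finset.range (n + 1), cosetCard k K i)⁻¹ * F (n + 1) lam := by
      intro lam
      have := (orbitCard_pos lam).ne'
      rw [ratio]
      field_simp
    have h2 : cosetCard k K n * orbitCard o *
        ∑ lam, (link k lam o : ℝ) * (ratio lam * F (n + 1) lam / orbitCard lam) =
        ratio o * ∑ lam, (link k lam o : ℝ) * F (n + 1) lam := by
      simp only [h1]
      rw [ratio, Finset.mul_sum, Finset.mul_sum]
      refine Finset.sum_congr rfl fun lam _ => ?_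
      have h3 := (cosetCard_pos (k := k) (K := K) n).ne'
      have h4 : (∏ i ∈ Finset.range n, cosetCard k K i) ≠ 0 :=
        (Finset.prod_pos fun i _ => cosetCard_pos i).ne'
      rw [Finset.prod_range_succ]
      field_simp
    rw [h2]
    exact mul_right_inj' (ratio_pos o).ne'

lemma nonempty_harm_equiv (hq : IsQuad k K) :
    Nonempty ((graphUB k K).harm ≃ₗ[{c : ℝ // 0 ≤ c}] functionals k K) := by
  refine nonempty_coneEquiv toFunctional ofFunctional (fun F hF => (toFunctional_mem_iff hq F).2 hF)
    (fun ψ hψ => (toFunctional_mem_iff hq _).1 ?_) (fun F _ => ofFunctional_toFunctional F)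
    fun ψ _ => toFunctional_ofFunctional ψ
  exact (toFunctional_ofFunctional ψ).symm ▸ hψ

open Classical in
/-- Extension by zero of a function on the nilpotent orbits. -/
def extendZero : ((n : ℕ) → {o : Orbits k K (2 * n) // IsNilp k o} → ℝ) →ₗ[ℝ]
    ((n : ℕ) → Orbits k K (2 * n) → ℝ) where
  toFun F n o := if h : IsNilp k o then F n ⟨o, h⟩ else 0
  map_add' F G := by funext n o; by_cases h : IsNilp k o <;> simp [h]
  map_smul' c F := by funext n o; by_cases h : IsNilp k o <;> simp [h]

/-- Restriction of a function to the nilpotent orbits. -/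
def restrictNilp : ((n : ℕ) → Orbits k K (2 * n) → ℝ) →ₗ[ℝ]
    ((n : ℕ) → {o : Orbits k K (2 * n) // IsNilp k o} → ℝ) where
  toFun F n o := F n o.1
  map_add' _ _ := rfl
  map_smul' _ _ := rfl

lemma restrictNilp_extendZero (F : (n : ℕ) → {o : Orbits k K (2 * n) // IsNilp k o} → ℝ) :
    restrictNilp (extendZero F) = F := by
  funext n o
  exact dif_pos o.2

lemma extendZero_restrictNilp {F : (n : ℕ) → Orbits k K (2 * n) → ℝ}
    (hF : ∀ n o, ¬ IsNilp k o → F n o = 0) : extendZero (restrictNilp F) = F := by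
  funext n o
  by_cases h : IsNilp k o
  · exact dif_pos h
  · exact (dif_neg h).trans (hF n o h).symm

/-- At a nonnilpotent orbit both sides of the harmonicity equation are zero, since all its upper
neighbours are nonnilpotent as well; at a nilpotent orbit the terms at nonnilpotent orbits vanish.
-/
lemma extendZero_mem_iff (hq : IsQuad k K)
    (F : (n : ℕ) → {o : Orbits k K (2 * n) // IsNilp k o} → ℝ) :
    extendZero F ∈ (graphUB k K).harm ↔ F ∈ (graphUB₀ k K).harm := by
  classical
  have h0 : ∀ n o, ¬ IsNilp k o → extendZero F n o = 0 := fun n o h => dif_neg h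
  have h1 : ∀ n (o : {o : Orbits k K (2 * n) // IsNilp k o}), extendZero F n o.1 = F n o :=
    fun n o => dif_pos o.2
  have h2 : ∀ n (o : {o : Orbits k K (2 * n) // IsNilp k o}),
      ∑ lam, (link k lam o.1 : ℝ) * extendZero F (n + 1) lam =
        ∑ lam : {o : Orbits k K (2 * (n + 1)) // IsNilp k o},
          (link k lam.1 o.1 : ℝ) * F (n + 1) lam := by
    intro n o
    simp only [← h1]
    rw [← Finset.sum_subset (Finset.subset_univ (Finset.univ.filter fun lam => IsNilp k lam))
      fun lam _ hlam => by rw [h0 _ _ (by simpa using hlam), mul_zero]]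
    exact Finset.sum_subtype _ (by simp) fun lam => (link k lam o.1 : ℝ) * extendZero F (n + 1) lam
  constructor
  · intro h
    refine ⟨fun n o => ?_, fun n o => ?_⟩
    · rw [← h1 n o]; exact h.1 n o.1
    · rw [← h1 n o]; exact (h.2 n o.1).trans (h2 n o)
  · intro h
    refine ⟨fun n o => ?_, fun n o => ?_⟩
    · by_cases ho : IsNilp k o
      · exact (h.1 n ⟨o, ho⟩).trans_eq (h1 n ⟨o, ho⟩).symm
      · exact (h0 n o ho).ge
    · by_cases ho : IsNilp k o
      · exact (h1 n ⟨o, ho⟩).trans ((h.2 n ⟨o, ho⟩).trans (h2 n ⟨o, ho⟩).symm)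
      · rw [h0 n o ho]
        symm
        refine Finset.sum_eq_zero fun lam _ => ?_
        change (link k lam o : ℝ) * extendZero F (n + 1) lam = 0
        by_cases hl : link k lam o = 0
        · rw [hl, Nat.cast_zero, zero_mul]
        · rw [h0 _ _ fun h => ho ((link_eq_zero_iff_isNilp hq hl).1 h), mul_zero]

lemma nonempty_harm₀_equiv_functionals₀ (hq : IsQuad k K) :
    Nonempty ((graphUB₀ k K).harm ≃ₗ[{c : ℝ // 0 ≤ c}] functionals₀ k K) := by
  have key : ∀ ψ ∈ functionals₀ k K, extendZero (restrictNilp (ofFunctional ψ)) = ofFunctional ψ :=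
    fun ψ hψ => extendZero_restrictNilp fun n o ho => by
      change (ratio o)⁻¹ * ψ (chi k o) = 0
      rw [hψ.2 n o ho, mul_zero]
  refine nonempty_coneEquiv (toFunctional ∘ₗ extendZero) (restrictNilp ∘ₗ ofFunctional)
    (fun F hF => ⟨?_, fun n o ho => ?_⟩) (fun ψ hψ => ?_) (fun F _ => ?_) fun ψ hψ => ?_
  · exact (toFunctional_mem_iff hq _).2 ((extendZero_mem_iff hq F).2 hF)
  · change toFunctional (extendZero F) (chi k o) = 0
    rw [toFunctional_chi, show extendZero F n o = 0 from dif_neg ho, mul_zero]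
  · refine (extendZero_mem_iff hq _).1 ((toFunctional_mem_iff hq _).1 ?_)
    change toFunctional (extendZero (restrictNilp (ofFunctional ψ))) ∈ _
    rw [key ψ hψ, toFunctional_ofFunctional]
    exact hψ.1
  · change restrictNilp (ofFunctional (toFunctional (extendZero F))) = F
    rw [ofFunctional_toFunctional]
    exact restrictNilp_extendZero F
  · change toFunctional (extendZero (restrictNilp (ofFunctional ψ))) = ψ
    rw [key ψ hψ, toFunctional_ofFunctional]

end Functionals

end UB
end

theorem mainTheorem6 {k K : Type*} [Field k] [Fintype k] [Field K] [Fintype K] [Algebra k K]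
    (hodd : Odd (Fintype.card k)) (hdeg : Module.finrank k K = 2) :
    Nonempty ((UB.graphUB k K).harm ≃ₗ[{c : ℝ // 0 ≤ c}] UB.functionals k K) ∧
    Nonempty ((UB.graphUB₀ k K).harm ≃ₗ[{c : ℝ // 0 ≤ c}]
      (UB.evenYoungGraph (-(Fintype.card k : ℝ)⁻¹)).harm) ∧
    Nonempty ((UB.graphUB₀ k K).harm ≃ₗ[{c : ℝ // 0 ≤ c}] UB.functionals₀ k K) := by
  have hq : UB.IsQuad k K := UB.isQuadConj_conj hodd hdeg
  exact ⟨UB.nonempty_harm_equiv hq, UB.nonempty_harm₀_equiv hq,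
    UB.nonempty_harm₀_equiv_functionals₀ hq⟩
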